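/- **Notation.** For a positive non-square integer $D$ put $\delta=\frac{1+\sqrt D}{2}$, $\xi=\frac{\sqrt D-1}{2}$ if $D\equiv 1 \bmod 4$, and $\delta=\xi=\sqrt D$ otherwise. Let $R_D=\mathbb Z[\delta]$ (the ring of integers of $\mathbb Q(\sqrt D)$ when $D$ is squarefree), with norm $N(\cdot)$. An element of $R_D$ is totally positive if it and its conjugate are positive; a totally positive element is indecomposable if it is not a sum of two totally positive elements of $R_D$. Let $\xi=[u_0,u_1,\dots]$ be the simple continued fraction with convergents $p_i/q_i$, $(p_{-1},q_{-1})=(1,0)$; put $\delta_i=p_i+q_i\delta$ for $i\ge -1$ and $\delta_{i,r}=\delta_i+r\,\delta_{i+1}$ for $0\le r\le u_{i+2}$. Let * $N_D=\min\{-N(\alpha):\alpha\in R_D,\ N(\alpha)<0\}$, * $M_D=\max\{N(\delta_{i,r}) : i\ge -1,\ N(\delta_i)>0,\ 0\le r\le u_{i+2}\}$, * $a_D$ the least integer $a\ge 0$ with $a^2\equiv D \bmod N_D$ (mod $4N_D$ if $D\equiv 1\bmod 4$), * $UB(D)=\frac{D-a_D^2}{N_D}$ ($\frac{D-a_D^2}{4N_D}$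 if $D\equiv1\bmod 4$), the (intended) Jang–Kim bound, * $r(D)=\dfrac{M_D-UB(D)}{\sqrt D}$. In a continued fraction the overlined block has minimal period length. **(I) $D\equiv 3\bmod 4$.** For integers $m,n\ge 0$ let $A=256n^2+672n+429$, $B=128n^2+328n+203$, $$D=D(m,n)=\left(2A^2m+3584n^3+13376n^2+16414n+6641\right)\left(2B^2m+896n^3+3232n^2+3822n+1487\right),$$ $u_0=2ABm+1792n^3+6576n^2+7922n+3142$, and $$N_{m,n}=4B^2m+1792n^3+6464n^2+7644n+2974,$$ $$M_{m,n}=(65536n^4+344064n^3+669952n^2+573216n+181892)m+1792n^3+6688n^2+8172n+3282.$$ Then for all $m,n\ge0$: $D$ is positive, not a square, $D\equiv3\bmod4$, and $$\sqrt D=[u_0,\overline{2,8n+10,1,4n+3,1,1,1,1,1,4n+3,1,8n+10,2,2u_0}]\quad(\text{period }14);$$ $N_D=N_{m,n}=-N(\delta_6)$; $\delta_{11,1}$ is indecomposable, $N(\delta_{11,1})=M_{m,n}=M_D$, and this is the largest norm of an indecomposable element of $R_D$. If $N_{m,n}$ is twice a prime, or if $D$ is squarefree, then $a_D=N_{m,n}/2$,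 $$UB(D)=(49152n^4+260096n^3+511680n^2+443408n+142832)m+1344n^3+5072n^2+6296n+2577<M_{m,n},$$ and $r(D)>\rho(n):=\dfrac{16384n^4+83968n^3+158272n^2+129808n+39060}{2AB}$. For all $m,n\ge 0$, $r(D)<\frac14-\frac1{64(n+1)}$, and $r(D)<\frac14-\frac1{64n}$ if $n\ge 26$. For each fixed $n\ge 0$ there are infinitely many $m$ with $N_{m,n}$ twice a prime, and infinitely many $m$ with $D(m,n)$ squarefree. Along the $m$ of these two kinds, $r(D(m,n))\to\rho(n)$ as $m\to\infty$ for fixed $n$; and along the pairs $(m,n)$ of these two kinds $r(D(m,n))\to\frac14$ from below as $n\to\infty$, uniformly in $m$. **(II) $D\equiv 2\bmod 4$.** For positive integers $m,n$ with $(m,n)\ne(1,1)$ let $B=56n^2+184n+151$, $A=112n^2+352n+276$, $$D=(B^2m+1568n^4-5376n^3-52960n^2-102576n-60832)(A^2m+6272n^4-23296n^3-202592n^2-365792n-203234),$$ $u_0=ABm+3136n^4-11200n^3-103640n^2-193808n-111190$, and $$N_{m,n}=(6272n^4+39424n^3+92856n^2+97128n+38070)m+3136n^4-11648n^3-101300n^2-182868n-101569,$$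 $$M_{m,n}=2B^2m+3136n^4-10752n^3-105920n^2-205152n-121664.$$ Then $D$ is positive, not a square, $D\equiv2\bmod 4$ if $m$ is odd and $D\equiv 0\bmod 4$ if $m$ is even, $$\sqrt D=[u_0,\overline{1,n,1,1,1,1,1,7n+10,2,7n+10,1,1,1,1,1,n,1,2u_0}]\quad(\text{period }18);$$ $N_D=N_{m,n}=-N(\delta_4)$; $\max_r N(\delta_{3,r})=N(\delta_{3,0})$; $\delta_{7,1}$ is indecomposable, $N(\delta_{7,1})=M_{m,n}=M_D$, the largest norm of an indecomposable element of $R_D$. If $N_{m,n}$ is prime, then $$M_D-UB(D)=2(784n^4+4592n^3+10027n^2+9672n+3477)m+784n^4-3248n^3-23545n^2-37678n-18553>0.$$ Always $r(D)<\frac14-\frac1{7(n+2)}$. For each $n\ge1$ there are infinitely many odd $m$ with $N_{m,n}$ prime. Along the pairs with $N_{m,n}$ prime, $r(D(m,n))\to\frac14$ from below as $n\to\infty$, uniformly in $m\ge 1$. **(III) $D\equiv 1\bmod 4$ (\*).** For positive integers $m,n$ let $A=64n^2+144n+69$, $B=32n^2+68n+29$, $N_{m,n}=2B^2m+224n^3+608n^2+486n+121$,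 $$D=\left(2A^2m+896n^3+2656n^2+2398n+685\right)N_{m,n},$$ $u_0=ABm+224n^3+636n^2+541n+143$, and $$M_{m,n}=(2048n^4+9216n^3+14624n^2+9576n+2206)m+224n^3+664n^2+582n+159.$$ Then $D$ is positive, not a square, $D\equiv1\bmod4$, and $$\tfrac{\sqrt D-1}2=[u_0,\overline{2,4n+4,1,2n,1,1,1,1,1,2n,1,4n+4,2,2u_0+1}]\quad(\text{period }14);$$ $N_D=N_{m,n}=-N(\delta_6)$; $\max_r N(\delta_{5,r})=N(\delta_{5,0})$; $\delta_{11,1}$ is indecomposable, $N(\delta_{11,1})=M_{m,n}=M_D$, the largest norm of an indecomposable element of $R_D$. If $N_{m,n}$ is prime or $D$ is squarefree, then $$M_D-UB(D)=(512n^4+2176n^3+3080n^2+1612n+246)m+56n^3+152n^2+104n+18>0.$$ Always $r(D)<\frac18-\frac1{64n}$. For each $n\ge1$ there are infinitely many $m$ with $N_{m,n}$ prime, and infinitely many $m$ with $D(m,n)$ squarefree. Along the pairs $(m,n)$ of these two kinds, $r(D(m,n))\to\frac18$ from below as $n\to\infty$, uniformly in $m\ge1$. -/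

import Mathlib

open Filter Topology

namespace JangKim

noncomputable section

/-! ### The quadratic order attached to `D` -/

/-- Trace of `δ`, where `δ = (1 + √D) / 2` if `D ≡ 1 mod 4` and `δ = √D` otherwise. -/
def trDelta (D : ℤ) : ℤ := if D % 4 = 1 then 1 else 0

/-- Minus the norm of `δ`, so that `δ ^ 2 = negNormDelta D + trDelta D * δ`. -/
def negNormDelta (D : ℤ) : ℤ := if D % 4 = 1 then (D - 1) / 4 else D

/-- The order `ℤ[δ]`: `ℤ[(1 + √D) / 2]` if `D ≡ 1 mod 4`, and `ℤ[√D]` otherwise. For squarefree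
`D` it is the ring of integers of `ℚ(√D)`. An element `⟨x, y⟩` stands for `x + y δ`, and
`QuadraticAlgebra.norm` is the norm. -/
abbrev Order (D : ℤ) : Type := QuadraticAlgebra ℤ (negNormDelta D) (trDelta D)

/-- The real number `δ`. -/
def deltaReal (D : ℤ) : ℝ := if D % 4 = 1 then (√(D : ℝ) + 1) / 2 else √(D : ℝ)

/-- The conjugate `δ'` of `δ`. -/
def deltaConj (D : ℤ) : ℝ := if D % 4 = 1 then (1 - √(D : ℝ)) / 2 else -√(D : ℝ)

/-- The real number `ξ = -δ'`. -/
def xi (D : ℤ) : ℝ := if D % 4 = 1 then (√(D : ℝ) - 1) / 2 else √(D : ℝ)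

/-- `x + y δ` is totally positive: it and its conjugate `x + y δ'` are positive. -/
def TotPos {D : ℤ} (α : Order D) : Prop :=
  0 < (α.re : ℝ) + α.im * deltaReal D ∧ 0 < (α.re : ℝ) + α.im * deltaConj D

/-- A totally positive element which is not a sum of two totally positive elements. -/
def Indecomposable {D : ℤ} (α : Order D) : Prop :=
  TotPos α ∧ ¬ ∃ β γ : Order D, TotPos β ∧ TotPos γ ∧ α = β + γ

/-! ### Continued fractions -/

/-- The partial quotient `u_k` of the simple continued fraction expansion of `x`
(and `0` if the expansion stops before index `k`). -/
def partialQuotient (x : ℝ) (k : ℕ) : ℤ :=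
  ((GenContFract.IntFractPair.stream x k).map (fun p => p.b)).getD 0

/-- `x = [u₀, overline{per}]`, and the length of the list `per` is the minimal period length of
the sequence `u₁, u₂, …`. -/
def HasPeriodicExpansion (x : ℝ) (u₀ : ℤ) (per : List ℤ) : Prop :=
  partialQuotient x 0 = u₀ ∧
  (∀ k : ℕ, partialQuotient x (k + 1) = per.getD (k % per.length) 0) ∧
  (∀ t : ℕ, 0 < t → (∀ k : ℕ, partialQuotient x (k + 1 + t) = partialQuotient x (k + 1)) →
    per.length ≤ t)

/-- Numerators of the convergents of `[u 0, u 1, …]`, with the index shifted by one: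
`convNum u (k + 1) = p_k` and `convNum u 0 = p_{-1} = 1`. -/
def convNum (u : ℕ → ℤ) : ℕ → ℤ
  | 0 => 1
  | 1 => u 0
  | k + 2 => u (k + 1) * convNum u (k + 1) + convNum u k

/-- Denominators of the convergents of `[u 0, u 1, …]`, with the index shifted by one:
`convDen u (k + 1) = q_k` and `convDen u 0 = q_{-1} = 0`. -/
def convDen (u : ℕ → ℤ) : ℕ → ℤ
  | 0 => 0
  | 1 => 1
  | k + 2 => u (k + 1) * convDen u (k + 1) + convDen u k

/-- `δ_i = p_i + q_i δ` for `i ≥ -1`, where `p_i / q_i` are the convergents of `ξ`. -/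
def conv (D : ℤ) (i : ℤ) : Order D :=
  ⟨convNum (partialQuotient (xi D)) (i + 1).toNat, convDen (partialQuotient (xi D)) (i + 1).toNat⟩

/-- `δ_{i,r} = p_{i,r} + q_{i,r} δ` for `i ≥ -1`, where
`p_{i,r} / q_{i,r} = [u₀, …, u_{i+1}, r]`; that is, `p_{i,r} = r p_{i+1} + p_i` and
`q_{i,r} = r q_{i+1} + q_i`. -/
def semiconv (D : ℤ) (i r : ℤ) : Order D :=
  ⟨r * (conv D (i + 1)).re + (conv D i).re, r * (conv D (i + 1)).im + (conv D i).im⟩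

/-! ### The quantities `N`, `M`, `a`, the Jang–Kim bound, and `r(D)` -/

/-- The absolute values of the negative norms of elements of the order. -/
def negNorms (D : ℤ) : Set ℤ :=
  {k | 0 < k ∧ ∃ α : Order D, QuadraticAlgebra.norm α = -k}

/-- `N`: minus the largest negative norm. -/
def minNegNorm (D : ℤ) : ℤ := sInf (negNorms D)

/-- The norms of the indecomposable elements. -/
def indecNorms (D : ℤ) : Set ℤ :=
  {k | ∃ α : Order D, Indecomposable α ∧ QuadraticAlgebra.norm α = k}

/-- The norms of all `δ_{i,r}` with `i ≥ -1`, `N(δ_i) > 0` and `0 ≤ r ≤ u_{i+2}`. -/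
def semiconvNorms (D : ℤ) : Set ℤ :=
  {k | ∃ i r : ℤ, -1 ≤ i ∧ 0 < QuadraticAlgebra.norm (conv D i) ∧
    0 ≤ r ∧ r ≤ partialQuotient (xi D) (i + 2).toNat ∧
    QuadraticAlgebra.norm (semiconv D i r) = k}

/-- `M`: the largest of the norms of the `δ_{i,r}` with `N(δ_i) > 0`. -/
def maxNorm (D : ℤ) : ℤ := sSup (semiconvNorms D)

/-- The nonnegative integers `a` with `a² ≡ D mod 4N` if `D ≡ 1 mod 4`, and with
`a² ≡ D mod N` otherwise. -/
def jkRoots (D : ℤ) : Set ℤ :=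
  {a | 0 ≤ a ∧ a ^ 2 ≡ D [ZMOD (if D % 4 = 1 then 4 * minNegNorm D else minNegNorm D)]}

/-- `a`: the smallest element of `jkRoots D`. -/
def jkRoot (D : ℤ) : ℤ := sInf (jkRoots D)

/-- The upper bound of Jang and Kim: `(D - a²) / (4N)` if `D ≡ 1 mod 4`, `(D - a²) / N`
otherwise. -/
def jkBound (D : ℤ) : ℝ :=
  if D % 4 = 1 then ((D : ℝ) - (jkRoot D : ℝ) ^ 2) / (4 * (minNegNorm D : ℝ))
  else ((D : ℝ) - (jkRoot D : ℝ) ^ 2) / (minNegNorm D : ℝ)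

/-- `r(D)`: the excess of `M` over the Jang–Kim bound, divided by `√D`. -/
def excessRatio (D : ℤ) : ℝ := ((maxNorm D : ℝ) - jkBound D) / √(D : ℝ)

/-! ### The family with `D ≡ 3 mod 4` -/

def D₃ (m n : ℤ) : ℤ :=
  (2 * (256 * n ^ 2 + 672 * n + 429) ^ 2 * m
      + 3584 * n ^ 3 + 13376 * n ^ 2 + 16414 * n + 6641) *
    (2 * (128 * n ^ 2 + 328 * n + 203) ^ 2 * m
      + 896 * n ^ 3 + 3232 * n ^ 2 + 3822 * n + 1487)

def u₃ (m n : ℤ) : ℤ :=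
  2 * (128 * n ^ 2 + 328 * n + 203) * (256 * n ^ 2 + 672 * n + 429) * m
    + 1792 * n ^ 3 + 6576 * n ^ 2 + 7922 * n + 3142

def period₃ (m n : ℤ) : List ℤ :=
  [2, 8 * n + 10, 1, 4 * n + 3, 1, 1, 1, 1, 1, 4 * n + 3, 1, 8 * n + 10, 2, 2 * u₃ m n]

def N₃ (m n : ℤ) : ℤ :=
  4 * (128 * n ^ 2 + 328 * n + 203) ^ 2 * m + 1792 * n ^ 3 + 6464 * n ^ 2 + 7644 * n + 2974

def UB₃ (m n : ℤ) : ℤ :=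
  (49152 * n ^ 4 + 260096 * n ^ 3 + 511680 * n ^ 2 + 443408 * n + 142832) * m
    + 1344 * n ^ 3 + 5072 * n ^ 2 + 6296 * n + 2577

def M₃ (m n : ℤ) : ℤ :=
  (65536 * n ^ 4 + 344064 * n ^ 3 + 669952 * n ^ 2 + 573216 * n + 181892) * m
    + 1792 * n ^ 3 + 6688 * n ^ 2 + 8172 * n + 3282

/-- The limit of `r(D₃(m, n))` as `m → ∞` for fixed `n`. -/
def rho₃ (n : ℝ) : ℝ :=
  (16384 * n ^ 4 + 83968 * n ^ 3 + 158272 * n ^ 2 + 129808 * n + 39060) /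
    (2 * (128 * n ^ 2 + 328 * n + 203) * (256 * n ^ 2 + 672 * n + 429))

/-! ### The family with `D ≡ 2 mod 4` (for odd `m`) -/

def D₂ (m n : ℤ) : ℤ :=
  ((56 * n ^ 2 + 184 * n + 151) ^ 2 * m
      + 1568 * n ^ 4 - 5376 * n ^ 3 - 52960 * n ^ 2 - 102576 * n - 60832) *
    ((112 * n ^ 2 + 352 * n + 276) ^ 2 * m
      + 6272 * n ^ 4 - 23296 * n ^ 3 - 202592 * n ^ 2 - 365792 * n - 203234)

def u₂ (m n : ℤ) : ℤ :=
  (56 * n ^ 2 + 184 * n + 151) * (112 * n ^ 2 + 352 * n + 276) * m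
    + 3136 * n ^ 4 - 11200 * n ^ 3 - 103640 * n ^ 2 - 193808 * n - 111190

def period₂ (m n : ℤ) : List ℤ :=
  [1, n, 1, 1, 1, 1, 1, 7 * n + 10, 2, 7 * n + 10, 1, 1, 1, 1, 1, n, 1, 2 * u₂ m n]

def N₂ (m n : ℤ) : ℤ :=
  (6272 * n ^ 4 + 39424 * n ^ 3 + 92856 * n ^ 2 + 97128 * n + 38070) * m
    + 3136 * n ^ 4 - 11648 * n ^ 3 - 101300 * n ^ 2 - 182868 * n - 101569

def M₂ (m n : ℤ) : ℤ :=
  2 * (56 * n ^ 2 + 184 * n + 151) ^ 2 * m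
    + 3136 * n ^ 4 - 10752 * n ^ 3 - 105920 * n ^ 2 - 205152 * n - 121664

/-- The excess of `M₂` over the Jang–Kim bound. -/
def excess₂ (m n : ℤ) : ℤ :=
  2 * (784 * n ^ 4 + 4592 * n ^ 3 + 10027 * n ^ 2 + 9672 * n + 3477) * m
    + 784 * n ^ 4 - 3248 * n ^ 3 - 23545 * n ^ 2 - 37678 * n - 18553

/-! ### The family with `D ≡ 1 mod 4` -/

def D₁ (m n : ℤ) : ℤ :=
  (2 * (64 * n ^ 2 + 144 * n + 69) ^ 2 * m + 896 * n ^ 3 + 2656 * n ^ 2 + 2398 * n + 685) *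
    (2 * (32 * n ^ 2 + 68 * n + 29) ^ 2 * m + 224 * n ^ 3 + 608 * n ^ 2 + 486 * n + 121)

def u₁ (m n : ℤ) : ℤ :=
  (64 * n ^ 2 + 144 * n + 69) * (32 * n ^ 2 + 68 * n + 29) * m
    + 224 * n ^ 3 + 636 * n ^ 2 + 541 * n + 143

def period₁ (m n : ℤ) : List ℤ :=
  [2, 4 * n + 4, 1, 2 * n, 1, 1, 1, 1, 1, 2 * n, 1, 4 * n + 4, 2, 2 * u₁ m n + 1]

def N₁ (m n : ℤ) : ℤ :=
  2 * (32 * n ^ 2 + 68 * n + 29) ^ 2 * m + 224 * n ^ 3 + 608 * n ^ 2 + 486 * n + 121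

def M₁ (m n : ℤ) : ℤ :=
  (2048 * n ^ 4 + 9216 * n ^ 3 + 14624 * n ^ 2 + 9576 * n + 2206) * m
    + 224 * n ^ 3 + 664 * n ^ 2 + 582 * n + 159

/-- The excess of `M₁` over the Jang–Kim bound. -/
def excess₁ (m n : ℤ) : ℤ :=
  (512 * n ^ 4 + 2176 * n ^ 3 + 3080 * n ^ 2 + 1612 * n + 246) * m
    + 56 * n ^ 3 + 152 * n ^ 2 + 104 * n + 18

/-! ### The parameters for which the Jang–Kim bound is computed -/

/-- `N₃(m, n)` is twice a prime, or `D₃(m, n)` is squarefree. -/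
def Good₃ (m n : ℕ) : Prop :=
  (∃ p : ℕ, p.Prime ∧ N₃ m n = 2 * p) ∨ Squarefree (D₃ m n)

/-- `m` is positive and `N₂(m, n)` is a prime. -/
def Good₂ (m n : ℕ) : Prop :=
  0 < m ∧ ∃ p : ℕ, p.Prime ∧ N₂ m n = p

/-- `m` is positive, and `N₁(m, n)` is a prime or `D₁(m, n)` is squarefree. -/
def Good₁ (m n : ℕ) : Prop :=
  0 < m ∧ ((∃ p : ℕ, p.Prime ∧ N₁ m n = p) ∨ Squarefree (D₁ m n))

end

end JangKim

open JangKim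

/-!
In the order `ℤ[δ]` let `δ_i = p_i + q_i δ` be built from the convergents of `ξ = -δ'`. The proof has
three independent ingredients.

*Norm forms.* Given a sequence `u` of positive integers, let `δ_i` be built from `u`. If the norms
of the `δ_i` alternate in sign, then so do the conjugates `δ'_i`, and the positive numbers
`-δ'_{k-2} / δ'_{k-1}` satisfy the recursion of complete quotients; hence `u` is the sequence of
partial quotients of `ξ` (`Admissible.partialQuotient_xi`). The coefficients of the binary forms
`N(x δ_{k-1} + y δ_k)` satisfy a simple recursion (`normForm`), so in each family it suffices to list
the forms as polynomials in `m, n` and to check that they satisfy the recursion, have the right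
signs, and close up after one period (`FormCycle`). As the periods are palindromes, half of a
period is enough (`FormCycle.of_palindrome`).

*Geometry of the chain of semiconvergents.* An element on the side of `δ_i` is a nonnegative integral
combination of two neighbouring semiconvergents `δ_{j,r}`, `δ_{j,r+1}` with `j` of the parity of `i`
(`Admissible.exists_semiconv_combination`); this is the Euclidean algorithm, with the coefficient of
`δ_i` decreasing. For odd `i` it shows that indecomposables are semiconvergents up to conjugation,
and the converse holds because the `δ_i`-coordinate of a totally positive element is at least `1`. For
even `i` it shows that `-N` is smallest at a convergent, because `-N` is superadditive on the cone
`α > 0 > α'` and concave along each chain. Thus `N_D` and `M_D` are an extremum of finitely many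
explicit polynomials, and all comparisons needed are linear in `m` and have nonnegative
coefficients after a shift of the variables.

*The Jang-Kim root.* One form of the cycle exhibits a square root `a` of `D` modulo `N_D` (or
`4 N_D`), and `(D - a²) / N_D` (or a quarter of it) is then always a lower bound for `UB(D)`. If `N_D`
is prime, the roots are `± a`; if `N_D` or `N_D / 2` is a squarefree divisor of `D`, it divides every
root. The infinitude of prime values is Dirichlet's theorem; for squarefree values of a product of two coprime
linear polynomials with odd values, odd squares `> 1` divide at most about `1/4` of the values of
each factor, as `∑ 1 / (2 j + 1)² ≤ ∑ 1 / (4 j (j + 1)) = 1 / 4`.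
-/

open Filter Topology

namespace JangKim

/-! ### Real embeddings of the order -/

/-- The value `x + y δ` of an element of the order. -/
noncomputable def val {D : ℤ} (α : Order D) : ℝ := α.re + α.im * deltaReal D

/-- The value `x + y δ'` of the conjugate of an element of the order. -/
noncomputable def valConj {D : ℤ} (α : Order D) : ℝ := α.re + α.im * deltaConj D

lemma trDelta_eq_zero_or_one (D : ℤ) : trDelta D = 0 ∨ trDelta D = 1 := by
  unfold trDelta; split_ifs <;> simp

lemma deltaReal_add_deltaConj (D : ℤ) : deltaReal D + deltaConj D = trDelta D := by
  unfold deltaReal deltaConj trDelta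
  split_ifs <;> push_cast <;> ring

lemma deltaReal_mul_deltaConj {D : ℤ} (hD : 0 < D) :
    deltaReal D * deltaConj D = -negNormDelta D := by
  have hs : √(D : ℝ) * √(D : ℝ) = D := Real.mul_self_sqrt (by exact_mod_cast hD.le)
  unfold deltaReal deltaConj negNormDelta
  split_ifs with h
  · have h4 : (4 : ℝ) * ((D - 1) / 4 : ℤ) = D - 1 := by
      have : 4 * ((D - 1) / 4) = D - 1 := by omega
      exact_mod_cast this
    nlinarith
  · nlinarith

lemma xi_eq_neg_deltaConj (D : ℤ) : xi D = -deltaConj D := by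
  unfold xi deltaConj
  split_ifs <;> ring

lemma deltaReal_pos {D : ℤ} (hD : 0 < D) : 0 < deltaReal D := by
  have : 0 < √(D : ℝ) := Real.sqrt_pos.2 (by exact_mod_cast hD)
  unfold deltaReal
  split_ifs <;> positivity

lemma deltaConj_lt_deltaReal {D : ℤ} (hD : 0 < D) : deltaConj D < deltaReal D := by
  have : 0 < √(D : ℝ) := Real.sqrt_pos.2 (by exact_mod_cast hD)
  unfold deltaReal deltaConj
  split_ifs <;> linarith

lemma val_add {D : ℤ} (α β : Order D) : val (α + β) = val α + val β := by
  simp only [val, QuadraticAlgebra.re_add, QuadraticAlgebra.im_add]; push_cast; ring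

lemma valConj_add {D : ℤ} (α β : Order D) : valConj (α + β) = valConj α + valConj β := by
  simp only [valConj, QuadraticAlgebra.re_add, QuadraticAlgebra.im_add]; push_cast; ring

lemma norm_eq_val_mul_valConj {D : ℤ} (hD : 0 < D) (α : Order D) :
    ((QuadraticAlgebra.norm α : ℤ) : ℝ) = val α * valConj α := by
  rw [QuadraticAlgebra.norm_def, val, valConj]
  have h1 := deltaReal_add_deltaConj D
  have h2 := deltaReal_mul_deltaConj hD
  push_cast
  linear_combination (-(α.re : ℝ) * α.im) * h1 - (α.im : ℝ) * α.im * h2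

lemma val_star {D : ℤ} (α : Order D) : val (star α) = valConj α := by
  have h1 := deltaReal_add_deltaConj D
  simp only [val, valConj, QuadraticAlgebra.re_star, QuadraticAlgebra.im_star]
  push_cast
  linear_combination (-(α.im : ℝ)) * h1

lemma valConj_star {D : ℤ} (α : Order D) : valConj (star α) = val α := by
  rw [← val_star, star_star]

lemma val_neg {D : ℤ} (α : Order D) : val (-α) = -val α := by
  simp only [val, QuadraticAlgebra.re_neg, QuadraticAlgebra.im_neg]; push_cast; ring

lemma valConj_neg {D : ℤ} (α : Order D) : valConj (-α) = -valConj α := by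
  simp only [valConj, QuadraticAlgebra.re_neg, QuadraticAlgebra.im_neg]; push_cast; ring

lemma totPos_iff {D : ℤ} (α : Order D) : TotPos α ↔ 0 < val α ∧ 0 < valConj α := Iff.rfl

lemma TotPos.star {D : ℤ} {α : Order D} (h : TotPos α) : TotPos (star α) := by
  rw [totPos_iff] at h ⊢
  rw [val_star, valConj_star]
  exact ⟨h.2, h.1⟩

lemma Indecomposable.star {D : ℤ} {α : Order D} (h : Indecomposable α) :
    Indecomposable (star α) := by
  refine ⟨h.1.star, ?_⟩
  rintro ⟨β, γ, hβ, hγ, e⟩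
  refine h.2 ⟨Star.star β, Star.star γ, hβ.star, hγ.star, ?_⟩
  rw [← star_add, ← e, star_star]

/-! ### Convergents and complete quotients -/

/-- The element `p_{k-1} + q_{k-1} δ` of the order attached to the partial quotients `u`. -/
def cv (D : ℤ) (u : ℕ → ℤ) (k : ℕ) : Order D := ⟨convNum u k, convDen u k⟩

/-- The combination `a δ_{k-1} + b δ_k`, where `δ_{k-1} = cv D u k`. -/
def comb (D : ℤ) (u : ℕ → ℤ) (k : ℕ) (a b : ℤ) : Order D :=
  ⟨a * convNum u k + b * convNum u (k + 1), a * convDen u k + b * convDen u (k + 1)⟩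

lemma val_comb {D : ℤ} {u : ℕ → ℤ} {k : ℕ} {a b : ℤ} :
    val (comb D u k a b) = a * val (cv D u k) + b * val (cv D u (k + 1)) := by
  simp only [val, comb, cv]; push_cast; ring

lemma valConj_comb {D : ℤ} {u : ℕ → ℤ} {k : ℕ} {a b : ℤ} :
    valConj (comb D u k a b) = a * valConj (cv D u k) + b * valConj (cv D u (k + 1)) := by
  simp only [valConj, comb, cv]; push_cast; ring

lemma valConj_cv_add_two {D : ℤ} {u : ℕ → ℤ} {k : ℕ} :
    valConj (cv D u (k + 2)) = u (k + 1) * valConj (cv D u (k + 1)) + valConj (cv D u k) := by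
  simp only [valConj, cv, convNum, convDen]; push_cast; ring

/-- The numbers `u k` are positive, and the elements `p_k + q_k δ` built from them have norms of
alternating sign. These conditions force `u` to be the sequence of partial quotients of `ξ`. -/
structure Admissible (D : ℤ) (u : ℕ → ℤ) : Prop where
  pos : 0 < D
  one_le : ∀ k, 1 ≤ u k
  sign : ∀ k, 0 < (-1) ^ k * QuadraticAlgebra.norm (cv D u k)

lemma convNum_pos {u : ℕ → ℤ} (hu : ∀ k, 1 ≤ u k) : ∀ k, 0 < convNum u k
  | 0 => by simp [convNum]
  | 1 => by simpa [convNum] using lt_of_lt_of_le one_pos (hu 0)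
  | k + 2 => by
    have h1 := convNum_pos hu (k + 1)
    have h2 := convNum_pos hu k
    have h3 := hu (k + 1)
    rw [convNum]; positivity

lemma convDen_nonneg {u : ℕ → ℤ} (hu : ∀ k, 1 ≤ u k) : ∀ k, 0 ≤ convDen u k
  | 0 => by simp [convDen]
  | 1 => by simp [convDen]
  | k + 2 => by
    have h1 := convDen_nonneg hu (k + 1)
    have h2 := convDen_nonneg hu k
    have h3 := hu (k + 1)
    rw [convDen]; positivity

lemma conv_det (u : ℕ → ℤ) : ∀ k,
    convNum u k * convDen u (k + 1) - convNum u (k + 1) * convDen u k = (-1) ^ k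
  | 0 => by simp [convNum, convDen]
  | k + 1 => by
    have h := conv_det u k
    rw [convNum, convDen, pow_succ]
    linear_combination (-1) * h

/-- If `x k = u k + 1 / x (k + 1)` with `x k > 1` for `k > 0`, then the `x k` are the complete
quotients of `x 0`. -/
lemma partialQuotient_eq_of_completeQuotients {x : ℕ → ℝ} {u : ℕ → ℤ}
    (h : ∀ k, x k = u k + (x (k + 1))⁻¹) (h1 : ∀ k, 1 < x (k + 1)) (k : ℕ) :
    partialQuotient (x 0) k = u k := by
  have hof : ∀ k, GenContFract.IntFractPair.of (x k) = ⟨u k, (x (k + 1))⁻¹⟩ := by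
    intro k
    have hlt : (x (k + 1))⁻¹ < 1 := inv_lt_one_of_one_lt₀ (h1 k)
    have hpos : 0 < (x (k + 1))⁻¹ := inv_pos.2 (one_pos.trans (h1 k))
    have hfl : ⌊x k⌋ = u k := by
      rw [Int.floor_eq_iff, h k]
      constructor <;> linarith
    rw [GenContFract.IntFractPair.of, Int.fract, hfl]
    congr 1
    rw [h k]; ring
  have key : ∀ k, GenContFract.IntFractPair.stream (x 0) k = some ⟨u k, (x (k + 1))⁻¹⟩ := by
    intro k
    induction k with
    | zero => rw [GenContFract.IntFractPair.stream_zero, hof]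
    | succ k ih =>
      rw [GenContFract.IntFractPair.stream_succ_of_some ih
        (inv_pos.2 (one_pos.trans (h1 k))).ne', inv_inv, hof]
  rw [partialQuotient, key]
  rfl

namespace Admissible

variable {D : ℤ} {u : ℕ → ℤ}

lemma val_cv_pos (h : Admissible D u) (k : ℕ) : 0 < val (cv D u k) := by
  have h1 : (0 : ℝ) < convNum u k := by exact_mod_cast convNum_pos h.one_le k
  have h2 : (0 : ℝ) ≤ convDen u k := by exact_mod_cast convDen_nonneg h.one_le k
  have h3 := deltaReal_pos h.pos
  simp only [val, cv]; positivity

lemma valConj_cv_sign (h : Admissible D u) (k : ℕ) : 0 < (-1) ^ k * valConj (cv D u k) := by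
  have h1 := h.val_cv_pos k
  have h2 : (0 : ℝ) < ((-1) ^ k * QuadraticAlgebra.norm (cv D u k) : ℤ) := by
    exact_mod_cast h.sign k
  push_cast at h2
  rw [norm_eq_val_mul_valConj h.pos] at h2
  have h3 : 0 < val (cv D u k) * ((-1) ^ k * valConj (cv D u k)) := by linarith
  exact (pos_iff_pos_of_mul_pos h3).1 h1

lemma valConj_cv_ne_zero (h : Admissible D u) (k : ℕ) : valConj (cv D u k) ≠ 0 := by
  intro h0
  have := h.valConj_cv_sign k
  simp [h0] at this

lemma valConj_cv_pos (h : Admissible D u) {k : ℕ} (hk : Even k) : 0 < valConj (cv D u k) := by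
  simpa [hk.neg_one_pow] using h.valConj_cv_sign k

lemma valConj_cv_neg (h : Admissible D u) {k : ℕ} (hk : Odd k) : valConj (cv D u k) < 0 := by
  simpa [hk.neg_one_pow] using h.valConj_cv_sign k

/-- The complete quotients of `ξ` are `-δ'_{k-2} / δ'_{k-1}`. -/
lemma partialQuotient_xi (h : Admissible D u) : partialQuotient (xi D) = u := by
  set x : ℕ → ℝ := fun k => match k with
    | 0 => xi D
    | k + 1 => -valConj (cv D u k) / valConj (cv D u (k + 1)) with hx
  have hpos : ∀ k, 0 < x (k + 1) := by
    intro k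
    have h1 := h.valConj_cv_sign k
    have h2 := h.valConj_cv_sign (k + 1)
    have e : x (k + 1) = ((-1) ^ k * valConj (cv D u k)) /
        ((-1) ^ (k + 1) * valConj (cv D u (k + 1))) := by
      have := h.valConj_cv_ne_zero (k + 1)
      simp only [hx, pow_succ]
      field_simp
    rw [e]; positivity
  have hrec : ∀ k, x k = u k + (x (k + 1))⁻¹ := by
    intro k
    cases k with
    | zero =>
      have : valConj (cv D u 0) = 1 := by simp [valConj, cv, convNum, convDen]
      simp only [hx, this, xi_eq_neg_deltaConj]
      simp [valConj, cv, convNum, convDen]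
      ring
    | succ k =>
      have h1 := h.valConj_cv_ne_zero (k + 1)
      have h2 := h.valConj_cv_ne_zero (k + 2)
      have h3 := valConj_cv_add_two (D := D) (u := u) (k := k)
      simp only [hx]
      rw [inv_div, div_eq_iff h1]
      field_simp
      linarith
  have hone : ∀ k, 1 < x (k + 1) := by
    intro k
    have h1 := hpos (k + 1)
    have h2 : (1 : ℝ) ≤ u (k + 1) := by exact_mod_cast h.one_le (k + 1)
    rw [hrec (k + 1)]
    have := inv_pos.2 h1
    linarith
  funext k
  exact partialQuotient_eq_of_completeQuotients hrec hone k

lemma conv_eq (h : Admissible D u) (i : ℤ) : conv D i = cv D u (i + 1).toNat := by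
  rw [conv, h.partialQuotient_xi, cv]

lemma semiconv_eq (h : Admissible D u) {i : ℤ} (hi : -1 ≤ i) (r : ℤ) :
    semiconv D i r = comb D u (i + 1).toNat 1 r := by
  have e : (i + 1 + 1).toNat = (i + 1).toNat + 1 := by omega
  rw [semiconv, h.conv_eq, h.conv_eq, e, comb]
  simp only [cv]
  congr 1 <;> ring

lemma lt_xi (h : Admissible D u) : (u 0 : ℝ) < xi D := by
  have := h.valConj_cv_neg (k := 1) odd_one
  simp only [valConj, cv, convNum, convDen] at this
  rw [xi_eq_neg_deltaConj]
  push_cast at this; linarith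

lemma xi_lt (h : Admissible D u) : xi D < u 0 + 1 := by
  have h1 := h.valConj_cv_neg (k := 1) odd_one
  have h2 := h.valConj_cv_pos (k := 2) even_two
  have h3 : (1 : ℝ) ≤ u 1 := by exact_mod_cast h.one_le 1
  rw [valConj_cv_add_two] at h2
  have h0 : valConj (cv D u 0) = 1 := by simp [valConj, cv, convNum, convDen]
  have e : valConj (cv D u 1) = u 0 - xi D := by
    simp [valConj, cv, convNum, convDen, xi_eq_neg_deltaConj]
  simp only [zero_add] at h2
  rw [h0] at h2
  nlinarith

lemma not_isSquare (h : Admissible D u) : ¬ IsSquare D := by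
  rintro ⟨s, hs⟩
  have h1 := h.lt_xi
  have h2 := h.xi_lt
  have hs' : √(D : ℝ) = |s| := by
    rw [hs]; push_cast; exact Real.sqrt_mul_self_eq_abs _
  have hint : ∃ z : ℤ, xi D = z := by
    unfold xi
    split_ifs with hD
    · have hodd : |s| % 2 = 1 := by
        rcases Int.emod_two_eq_zero_or_one |s| with h0 | h0
        · exfalso
          have : |s| * |s| = D := by rw [abs_mul_abs_self, hs]
          obtain ⟨t, ht⟩ := Int.dvd_of_emod_eq_zero h0
          rw [ht] at this
          have : D = 4 * (t * t) := by linarith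
          omega
        · exact h0
      refine ⟨(|s| - 1) / 2, ?_⟩
      have : 2 * ((|s| - 1) / 2) = |s| - 1 := by omega
      have h2 : (2 : ℝ) * (((|s| - 1) / 2 : ℤ) : ℝ) = ((|s| : ℤ) : ℝ) - 1 := by exact_mod_cast this
      rw [hs']; push_cast at h2 ⊢; linarith
    · exact ⟨|s|, by rw [hs', Int.cast_abs]⟩
  obtain ⟨z, hz⟩ := hint
  rw [hz] at h1 h2
  have h1' : u 0 < z := by exact_mod_cast h1
  have h2' : z < u 0 + 1 := by exact_mod_cast h2
  omega

/-! ### The chain of semiconvergents -/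

/-- Every element `a δ_{k-1} + b δ_k` with `a > 0`, `b ≥ 0` on the same side as `δ_{k-1}` is a
nonnegative combination of two neighbouring semiconvergents `δ_{j-1,r}`, `δ_{j-1,r+1}`. -/
lemma exists_semiconv_combination (h : Admissible D u) (a : ℕ) : ∀ (k : ℕ) (b : ℤ), 0 < a → 0 ≤ b →
    0 < (-1) ^ k * valConj (comb D u k a b) →
    ∃ (j : ℕ) (r c d : ℤ), (Even j ↔ Even k) ∧ 0 ≤ r ∧ r + 1 ≤ u (j + 1) ∧ 0 ≤ c ∧ 0 ≤ d ∧
      0 < c + d ∧ comb D u k a b = comb D u j (c + d) (c * r + d * (r + 1)) := by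
  induction a using Nat.strong_induction_on with
  | _ a ih =>
  intro k b ha hb hs
  have hu := h.one_le (k + 1)
  rcases lt_trichotomy b (u (k + 1) * a) with hlt | heq | hgt
  · have ha' : (0 : ℤ) < a := by exact_mod_cast ha
    refine ⟨k, b / a, a - b % a, b % a, Iff.rfl, Int.ediv_nonneg hb ha'.le, ?_, ?_,
      Int.emod_nonneg _ ha'.ne', by linarith, ?_⟩
    · have : b / a < u (k + 1) := Int.ediv_lt_of_lt_mul ha' hlt
      omega
    · linarith [Int.emod_lt_of_pos b ha']
    · have e := Int.mul_ediv_add_emod b a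
      congr 1
      · ring
      · linear_combination (-1 : ℤ) * e
  · refine ⟨k, u (k + 1) - 1, 0, a, Iff.rfl, by omega, by omega, le_rfl, by positivity,
      by simpa using ha, ?_⟩
    congr 1
    · ring
    · rw [heq]; ring
  · -- Rewrite the element in the basis `δ_{k+1}, δ_{k+2}`: the first coefficient drops.
    obtain ⟨c, hc, rfl⟩ : ∃ c : ℤ, 0 < c ∧ b = u (k + 1) * a + c :=
      ⟨b - u (k + 1) * a, by linarith, by ring⟩
    have hu2 := h.one_le (k + 2)
    have e : comb D u k a (u (k + 1) * a + c) = comb D u (k + 2) (a - c * u (k + 2)) c := by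
      simp only [comb, convNum, convDen]
      congr 1 <;> ring
    have h1 := h.valConj_cv_sign (k + 2)
    have h2 := h.valConj_cv_sign (k + 3)
    have hs' : 0 < (-1) ^ (k + 2) * valConj (comb D u (k + 2) (a - c * u (k + 2)) c) := by
      rw [← e, pow_add]; simpa using hs
    have hpos : 0 < a - c * u (k + 2) := by
      by_contra hcon
      push Not at hcon
      rw [valConj_comb] at hs'
      have hcon' : ((a - c * u (k + 2) : ℤ) : ℝ) ≤ 0 := by exact_mod_cast hcon
      have hc' : (0 : ℝ) < c := by exact_mod_cast hc
      rw [pow_succ] at h2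
      nlinarith [mul_nonneg_of_nonpos_of_nonpos hcon' (neg_nonpos.2 h1.le), mul_pos hc' h2]
    have hlt : a - c * u (k + 2) < a := by nlinarith
    obtain ⟨a', ha'⟩ := Int.eq_ofNat_of_zero_le hpos.le
    have hlt' : a' < a := by omega
    rw [ha'] at e hs'
    obtain ⟨j, r, c', d, hj, hrest⟩ := ih a' hlt' (k + 2) c (by omega) hc.le hs'
    refine ⟨j, r, c', d, ?_, ?_⟩
    · rw [hj, Nat.even_add]; simp
    · rw [e]; exact hrest

lemma totPos_semiconv (h : Admissible D u) {k : ℕ} (hk : Even k) {r : ℤ} (hr : 0 ≤ r)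
    (hr' : r ≤ u (k + 1)) : TotPos (comb D u k 1 r) := by
  rw [totPos_iff, val_comb, valConj_comb]
  have h1 := h.val_cv_pos k
  have h2 := h.val_cv_pos (k + 1)
  have h3 := h.valConj_cv_neg hk.add_one
  have h4 := h.valConj_cv_pos (k := k + 2) (by rw [Nat.even_add]; simp [hk])
  rw [valConj_cv_add_two] at h4
  have hr0 : (0 : ℝ) ≤ r := by exact_mod_cast hr
  have hr1 : (r : ℝ) ≤ u (k + 1) := by exact_mod_cast hr'
  constructor
  · push_cast; positivity
  · push_cast; nlinarith

/-- The coordinates of an element with respect to the basis `δ_{k-1}, δ_k`. -/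
lemma exists_eq_comb (u : ℕ → ℤ) (k : ℕ) (α : Order D) : ∃ a b : ℤ, α = comb D u k a b := by
  have hdet := conv_det u k
  have hsq : ((-1 : ℤ) ^ k) * (-1) ^ k = 1 := by rw [← mul_pow]; simp
  refine ⟨(-1) ^ k * (α.re * convDen u (k + 1) - α.im * convNum u (k + 1)),
    (-1) ^ k * (α.im * convNum u k - α.re * convDen u k), ?_⟩
  ext
  · simp only [comb]
    linear_combination (-α.re) * hsq - (α.re * (-1) ^ k) * hdet
  · simp only [comb]
    linear_combination (-α.im) * hsq - (α.im * (-1) ^ k) * hdet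

/-- For even `k` the coefficient of `δ_{k-1}` is positive on totally positive elements. Hence an
element for which it equals `1` cannot be decomposed. -/
lemma indecomposable_semiconv (h : Admissible D u) {k : ℕ} (hk : Even k) {r : ℤ} (hr : 0 ≤ r)
    (hr' : r ≤ u (k + 1)) : Indecomposable (comb D u k 1 r) := by
  have hcoef : ∀ a b : ℤ, TotPos (comb D u k a b) → 0 < a := by
    intro a b hab
    rw [totPos_iff, val_comb, valConj_comb] at hab
    have h1 := h.val_cv_pos k
    have h2 := h.val_cv_pos (k + 1)
    have h3 := h.valConj_cv_neg hk.add_one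
    have h4 := h.valConj_cv_pos hk
    by_contra hcon
    push Not at hcon
    have hcon' : (a : ℝ) ≤ 0 := by exact_mod_cast hcon
    have hb : (0 : ℝ) < b := by
      by_contra hb
      push Not at hb
      nlinarith [hab.1]
    nlinarith [hab.2]
  refine ⟨h.totPos_semiconv hk hr hr', ?_⟩
  rintro ⟨β, γ, hβ, hγ, e⟩
  obtain ⟨a, b, rfl⟩ := exists_eq_comb u k β
  obtain ⟨a', b', rfl⟩ := exists_eq_comb u k γ
  have ha := hcoef _ _ hβ
  have ha' := hcoef _ _ hγ
  have hre := congrArg QuadraticAlgebra.re e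
  have him := congrArg QuadraticAlgebra.im e
  simp only [comb, QuadraticAlgebra.re_add, QuadraticAlgebra.im_add] at hre him
  have hdet := conv_det u k
  have hz : (1 - a - a') * (-1) ^ k = 0 := by
    rw [← hdet]
    linear_combination convDen u (k + 1) * hre - convNum u (k + 1) * him
  rcases mul_eq_zero.1 hz with h0 | h0
  · omega
  · exact absurd h0 (pow_ne_zero _ (by norm_num))

lemma comb_add (k : ℕ) (a b a' b' : ℤ) :
    comb D u k (a + a') (b + b') = comb D u k a b + comb D u k a' b' := by
  ext <;> simp only [comb, QuadraticAlgebra.re_add, QuadraticAlgebra.im_add] <;> ring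

/-- An indecomposable element with nonnegative `δ`-coordinate is a semiconvergent. -/
lemma exists_eq_semiconv_of_im_nonneg (h : Admissible D u) {α : Order D} (hα : Indecomposable α)
    (him : 0 ≤ α.im) :
    ∃ (k : ℕ) (r : ℤ), Even k ∧ 0 ≤ r ∧ r ≤ u (k + 1) ∧ α = comb D u k 1 r := by
  have e0 : α = comb D u 0 (α.re - u 0 * α.im) α.im := by
    ext <;> simp [comb, convNum, convDen]
    ring
  have htp := hα.1
  have hpos : 0 < α.re - u 0 * α.im := by
    have h1 := htp.2
    have h2 := h.lt_xi
    rw [xi_eq_neg_deltaConj] at h2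
    have h3 : (0 : ℝ) ≤ α.im := by exact_mod_cast him
    have : (0 : ℝ) < ((α.re - u 0 * α.im : ℤ) : ℝ) := by
      push_cast; nlinarith
    exact_mod_cast this
  obtain ⟨a, ha⟩ := Int.eq_ofNat_of_zero_le hpos.le
  rw [ha] at e0
  have hs : 0 < (-1) ^ 0 * valConj (comb D u 0 (a : ℕ) α.im) := by
    have := htp.2
    rw [pow_zero, one_mul, ← e0]; exact this
  obtain ⟨j, r, c, d, hj, hr, hr', hc, hd, hcd, e⟩ :=
    h.exists_semiconv_combination a 0 α.im (by omega) him hs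
  have hjE : Even j := by rw [hj]; simp
  rw [e] at e0
  -- Two or more summands would give a decomposition.
  have hadd : ∀ {β γ : Order D}, TotPos β → TotPos γ → TotPos (β + γ) := by
    intro β γ hβ hγ
    rw [totPos_iff] at *
    rw [val_add, valConj_add]
    exact ⟨add_pos hβ.1 hγ.1, add_pos hβ.2 hγ.2⟩
  have hv := h.totPos_semiconv hjE hr (by omega)
  have hw := h.totPos_semiconv hjE (r := r + 1) (by omega) hr'
  have htot : ∀ n : ℕ, ∀ c d : ℤ, 0 ≤ c → 0 ≤ d → c + d = n + 1 →
      TotPos (comb D u j (c + d) (c * r + d * (r + 1))) := by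
    intro n
    induction n with
    | zero =>
      intro c d hc hd hcd
      rcases (by omega : (c = 1 ∧ d = 0) ∨ (c = 0 ∧ d = 1)) with ⟨rfl, rfl⟩ | ⟨rfl, rfl⟩
      · simpa using hv
      · simpa using hw
    | succ n ih =>
      intro c d hc hd hcd
      rcases eq_or_lt_of_le hc with rfl | hc'
      · have := hadd hw (ih 0 (d - 1) le_rfl (by omega) (by omega))
        rw [← comb_add] at this
        convert this using 2 <;> ring
      · have := hadd hv (ih (c - 1) d (by omega) hd (by push_cast at hcd; omega))
        rw [← comb_add] at this
        convert this using 2 <;> ring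
  have hone : c + d = 1 := by
    by_contra hne
    obtain ⟨n, hn⟩ := Int.eq_ofNat_of_zero_le (by omega : 0 ≤ c + d - 2)
    refine hα.2 ?_
    rcases eq_or_lt_of_le hc with rfl | hc'
    · refine ⟨_, _, hw, htot n 0 (d - 1) le_rfl (by omega) (by omega), ?_⟩
      rw [← comb_add, e0]
      congr 1 <;> ring
    · refine ⟨_, _, hv, htot n (c - 1) d (by omega) hd (by omega), ?_⟩
      rw [← comb_add, e0]
      congr 1 <;> ring
  rcases (by omega : (c = 1 ∧ d = 0) ∨ (c = 0 ∧ d = 1)) with ⟨rfl, rfl⟩ | ⟨rfl, rfl⟩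
  · exact ⟨j, r, hjE, hr, by omega, by simpa using e0⟩
  · exact ⟨j, r + 1, hjE, by omega, hr', by simpa using e0⟩

/-- Up to conjugation the indecomposable elements are semiconvergents. -/
lemma norm_mem_of_indecomposable (h : Admissible D u) {α : Order D} (hα : Indecomposable α) :
    ∃ (k : ℕ) (r : ℤ), Even k ∧ 0 ≤ r ∧ r ≤ u (k + 1) ∧
      QuadraticAlgebra.norm α = QuadraticAlgebra.norm (comb D u k 1 r) := by
  rcases le_total 0 α.im with h0 | h0
  · obtain ⟨k, r, hk, hr, hr', e⟩ := h.exists_eq_semiconv_of_im_nonneg hα h0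
    exact ⟨k, r, hk, hr, hr', by rw [← e]⟩
  · obtain ⟨k, r, hk, hr, hr', e⟩ := h.exists_eq_semiconv_of_im_nonneg hα.star
      (by simpa using h0)
    exact ⟨k, r, hk, hr, hr', by rw [← e, QuadraticAlgebra.norm_star]⟩

end Admissible

/-! ### Norm forms along the expansion -/

/-- The change of the form `(A, B, C) = A x² + B x y + C y²` under `(x, y) ↦ (y, x + v y)`. -/
def stepForm (v : ℤ) (f : ℤ × ℤ × ℤ) : ℤ × ℤ × ℤ :=
  (f.2.2, f.2.1 + 2 * v * f.2.2, f.1 + v * f.2.1 + v ^ 2 * f.2.2)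

/-- The coefficients `(A, B, C)` of the norm form `N(x δ_{k-1} + y δ_k) = A x² + B x y + C y²`. -/
def normForm (D : ℤ) (u : ℕ → ℤ) : ℕ → ℤ × ℤ × ℤ
  | 0 => (1, 2 * u 0 + trDelta D, u 0 ^ 2 + trDelta D * u 0 - negNormDelta D)
  | k + 1 => stepForm (u (k + 1)) (normForm D u k)

lemma norm_comb (D : ℤ) (u : ℕ → ℤ) (k : ℕ) : ∀ a b : ℤ,
    QuadraticAlgebra.norm (comb D u k a b) = (normForm D u k).1 * a ^ 2 +
      (normForm D u k).2.1 * (a * b) + (normForm D u k).2.2 * b ^ 2 := by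
  induction k with
  | zero =>
    intro a b
    simp only [QuadraticAlgebra.norm_def, comb, convNum, convDen, normForm]
    ring
  | succ k ih =>
    intro a b
    have e : comb D u (k + 1) a b = comb D u k b (a + u (k + 1) * b) := by
      simp only [comb, convNum, convDen]
      congr 1 <;> ring
    rw [e, ih]
    simp only [normForm, stepForm]
    ring

lemma norm_cv (D : ℤ) (u : ℕ → ℤ) (k : ℕ) :
    QuadraticAlgebra.norm (cv D u k) = (normForm D u k).1 := by
  have := norm_comb D u k 1 0
  simpa [comb, cv] using this

lemma normForm_add_two_fst (D : ℤ) (u : ℕ → ℤ) (k : ℕ) : (normForm D u (k + 2)).1 =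
    (normForm D u k).1 + u (k + 1) * (normForm D u k).2.1
      + u (k + 1) ^ 2 * (normForm D u k).2.2 := rfl

/-- A convex quadratic polynomial on an interval is at most its larger value at the ends. -/
lemma quadratic_le_of_endpoints {A B C v r K : ℤ} (hC : 0 ≤ C) (hr : 0 ≤ r) (hrv : r ≤ v)
    (h0 : A ≤ K) (hv : A + v * B + v ^ 2 * C ≤ K) : A + B * r + C * r ^ 2 ≤ K := by
  rcases eq_or_lt_of_le (hr.trans hrv) with h | h
  · obtain rfl : r = 0 := by omega
    simpa using h0
  · have h1 : v * (A + B * r + C * r ^ 2) ≤ v * K := by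
      nlinarith [mul_nonneg (sub_nonneg.2 hrv) (sub_nonneg.2 h0), mul_nonneg hr (sub_nonneg.2 hv),
        mul_nonneg (mul_nonneg hC (mul_nonneg hr h.le)) (sub_nonneg.2 hrv)]
    exact le_of_mul_le_mul_left h1 h

namespace Admissible

variable {D : ℤ} {u : ℕ → ℤ}

lemma normForm_fst_pos (h : Admissible D u) {k : ℕ} (hk : Even k) : 0 < (normForm D u k).1 := by
  simpa [hk.neg_one_pow, norm_cv] using h.sign k

lemma normForm_fst_neg (h : Admissible D u) {k : ℕ} (hk : Odd k) : (normForm D u k).1 < 0 := by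
  simpa [hk.neg_one_pow, norm_cv] using h.sign k

/-- On the cone `α > 0 > α'` the function `-N` is superadditive, and along a chain of
semiconvergents it is concave; so it is smallest at a convergent. -/
lemma le_neg_norm_comb (h : Admissible D u) {N : ℤ} (hN0 : 0 < N)
    (hN : ∀ k, Odd k → N ≤ -(normForm D u k).1) {k : ℕ} (hk : Odd k) {a b : ℤ} (ha : 0 < a)
    (hb : 0 ≤ b) (hs : valConj (comb D u k a b) < 0) :
    N ≤ -QuadraticAlgebra.norm (comb D u k a b) := by
  obtain ⟨a', rfl⟩ := Int.eq_ofNat_of_zero_le ha.le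
  obtain ⟨j, r, c, d, hj, hr, hr', hc, hd, hcd, e⟩ :=
    h.exists_semiconv_combination a' k b (by omega) hb (by simpa [hk.neg_one_pow] using hs)
  have hjO : Odd j := by rw [← Nat.not_even_iff_odd] at hk ⊢; rwa [hj]
  rw [e]
  have hend := hN j hjO
  have hend2 := hN (j + 2) (by rw [Nat.odd_add]; simp [hjO])
  rw [normForm_add_two_fst] at hend2
  have hC : 0 ≤ (normForm D u j).2.2 := (h.normForm_fst_pos (k := j + 1) hjO.add_one).le
  have hv := quadratic_le_of_endpoints hC hr (by omega : r ≤ u (j + 1)) (le_neg_of_le_neg hend)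
    (le_neg_of_le_neg hend2)
  have hw := quadratic_le_of_endpoints hC (by omega : 0 ≤ r + 1) hr' (le_neg_of_le_neg hend)
    (le_neg_of_le_neg hend2)
  -- The trace of `β γ'` is negative for neighbouring semiconvergents `β`, `γ`.
  have hcross : 2 * (normForm D u j).1 + (normForm D u j).2.1 * (2 * r + 1)
      + 2 * (normForm D u j).2.2 * (r * (r + 1)) ≤ 0 := by
    have h1 := norm_comb D u j 1 r
    have h2 := norm_comb D u j 1 (r + 1)
    have h3 := norm_comb D u j 2 (2 * r + 1)
    have hp : ∀ s : ℤ, 0 ≤ s → s ≤ u (j + 1) →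
        0 < val (comb D u j 1 s) ∧ valConj (comb D u j 1 s) < 0 := by
      intro s hs0 hs1
      rw [val_comb, valConj_comb]
      have g1 := h.val_cv_pos j
      have g2 := h.val_cv_pos (j + 1)
      have g3 := h.valConj_cv_pos hjO.add_one
      have g4 := h.valConj_cv_neg (k := j + 2) (by rw [Nat.odd_add]; simp [hjO])
      rw [valConj_cv_add_two] at g4
      have hr0 : (0 : ℝ) ≤ s := by exact_mod_cast hs0
      have hr1 : (s : ℝ) ≤ u (j + 1) := by exact_mod_cast hs1
      constructor
      · push_cast; positivity
      · push_cast; nlinarith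
    obtain ⟨p1, p2⟩ := hp r hr (by omega)
    obtain ⟨q1, q2⟩ := hp (r + 1) (by omega) hr'
    have e3 : comb D u j 2 (2 * r + 1) = comb D u j 1 r + comb D u j 1 (r + 1) := by
      rw [← comb_add]; congr 1; ring
    have hle : QuadraticAlgebra.norm (comb D u j 2 (2 * r + 1)) ≤
        QuadraticAlgebra.norm (comb D u j 1 r) + QuadraticAlgebra.norm (comb D u j 1 (r + 1)) := by
      have : ((QuadraticAlgebra.norm (comb D u j 2 (2 * r + 1)) : ℤ) : ℝ) ≤
        ((QuadraticAlgebra.norm (comb D u j 1 r) : ℤ) : ℝ) +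
          ((QuadraticAlgebra.norm (comb D u j 1 (r + 1)) : ℤ) : ℝ) := by
        rw [norm_eq_val_mul_valConj h.pos, norm_eq_val_mul_valConj h.pos,
          norm_eq_val_mul_valConj h.pos, e3, val_add, valConj_add]
        nlinarith [mul_neg_of_pos_of_neg p1 q2, mul_neg_of_pos_of_neg q1 p2]
      exact_mod_cast this
    rw [h1, h2, h3] at hle
    linarith
  rw [norm_comb]
  set A := (normForm D u j).1
  set B := (normForm D u j).2.1
  set C := (normForm D u j).2.2
  have key : A * (c + d) ^ 2 + B * ((c + d) * (c * r + d * (r + 1))) + C * (c * r + d * (r + 1)) ^ 2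
      = c ^ 2 * (A + B * r + C * r ^ 2) + d ^ 2 * (A + B * (r + 1) + C * (r + 1) ^ 2)
        + c * d * (2 * A + B * (2 * r + 1) + 2 * C * (r * (r + 1))) := by ring
  rw [key]
  have h1 : c ^ 2 * (A + B * r + C * r ^ 2) ≤ c ^ 2 * (-N) :=
    mul_le_mul_of_nonneg_left hv (sq_nonneg c)
  have h2 : d ^ 2 * (A + B * (r + 1) + C * (r + 1) ^ 2) ≤ d ^ 2 * (-N) :=
    mul_le_mul_of_nonneg_left hw (sq_nonneg d)
  have h3 := mul_nonpos_of_nonneg_of_nonpos (mul_nonneg hc hd) hcross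
  have h4 : 1 ≤ c ^ 2 + d ^ 2 := by
    rcases (by omega : 1 ≤ c ∨ 1 ≤ d) with g | g <;> nlinarith [sq_nonneg c, sq_nonneg d]
  nlinarith

lemma neg_norm_cv_one (D : ℤ) (u : ℕ → ℤ) :
    -(normForm D u 1).1 = negNormDelta D - trDelta D * u 0 - u 0 ^ 2 := by
  simp only [normForm, stepForm]; ring

/-- The lower bound for `-N(x + y δ)` when `x ≥ 0` and `y > 0`. -/
lemma le_neg_norm_of_re_nonneg (h : Admissible D u) {N : ℤ} (hN0 : 0 < N)
    (hN : ∀ k, Odd k → N ≤ -(normForm D u k).1) {α : Order D} (hre : 0 ≤ α.re)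
    (him : 0 < α.im) (hs : valConj α < 0) : N ≤ -QuadraticAlgebra.norm α := by
  have h1 := hN 1 odd_one
  have ht : 0 ≤ trDelta D := by rcases trDelta_eq_zero_or_one D with e | e <;> simp [e]
  have hu0 := h.one_le 0
  rcases lt_or_ge α.re (u 0 * α.im) with hlt | hge
  · rw [neg_norm_cv_one] at h1
    rw [QuadraticAlgebra.norm_def]
    have g1 : α.re * α.re ≤ (u 0 * α.im) * (u 0 * α.im) :=
      mul_self_le_mul_self hre hlt.le
    have g2 : trDelta D * α.im * α.re ≤ trDelta D * α.im * (u 0 * α.im) :=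
      mul_le_mul_of_nonneg_left hlt.le (mul_nonneg ht him.le)
    have g3 : α.im * α.im * N ≤ α.im * α.im *
        (negNormDelta D - trDelta D * u 0 - u 0 ^ 2) :=
      mul_le_mul_of_nonneg_left h1 (mul_self_nonneg _)
    have g4 : 1 * N ≤ α.im * α.im * N := mul_le_mul_of_nonneg_right (by nlinarith) hN0.le
    nlinarith
  · obtain ⟨c, hc⟩ : ∃ c, c = α.re - u 0 * α.im := ⟨_, rfl⟩
    have e : α = comb D u 1 (α.im - u 1 * c) c := by
      ext <;> simp [comb, convNum, convDen, hc] <;> ring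
    have hpos : 0 < α.im - u 1 * c := by
      rw [e, valConj_comb] at hs
      have g1 := h.valConj_cv_neg (k := 1) odd_one
      have g2 := h.valConj_cv_pos (k := 1 + 1) even_two
      by_contra hcon
      push Not at hcon
      have hcon' : ((α.im - u 1 * c : ℤ) : ℝ) ≤ 0 := by exact_mod_cast hcon
      have hc' : (0 : ℝ) ≤ c := by exact_mod_cast (by omega : 0 ≤ c)
      nlinarith [mul_nonneg_of_nonpos_of_nonpos hcon' g1.le, mul_nonneg hc' g2.le]
    rw [e] at hs ⊢
    exact h.le_neg_norm_comb hN0 hN odd_one hpos (by omega) hs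

/-- A lower bound for `-N` at the convergents holds at all elements of negative norm. -/
lemma le_neg_norm (h : Admissible D u) {N : ℤ} (hN0 : 0 < N)
    (hN : ∀ k, Odd k → N ≤ -(normForm D u k).1) {α : Order D} (hα : QuadraticAlgebra.norm α < 0) :
    N ≤ -QuadraticAlgebra.norm α := by
  wlog hpos : 0 < val α generalizing α
  · have hα' : val α * valConj α < 0 := by
      rw [← norm_eq_val_mul_valConj h.pos]; exact_mod_cast hα
    have hne : val α ≠ 0 := by rintro h0; simp [h0] at hα'
    have := this (α := -α) (by rwa [QuadraticAlgebra.norm_neg]) (by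
      rw [val_neg]; push Not at hpos; have := lt_of_le_of_ne hpos hne; linarith)
    rwa [QuadraticAlgebra.norm_neg] at this
  have hα' : val α * valConj α < 0 := by
    rw [← norm_eq_val_mul_valConj h.pos]; exact_mod_cast hα
  have hneg : valConj α < 0 := by
    by_contra hcon
    push Not at hcon
    nlinarith [mul_nonneg hpos.le hcon]
  have him : 0 < α.im := by
    have h1 : valConj α < val α := hneg.trans hpos
    rw [val, valConj] at h1
    have h2 := deltaConj_lt_deltaReal h.pos
    by_contra hcon
    push Not at hcon
    have hcon' : (α.im : ℝ) ≤ 0 := by exact_mod_cast hcon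
    nlinarith
  rcases le_or_gt 0 α.re with hre | hre
  · exact h.le_neg_norm_of_re_nonneg hN0 hN hre him hneg
  rcases le_or_gt 0 (-(α.re + trDelta D * α.im)) with hre' | hre'
  · have := h.le_neg_norm_of_re_nonneg hN0 hN (α := -star α) (by simpa using hre') (by simpa using him)
      (by rw [valConj_neg, valConj_star]; linarith)
    rwa [QuadraticAlgebra.norm_neg, QuadraticAlgebra.norm_star] at this
  · have h1 := hN 1 odd_one
    rw [neg_norm_cv_one] at h1
    have ht : 0 ≤ trDelta D := by rcases trDelta_eq_zero_or_one D with e | e <;> simp [e]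
    have hu0 := h.one_le 0
    rw [QuadraticAlgebra.norm_def]
    have hD0 : N ≤ negNormDelta D := by nlinarith
    have g1 : 0 ≤ (-α.re) * (α.re + trDelta D * α.im) := mul_nonneg (by omega) (by omega)
    have g2 : 1 * N ≤ α.im * α.im * negNormDelta D :=
      mul_le_mul (by nlinarith) hD0 hN0.le (mul_self_nonneg _)
    nlinarith

lemma isLeast_negNorms (h : Admissible D u) {N : ℤ} (hN0 : 0 < N)
    (hN : ∀ k, Odd k → N ≤ -(normForm D u k).1) {k : ℕ} (hk : (normForm D u k).1 = -N) :
    IsLeast (negNorms D) N := by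
  refine ⟨⟨hN0, cv D u k, by rw [norm_cv, hk]⟩, ?_⟩
  rintro x ⟨hx, α, hα⟩
  have := h.le_neg_norm hN0 hN (α := α) (by omega)
  omega

lemma norm_semiconv (h : Admissible D u) {i : ℤ} (hi : -1 ≤ i) (r : ℤ) :
    QuadraticAlgebra.norm (semiconv D i r) = (normForm D u (i + 1).toNat).1 +
      (normForm D u (i + 1).toNat).2.1 * r + (normForm D u (i + 1).toNat).2.2 * r ^ 2 := by
  rw [h.semiconv_eq hi, norm_comb]; ring

lemma isGreatest_semiconvNorms (h : Admissible D u) {M : ℤ}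
    (hM : ∀ k, Even k → ∀ r, 0 ≤ r → r ≤ u (k + 1) → (normForm D u k).1 +
      (normForm D u k).2.1 * r + (normForm D u k).2.2 * r ^ 2 ≤ M)
    {k : ℕ} {r : ℤ} (hk : Even k) (hr : 0 ≤ r) (hr' : r ≤ u (k + 1))
    (hkr : (normForm D u k).1 + (normForm D u k).2.1 * r + (normForm D u k).2.2 * r ^ 2 = M) :
    IsGreatest (semiconvNorms D) M := by
  constructor
  · refine ⟨(k : ℤ) - 1, r, by omega, ?_, hr, ?_, ?_⟩
    · rw [h.conv_eq, norm_cv]; simpa using h.normForm_fst_pos hk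
    · rw [h.partialQuotient_xi]
      have : ((k : ℤ) - 1 + 2).toNat = k + 1 := by omega
      rw [this]; exact hr'
    · rw [h.norm_semiconv (by omega)]; simpa using hkr
  · rintro x ⟨i, s, hi, hpos, hs, hs', rfl⟩
    rw [h.norm_semiconv hi]
    rw [h.conv_eq, norm_cv] at hpos
    have hE : Even (i + 1).toNat := by
      by_contra hO
      rw [Nat.not_even_iff_odd] at hO
      have := h.normForm_fst_neg hO
      omega
    rw [h.partialQuotient_xi] at hs'
    have e : (i + 2).toNat = (i + 1).toNat + 1 := by omega
    rw [e] at hs'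
    exact hM _ hE s hs hs'

lemma isGreatest_indecNorms (h : Admissible D u) {M : ℤ}
    (hM : ∀ k, Even k → ∀ r, 0 ≤ r → r ≤ u (k + 1) → (normForm D u k).1 +
      (normForm D u k).2.1 * r + (normForm D u k).2.2 * r ^ 2 ≤ M)
    {k : ℕ} {r : ℤ} (hk : Even k) (hr : 0 ≤ r) (hr' : r ≤ u (k + 1))
    (hkr : (normForm D u k).1 + (normForm D u k).2.1 * r + (normForm D u k).2.2 * r ^ 2 = M) :
    IsGreatest (indecNorms D) M := by
  constructor
  · refine ⟨_, h.indecomposable_semiconv hk hr hr', ?_⟩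
    rw [norm_comb, ← hkr]; ring
  · rintro x ⟨α, hα, rfl⟩
    obtain ⟨j, s, hj, hs, hs', e⟩ := h.norm_mem_of_indecomposable hα
    rw [e, norm_comb]
    have := hM j hj s hs hs'
    linarith

end Admissible

/-! ### Periodic expansions -/

/-- The sequence `u₀, per, per, …`. -/
def expansion (u₀ : ℤ) (per : List ℤ) : ℕ → ℤ
  | 0 => u₀
  | k + 1 => per.getD (k % per.length) 0

/-- The forms `F 0, F 1, …` are the norm forms along the expansion `[u₀, overline{per}]` over one
period, which has even length; they return to `F 0`, and their first coefficients, the norms of the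
convergents, alternate in sign. -/
structure FormCycle (D u₀ : ℤ) (per : List ℤ) (F : ℕ → ℤ × ℤ × ℤ) : Prop where
  pos : 0 < D
  one_le_head : 1 ≤ u₀
  one_le : ∀ k < per.length, 1 ≤ per.getD k 0
  length_pos : 0 < per.length
  even : Even per.length
  zero : F 0 = (1, 2 * u₀ + trDelta D, u₀ ^ 2 + trDelta D * u₀ - negNormDelta D)
  step : ∀ k < per.length, F (k + 1) = stepForm (per.getD k 0) (F k)
  closed : F per.length = F 0
  sign : ∀ k < per.length, 0 < (-1) ^ k * (F k).1

namespace FormCycle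

variable {D u₀ : ℤ} {per : List ℤ} {F : ℕ → ℤ × ℤ × ℤ}

lemma normForm_eq (h : FormCycle D u₀ per F) (k : ℕ) :
    normForm D (expansion u₀ per) k = F (k % per.length) := by
  induction k with
  | zero => rw [Nat.zero_mod, h.zero]; rfl
  | succ k ih =>
    rw [normForm, ih, expansion, ← h.step _ (Nat.mod_lt _ h.length_pos)]
    rcases Nat.lt_or_ge (k % per.length + 1) per.length with hlt | hge
    · rw [Nat.add_mod, Nat.mod_eq_of_lt (by omega : 1 < per.length), Nat.mod_eq_of_lt hlt]
    · have e : k % per.length + 1 = per.length :=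
        le_antisymm (Nat.mod_lt _ h.length_pos) hge
      have e' : (k + 1) % per.length = 0 := by
        rw [← Nat.mod_add_mod, e, Nat.mod_self]
      rw [e, e', h.closed]

lemma admissible (h : FormCycle D u₀ per F) : Admissible D (expansion u₀ per) where
  pos := h.pos
  one_le k := by
    cases k with
    | zero => exact h.one_le_head
    | succ k => exact h.one_le _ (Nat.mod_lt _ h.length_pos)
  sign k := by
    rw [norm_cv, h.normForm_eq]
    have := h.sign _ (Nat.mod_lt k h.length_pos)
    have e : (-1 : ℤ) ^ k = (-1) ^ (k % per.length) := by
      conv_lhs => rw [← Nat.div_add_mod k per.length, pow_add, pow_mul, h.even.neg_one_pow, one_pow,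
        one_mul]
    rwa [e]

/-- The length of `per` is the minimal period when the last entry exceeds all others. -/
lemma hasPeriodicExpansion (h : FormCycle D u₀ per F)
    (hlast : ∀ k, k + 1 < per.length → per.getD k 0 < per.getD (per.length - 1) 0) :
    HasPeriodicExpansion (xi D) u₀ per := by
  rw [HasPeriodicExpansion, h.admissible.partialQuotient_xi]
  refine ⟨rfl, fun k => rfl, ?_⟩
  intro t ht hper
  by_contra hlt
  push Not at hlt
  have hL := h.length_pos
  have := hper (per.length - 1)
  rw [show per.length - 1 + 1 + t = (per.length - 1 + t) + 1 by omega] at this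
  simp only [expansion] at this
  rw [show per.length - 1 + t = (t - 1) + per.length by omega, Nat.add_mod_right,
    Nat.mod_eq_of_lt (by omega : t - 1 < per.length),
    Nat.mod_eq_of_lt (by omega : per.length - 1 < per.length)] at this
  have h2 := hlast (t - 1) (by omega)
  omega

lemma isLeast_negNorms (h : FormCycle D u₀ per F) {N : ℤ} (hN0 : 0 < N)
    (hN : ∀ k < per.length, Odd k → N ≤ -(F k).1) {k : ℕ} (hkL : k < per.length)
    (hk : (F k).1 = -N) : IsLeast (negNorms D) N := by
  refine h.admissible.isLeast_negNorms hN0 ?_ (k := k) ?_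
  · intro j hj
    rw [h.normForm_eq]
    refine hN _ (Nat.mod_lt _ h.length_pos) ?_
    rw [← Nat.div_add_mod j per.length, Nat.odd_add] at hj
    by_contra hne
    rw [Nat.not_odd_iff_even] at hne
    have := hj.2 hne
    exact (Nat.not_odd_iff_even.2 (h.even.mul_right _)) this
  · rw [h.normForm_eq, Nat.mod_eq_of_lt hkL, hk]

lemma norm_conv (h : FormCycle D u₀ per F) {i : ℤ} {k : ℕ} (hik : (i + 1).toNat = k)
    (hk : k < per.length) : QuadraticAlgebra.norm (conv D i) = (F k).1 := by
  rw [h.admissible.conv_eq, norm_cv, h.normForm_eq, hik, Nat.mod_eq_of_lt hk]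

lemma norm_semiconv (h : FormCycle D u₀ per F) {i : ℤ} (hi : -1 ≤ i) {k : ℕ}
    (hik : (i + 1).toNat = k) (hk : k < per.length) (r : ℤ) :
    QuadraticAlgebra.norm (semiconv D i r) = (F k).1 + (F k).2.1 * r + (F k).2.2 * r ^ 2 := by
  rw [h.admissible.norm_semiconv hi, h.normForm_eq, hik, Nat.mod_eq_of_lt hk]

lemma forall_norm_le (h : FormCycle D u₀ per F) {M : ℤ}
    (hM : ∀ k < per.length, Even k → ∀ r, 0 ≤ r → r ≤ per.getD k 0 →
      (F k).1 + (F k).2.1 * r + (F k).2.2 * r ^ 2 ≤ M) :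
    ∀ k, Even k → ∀ r, 0 ≤ r → r ≤ expansion u₀ per (k + 1) →
      (normForm D (expansion u₀ per) k).1 + (normForm D (expansion u₀ per) k).2.1 * r +
        (normForm D (expansion u₀ per) k).2.2 * r ^ 2 ≤ M := by
  intro k hk r hr hr'
  rw [h.normForm_eq]
  refine hM _ (Nat.mod_lt _ h.length_pos) ?_ r hr hr'
  rw [← Nat.div_add_mod k per.length, Nat.even_add] at hk
  exact hk.1 (h.even.mul_right _)

lemma isGreatest_norms (h : FormCycle D u₀ per F) {M : ℤ}
    (hM : ∀ k < per.length, Even k → ∀ r, 0 ≤ r → r ≤ per.getD k 0 →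
      (F k).1 + (F k).2.1 * r + (F k).2.2 * r ^ 2 ≤ M)
    {k : ℕ} {r : ℤ} (hkL : k < per.length) (hk : Even k) (hr : 0 ≤ r) (hr' : r ≤ per.getD k 0)
    (hkr : (F k).1 + (F k).2.1 * r + (F k).2.2 * r ^ 2 = M) :
    IsGreatest (semiconvNorms D) M ∧ IsGreatest (indecNorms D) M := by
  have hr'' : r ≤ expansion u₀ per (k + 1) := by
    simpa only [expansion, Nat.mod_eq_of_lt hkL] using hr'
  have hkr' : (normForm D (expansion u₀ per) k).1 + (normForm D (expansion u₀ per) k).2.1 * r +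
        (normForm D (expansion u₀ per) k).2.2 * r ^ 2 = M := by
    rw [h.normForm_eq, Nat.mod_eq_of_lt hkL, hkr]
  exact ⟨h.admissible.isGreatest_semiconvNorms (h.forall_norm_le hM) hk hr hr'' hkr',
    h.admissible.isGreatest_indecNorms (h.forall_norm_le hM) hk hr hr'' hkr'⟩

lemma indecomposable_semiconv (h : FormCycle D u₀ per F) {i : ℤ} (hi : -1 ≤ i) {k : ℕ}
    (hik : (i + 1).toNat = k) (hkL : k < per.length) (hk : Even k) {r : ℤ} (hr : 0 ≤ r)
    (hr' : r ≤ per.getD k 0) : Indecomposable (semiconv D i r) := by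
  rw [h.admissible.semiconv_eq hi, hik]
  refine h.admissible.indecomposable_semiconv hk hr ?_
  simpa only [expansion, Nat.mod_eq_of_lt hkL] using hr'

end FormCycle

/-! ### Prime and squarefree values of linear polynomials -/

lemma isCoprime_of_combination_eq_two_pow {a c x y : ℤ} {k : ℕ} (h : x * a + y * c = 2 ^ k)
    (hc : Odd c) : IsCoprime a c := by
  have h2 : IsCoprime ((2 : ℤ) ^ k) c := IsCoprime.pow_left (Int.isCoprime_two_left.2 hc)
  rw [← h] at h2
  exact (IsCoprime.add_mul_right_left_iff.1 h2).of_mul_left_right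

/-- Dirichlet's theorem for a linear polynomial. -/
lemma exists_gt_prime_linear {c d : ℤ} (hc : 0 < c) (hcd : IsCoprime c d) (B : ℕ) :
    ∃ m : ℕ, B < m ∧ ∃ p : ℕ, p.Prime ∧ c * m + d = p := by
  obtain ⟨q, rfl⟩ := Int.eq_ofNat_of_zero_le hc.le
  obtain ⟨p, hp, hpp, hmod⟩ := Nat.forall_exists_prime_gt_and_zmodEq (q * B + d.natAbs)
    (q := q) (a := d) (by rintro rfl; simp at hc) hcd.symm
  obtain ⟨k, hk⟩ := hmod.symm.dvd
  have hq : (0 : ℤ) < q := hc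
  have hp' : (q : ℤ) * B + |d| < p := by
    rw [Int.abs_eq_natAbs]; exact_mod_cast hp
  have hk' : (q : ℤ) * B < q * k := by linarith [le_abs_self d]
  have hkB : (B : ℤ) < k := lt_of_mul_lt_mul_left hk' hq.le
  refine ⟨k.toNat, by omega, p, hpp, ?_⟩
  rw [Int.toNat_of_nonneg (by omega)]
  linarith

/-- Among the numbers `m < X` at most `X / q + 1` satisfy `q ∣ a m + b` when `a`, `b` are
coprime. -/
lemma card_filter_dvd_linear_le {a b : ℤ} (hab : IsCoprime a b) (q X : ℕ) :
    ((Finset.range X).filter (fun m : ℕ => (q : ℤ) ∣ a * m + b)).card ≤ X / q + 1 := by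
  rw [← Finset.card_range (X / q + 1)]
  refine Finset.card_le_card_of_injOn (fun m => m / q) ?_ ?_
  · intro m hm
    simp only [Finset.coe_filter, Finset.mem_range, Set.mem_ofPred_eq] at hm
    simp only [Finset.coe_range, Set.mem_Iio]
    exact Nat.lt_succ_of_le (Nat.div_le_div_right hm.1.le)
  · intro m hm m' hm' hdiv
    simp only [Finset.coe_filter, Finset.mem_range, Set.mem_ofPred_eq] at hm hm'
    have hcop : IsCoprime (q : ℤ) a := by
      obtain ⟨s, t, hst⟩ := hab
      obtain ⟨k, hk⟩ := hm.2
      exact ⟨t * k, s - t * m, by linear_combination hst - t * hk⟩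
    have hdvd : (q : ℤ) ∣ a * ((m : ℤ) - m') := by
      have e : a * ((m : ℤ) - m') = (a * m + b) - (a * m' + b) := by ring
      rw [e]
      exact dvd_sub hm.2 hm'.2
    have h1 : (q : ℤ) ∣ (m : ℤ) - m' := hcop.dvd_of_dvd_mul_left hdvd
    have h2 : m' % q = m % q := (Nat.modEq_iff_dvd.2 h1)
    have e1 := Nat.div_add_mod m q
    have e2 := Nat.div_add_mod m' q
    simp only at hdiv
    rw [hdiv, ← h2] at e1
    omega

/-- `∑ 1 / (2 j + 1)² ≤ ∑ 1 / (4 j (j + 1)) ≤ 1 / 4`. -/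
lemma sum_odd_squares_le (X J : ℕ) :
    ∑ j ∈ Finset.range J, ((X / (2 * (j + 1) + 1) ^ 2 : ℕ) : ℝ) ≤ X / 4 := by
  have h : ∀ J : ℕ, ∑ j ∈ Finset.range J, ((X / (2 * (j + 1) + 1) ^ 2 : ℕ) : ℝ) ≤
      X / 4 * (1 - 1 / ((J : ℝ) + 1)) := by
    intro J
    induction J with
    | zero => simp
    | succ J ih =>
      rw [Finset.sum_range_succ]
      have h1 : ((X / (2 * (J + 1) + 1) ^ 2 : ℕ) : ℝ) ≤ (X : ℝ) / (2 * (J + 1) + 1) ^ 2 := by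
        have := @Nat.cast_div_le ℝ _ _ _ X ((2 * (J + 1) + 1) ^ 2)
        push_cast at this ⊢; exact this
      have h2 : (X : ℝ) / (2 * (J + 1) + 1) ^ 2 ≤ X / (4 * (J + 1) * (J + 2)) := by
        apply div_le_div_of_nonneg_left (by positivity) (by positivity)
        nlinarith
      have h3 : (X : ℝ) / (4 * (J + 1) * (J + 2)) =
          X / 4 * (1 - 1 / ((J : ℝ) + 1 + 1)) - X / 4 * (1 - 1 / ((J : ℝ) + 1)) := by
        field_simp; ring
      push_cast
      linarith
  refine (h J).trans ?_
  have : (0 : ℝ) ≤ X / 4 * (1 / ((J : ℝ) + 1)) := by positivity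
  linarith

/-- A positive odd integer below `(2 J + 3)²` that is divisible by the square of a prime is divisible
by the square of some `2 (j + 1) + 1` with `j < J`. -/
lemma exists_odd_square_dvd {x : ℤ} (hx : 0 < x) (hodd : Odd x) {J : ℕ} (hxJ : x < (2 * J + 3) ^ 2)
    {p : ℤ} (hp : Prime p) (hpx : p * p ∣ x) :
    ∃ j < J, (((2 * (j + 1) + 1) ^ 2 : ℕ) : ℤ) ∣ x := by
  have hodd' : Odd p := by
    have : Odd (p * p) := by
      obtain ⟨k, rfl⟩ := hpx
      exact (Int.odd_mul.1 hodd).1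
    exact (Int.odd_mul.1 this).1
  have hnp : p.natAbs.Prime := Int.prime_iff_natAbs_prime.1 hp
  have hno : Odd p.natAbs := Int.natAbs_odd.2 hodd'
  have h3 : 3 ≤ p.natAbs := by
    have := hnp.two_le
    obtain ⟨k, hk⟩ := hno
    omega
  obtain ⟨k, hk⟩ := hno
  have hsq : ((p.natAbs ^ 2 : ℕ) : ℤ) = p * p := by
    push_cast; rw [sq_abs, sq]
  have hle : p * p ≤ x := Int.le_of_dvd hx hpx
  refine ⟨k - 1, ?_, ?_⟩
  · have h1 : ((p.natAbs ^ 2 : ℕ) : ℤ) < (2 * J + 3) ^ 2 := by rw [hsq]; omega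
    have h2 : p.natAbs < 2 * J + 3 := by
      have : p.natAbs ^ 2 < (2 * J + 3) ^ 2 := by exact_mod_cast h1
      exact lt_of_pow_lt_pow_left₀ 2 (by omega) this
    omega
  · have : 2 * (k - 1 + 1) + 1 = p.natAbs := by omega
    rw [this, hsq]; exact hpx

/-- The odd squares `(2 j + 1)²` with `j > 0` divide at most about a quarter of the values of each
of the two polynomials, so some product is squarefree. -/
lemma exists_squarefree_linear_mul {a b c d : ℤ} (ha : 0 < a) (hb : 0 < b) (hc : 0 < c)
    (hd : 0 < d) (hab : IsCoprime a b) (hcd : IsCoprime c d)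
    (hodd : ∀ m : ℕ, Odd (a * m + b) ∧ Odd (c * m + d))
    (hcop : ∀ m : ℕ, IsCoprime (a * m + b) (c * m + d)) :
    ∃ m : ℕ, Squarefree ((a * m + b) * (c * m + d)) := by
  by_contra hno
  push Not at hno
  obtain ⟨K, hK1, hK2, hK0⟩ : ∃ K : ℕ, a + b ≤ K ∧ c + d ≤ K ∧ 0 < K :=
    ⟨(a + b + c + d).toNat, by omega, by omega, by omega⟩
  -- For `m < X = 64 K` all values are less than `(8 K + 3)²`, so only `j < J = 4 K` matter; these
  -- exclude at most `2 (X / 4 + J) < X` numbers `m`.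
  set X := 64 * K with hX
  set J := 4 * K with hJ
  set S : ℤ → ℤ → ℕ → Finset ℕ := fun s t j =>
    (Finset.range X).filter (fun m : ℕ => (((2 * (j + 1) + 1) ^ 2 : ℕ) : ℤ) ∣ s * m + t) with hS
  have hbound : ∀ s t : ℤ, 0 < s → 0 < t → s + t ≤ K → ∀ m < X, s * m + t < (2 * J + 3) ^ 2 := by
    intro s t hs ht hst m hm
    have h1 : (m : ℤ) + 1 ≤ 64 * K := by rw [hX] at hm; exact_mod_cast hm
    have h2 : s * m + t ≤ (s + t) * (m + 1) := by nlinarith [Int.natCast_nonneg m]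
    have h3 : (s + t) * ((m : ℤ) + 1) ≤ K * (64 * K) :=
      mul_le_mul hst h1 (by positivity) (by positivity)
    rw [hJ]; push_cast; nlinarith
  have hcover : Finset.range X ⊆ (Finset.range J).biUnion (S a b) ∪
      (Finset.range J).biUnion (S c d) := by
    intro m hm
    have hmX := Finset.mem_range.1 hm
    have hpos1 : 0 < a * m + b := by positivity
    have hpos2 : 0 < c * m + d := by positivity
    have hns : ¬ (Squarefree (a * m + b) ∧ Squarefree (c * m + d)) := fun hsq =>
      hno m ((squarefree_mul_iff).2 ⟨(hcop m).isRelPrime, hsq.1, hsq.2⟩)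
    simp only [Finset.mem_union, Finset.mem_biUnion, Finset.mem_range, hS, Finset.mem_filter]
    have hprime : ∀ x : ℤ, 0 < x → ¬ Squarefree x → ∃ p : ℤ, Prime p ∧ p * p ∣ x := by
      intro x hx hsq
      rw [squarefree_iff_no_irreducibles hx.ne'] at hsq
      push Not at hsq
      obtain ⟨p, hp, hpx⟩ := hsq
      exact ⟨p, hp.prime, hpx⟩
    rcases not_and_or.1 hns with hsq | hsq
    · obtain ⟨p, hp, hpx⟩ := hprime _ hpos1 hsq
      obtain ⟨j, hj, hjd⟩ := exists_odd_square_dvd hpos1 (hodd m).1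
        (hbound a b ha hb hK1 m hmX) hp hpx
      exact Or.inl ⟨j, hj, hmX, hjd⟩
    · obtain ⟨p, hp, hpx⟩ := hprime _ hpos2 hsq
      obtain ⟨j, hj, hjd⟩ := exists_odd_square_dvd hpos2 (hodd m).2
        (hbound c d hc hd hK2 m hmX) hp hpx
      exact Or.inr ⟨j, hj, hmX, hjd⟩
  have hcard : ∀ s t : ℤ, IsCoprime s t →
      (((Finset.range J).biUnion (S s t)).card : ℝ) ≤ X / 4 + J := by
    intro s t hst
    have h1 : (((Finset.range J).biUnion (S s t)).card : ℝ) ≤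
        ∑ j ∈ Finset.range J, (((X / (2 * (j + 1) + 1) ^ 2 : ℕ) : ℝ) + 1) := by
      have := (Finset.card_biUnion_le (s := Finset.range J) (t := S s t)).trans
        (Finset.sum_le_sum fun j _ =>
          card_filter_dvd_linear_le hst ((2 * (j + 1) + 1) ^ 2) X)
      exact_mod_cast this
    rw [Finset.sum_add_distrib] at h1
    have h2 := sum_odd_squares_le X J
    simp only [Finset.sum_const, Finset.card_range, nsmul_eq_mul, mul_one] at h1
    linarith
  have htot : (X : ℝ) ≤ (X / 4 + J) + (X / 4 + J) := by
    have h1 := (Finset.card_le_card hcover).trans (Finset.card_union_le _ _)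
    rw [Finset.card_range] at h1
    have h2 : (X : ℝ) ≤ (((Finset.range J).biUnion (S a b)).card : ℝ) +
      (((Finset.range J).biUnion (S c d)).card : ℝ) := by exact_mod_cast h1
    linarith [hcard a b hab, hcard c d hcd]
  have hK : (0 : ℝ) < K := by exact_mod_cast hK0
  rw [hX, hJ] at htot
  push_cast at htot
  linarith

lemma infinite_squarefree_linear_mul {a b c d : ℤ} (ha : 0 < a) (hb : 0 < b) (hc : 0 < c)
    (hd : 0 < d) (hab : IsCoprime a b) (hcd : IsCoprime c d)
    (hodd : ∀ m : ℕ, Odd (a * m + b) ∧ Odd (c * m + d))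
    (hcop : ∀ m : ℕ, IsCoprime (a * m + b) (c * m + d)) :
    {m : ℕ | Squarefree ((a * m + b) * (c * m + d))}.Infinite := by
  rw [Set.infinite_iff_exists_gt]
  intro B
  have e : ∀ s t : ℤ, ∀ m : ℕ, s * m + (t + s * (B + 1)) = s * ((m + (B + 1) : ℕ) : ℤ) + t := by
    intro s t m; push_cast; ring
  obtain ⟨m, hm⟩ := exists_squarefree_linear_mul (b := b + a * (B + 1)) (d := d + c * (B + 1))
    ha (by positivity) hc (by positivity) (by simpa [IsCoprime.add_mul_left_right_iff] using hab)
    (by simpa [IsCoprime.add_mul_left_right_iff] using hcd)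
    (fun m => by rw [e, e]; exact hodd _) (fun m => by rw [e, e]; exact hcop _)
  rw [e, e] at hm
  exact ⟨m + (B + 1), hm, by omega⟩

/-! ### The Jang-Kim bound -/

lemma isLeast_jkRoot {D a : ℤ} (ha : a ∈ jkRoots D) : IsLeast (jkRoots D) (jkRoot D) :=
  have hb : BddBelow (jkRoots D) := ⟨0, fun _ h => h.1⟩
  ⟨Int.csInf_mem ⟨a, ha⟩ hb, fun _ h => csInf_le hb h⟩

/-- The modulus `N` or `4 N` of the congruence for `jkRoot D`; it is also the denominator of
`jkBound D`. -/
noncomputable def jkMod (D : ℤ) : ℤ := if D % 4 = 1 then 4 * minNegNorm D else minNegNorm D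

lemma jkBound_eq (D : ℤ) : jkBound D = ((D : ℝ) - (jkRoot D : ℝ) ^ 2) / (jkMod D : ℝ) := by
  unfold jkBound jkMod
  split_ifs <;> push_cast <;> rfl

lemma jkBound_of_jkRoot_eq {D a K U : ℤ} (hK : 0 < K) (hmod : jkMod D = K) (ha : jkRoot D = a)
    (hU : D - a ^ 2 = K * U) : jkBound D = U := by
  have hK' : (0 : ℝ) < K := by exact_mod_cast hK
  rw [jkBound_eq, hmod, ha, div_eq_iff hK'.ne']
  have : ((D - a ^ 2 : ℤ) : ℝ) = (K * U : ℤ) := by rw [hU]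
  push_cast at this; linarith

/-- Any root of the congruence gives a lower bound for the Jang-Kim bound. -/
lemma le_jkBound {D a K U : ℤ} (hK : 0 < K) (hmod : jkMod D = K) (ha : a ∈ jkRoots D)
    (hU : D - a ^ 2 = K * U) : (U : ℝ) ≤ jkBound D := by
  have hK' : (0 : ℝ) < K := by exact_mod_cast hK
  have h := isLeast_jkRoot ha
  have h1 : jkRoot D ≤ a := h.2 ha
  have h2 : 0 ≤ jkRoot D := h.1.1
  rw [jkBound_eq, hmod, le_div_iff₀ hK']
  have h3 : U * K ≤ D - jkRoot D ^ 2 := by nlinarith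
  exact_mod_cast h3

lemma mem_jkRoots {D a K U : ℤ} (hmod : jkMod D = K) (ha : 0 ≤ a) (hU : D - a ^ 2 = K * U) :
    a ∈ jkRoots D := by
  refine ⟨ha, ?_⟩
  change a ^ 2 ≡ D [ZMOD jkMod D]
  rw [hmod]
  exact Int.modEq_iff_dvd.2 ⟨U, hU⟩

lemma exists_of_mem_jkRoots {D a K : ℤ} (hmod : jkMod D = K) (h : a ∈ jkRoots D) :
    ∃ U, D - a ^ 2 = K * U := by
  have := h.2
  change a ^ 2 ≡ D [ZMOD jkMod D] at this
  rw [hmod] at this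
  exact Int.modEq_iff_dvd.1 this

/-! ### Palindromic periods -/

/-- The form with its variables exchanged and its middle coefficient negated. -/
def revForm (f : ℤ × ℤ × ℤ) : ℤ × ℤ × ℤ := (f.2.2, -f.2.1, f.1)

/-- The forms along a period of length `2 l` whose first `2 l - 1` entries are a palindrome, given
the first `l` forms `H`. -/
def palindromicForms (l : ℕ) (H : ℕ → ℤ × ℤ × ℤ) (k : ℕ) : ℤ × ℤ × ℤ :=
  if k < l then H k else if k < 2 * l then revForm (H (2 * l - 1 - k)) else H 0

lemma palindromicForms_of_lt {l k : ℕ} (H : ℕ → ℤ × ℤ × ℤ) (h : k < l) :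
    palindromicForms l H k = H k := if_pos h

lemma palindromicForms_of_le {l k i : ℕ} (H : ℕ → ℤ × ℤ × ℤ) (h : l ≤ k) (hi : k + i + 1 = 2 * l) :
    palindromicForms l H k = revForm (H i) := by
  rw [palindromicForms, if_neg (by omega), if_pos (by omega), show 2 * l - 1 - k = i by omega]

/-- Reversal conjugates `stepForm v` into its inverse, so that in a palindromic period the second
half of the forms mirrors the first. -/
lemma FormCycle.of_palindrome {D u₀ : ℤ} {per : List ℤ} {H : ℕ → ℤ × ℤ × ℤ} {l : ℕ}
    (hl : per.length = 2 * l) (hl0 : 0 < l) (pos : 0 < D) (one_le_head : 1 ≤ u₀)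
    (one_le : ∀ k < per.length, 1 ≤ per.getD k 0)
    (hpal : ∀ k, k + 1 < l → per.getD (2 * l - 2 - k) 0 = per.getD k 0)
    (hlast : per.getD (2 * l - 1) 0 = 2 * u₀ + trDelta D)
    (zero : H 0 = (1, 2 * u₀ + trDelta D, u₀ ^ 2 + trDelta D * u₀ - negNormDelta D))
    (step : ∀ k, k + 1 < l → H (k + 1) = stepForm (per.getD k 0) (H k))
    (middle : stepForm (per.getD (l - 1) 0) (H (l - 1)) = revForm (H (l - 1)))
    (sign : ∀ k < l, 0 < (-1) ^ k * (H k).1)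
    (sign' : ∀ k < l, (-1) ^ k * (H k).2.2 < 0) :
    FormCycle D u₀ per (palindromicForms l H) where
  pos := pos
  one_le_head := one_le_head
  one_le := one_le
  length_pos := by omega
  even := by rw [hl]; exact even_two_mul l
  zero := by rw [palindromicForms_of_lt H hl0, zero]
  closed := by simp [palindromicForms, hl, hl0]
  step k hk := by
    rw [hl] at hk
    rcases lt_trichotomy (k + 1) l with h | h | h
    · rw [palindromicForms_of_lt H h, palindromicForms_of_lt H (by omega)]
      exact step k h
    · obtain rfl : k = l - 1 := by omega
      rw [palindromicForms_of_lt H (by omega : l - 1 < l),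
        palindromicForms_of_le H (i := l - 1) (by omega) (by omega)]
      exact middle.symm
    · rcases Nat.lt_or_ge (k + 1) (2 * l) with h' | h'
      · obtain ⟨i, hi⟩ : ∃ i, i = 2 * l - 2 - k := ⟨_, rfl⟩
        have hk' : k = 2 * l - 2 - i := by omega
        rw [palindromicForms_of_le H (i := i) (by omega) (by omega),
          palindromicForms_of_le H (i := i + 1) (by omega) (by omega), hk', hpal i (by omega),
          step i (by omega)]
        simp only [stepForm, revForm, Prod.mk.injEq, true_and]
        constructor <;> ring
      · have hk' : k = 2 * l - 1 := by omega
        have e : palindromicForms l H (k + 1) = H 0 := by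
          rw [palindromicForms, if_neg (by omega), if_neg (by omega)]
        rw [e, palindromicForms_of_le H (i := 0) (by omega) (by omega), hk', hlast, zero]
        simp only [stepForm, revForm, Prod.mk.injEq, true_and]
        constructor <;> ring
  sign k hk := by
    rw [hl] at hk
    rcases Nat.lt_or_ge k l with h | h
    · rw [palindromicForms_of_lt H h]
      exact sign k h
    · obtain ⟨i, hi⟩ : ∃ i, k + i + 1 = 2 * l := ⟨2 * l - 1 - k, by omega⟩
      have h1 := sign' i (by omega)
      rw [palindromicForms_of_le H h hi, revForm]
      have e : (-1 : ℤ) ^ k = -(-1) ^ i := by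
        have h2 : (-1 : ℤ) ^ k * (-1) ^ i = -1 := by
          rw [← pow_add]
          exact Odd.neg_one_pow ⟨l - 1, by omega⟩
        have h3 : ((-1 : ℤ) ^ i) * (-1) ^ i = 1 := by
          rw [← mul_pow]; simp
        linear_combination (-1 : ℤ) ^ i * h2 - (-1 : ℤ) ^ k * h3
      rw [e]; linarith

/-! ### The excess over the Jang-Kim bound -/

lemma maxNorm_eq {D M : ℤ} (h : IsGreatest (semiconvNorms D) M) : maxNorm D = M := h.csSup_eq

lemma minNegNorm_eq {D N : ℤ} (h : IsLeast (negNorms D) N) : minNegNorm D = N := h.csInf_eq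

lemma excessRatio_lt {D M U w p q : ℤ} (hM : maxNorm D = M) (hU : (U : ℝ) ≤ jkBound D)
    (hw : 0 < w) (hwD : (w : ℝ) < √(D : ℝ)) (hp : 0 < p) (hq : 0 < q)
    (h : p * (M - U) ≤ q * w) : excessRatio D < (q : ℝ) / p := by
  have hp' : (0 : ℝ) < p := by exact_mod_cast hp
  have hq' : (0 : ℝ) < q := by exact_mod_cast hq
  have hw' : (0 : ℝ) < w := by exact_mod_cast hw
  have h' : (p : ℝ) * (M - U) ≤ q * w := by exact_mod_cast h
  rw [excessRatio, hM, div_lt_div_iff₀ (hw'.trans hwD) hp']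
  nlinarith

lemma lt_excessRatio {D M U w p q : ℤ} (hM : maxNorm D = M) (hU : jkBound D = U)
    (hD : 0 < D) (hwD : √(D : ℝ) < w) (hp : 0 < p) (hq : 0 ≤ q)
    (h : q * w < p * (M - U)) : (q : ℝ) / p < excessRatio D := by
  have hp' : (0 : ℝ) < p := by exact_mod_cast hp
  have hq' : (0 : ℝ) ≤ q := by exact_mod_cast hq
  have hD' : 0 < √(D : ℝ) := Real.sqrt_pos.2 (by exact_mod_cast hD)
  have h' : (q : ℝ) * w < p * (M - U) := by exact_mod_cast h
  rw [excessRatio, hM, hU, div_lt_div_iff₀ hp' hD']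
  nlinarith

/-- If `g` is a squarefree divisor of `D` and of the modulus and is itself a root of the congruence,
then it is the least root. -/
lemma jkRoot_eq_of_squarefree {D f g K U : ℤ} (hD : D = f * g) (hodd : D % 2 = 1) (hmod : jkMod D = K)
    (hgK : g ∣ K) (hK : 2 ∣ K) (hg : 0 < g) (hsq : Squarefree g) (hU : D - g ^ 2 = K * U) :
    jkRoot D = g := by
  have hmem := mem_jkRoots hmod hg.le hU
  have hleast := isLeast_jkRoot hmem
  refine le_antisymm (hleast.2 hmem) ?_
  obtain ⟨V, hV⟩ := exists_of_mem_jkRoots hmod hleast.1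
  set a := jkRoot D
  have ha : 0 ≤ a := hleast.1.1
  have hdvd : g ∣ a ^ 2 := by
    have : a ^ 2 = D - K * V := by linarith
    rw [this]
    exact dvd_sub (hD ▸ dvd_mul_left g f) (hgK.mul_right V)
  have hga : g ∣ a := (hsq.dvd_pow_iff_dvd two_ne_zero).1 hdvd
  have hne : a ≠ 0 := by
    intro h0
    have h2 : 2 ∣ D := by
      have : D = K * V := by rw [h0] at hV; linarith
      rw [this]; exact hK.mul_right V
    omega
  exact Int.le_of_dvd (lt_of_le_of_ne ha (Ne.symm hne)) hga

/-- For a prime modulus `p` the least root of the congruence is the one in `[0, p / 2]`. -/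
lemma jkRoot_eq_of_prime {D a p U : ℤ} (hp : Prime p) (hmod : jkMod D = p)
    (ha : 0 ≤ a) (hap : 2 * a ≤ p) (hU : D - a ^ 2 = p * U) : jkRoot D = a := by
  have hmem := mem_jkRoots hmod ha hU
  have hleast := isLeast_jkRoot hmem
  refine le_antisymm (hleast.2 hmem) ?_
  obtain ⟨V, hV⟩ := exists_of_mem_jkRoots hmod hleast.1
  set b := jkRoot D
  have hb : 0 ≤ b := hleast.1.1
  have hdvd : p ∣ (a - b) * (a + b) := ⟨V - U, by linear_combination hV - hU⟩
  rcases hp.dvd_or_dvd hdvd with h | h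
  · by_contra hlt
    push Not at hlt
    have := Int.le_of_dvd (by omega) h
    omega
  · rcases eq_or_lt_of_le (add_nonneg ha hb) with h0 | h0
    · omega
    · have := Int.le_of_dvd h0 h
      omega

lemma Admissible.lt_sqrt {D : ℤ} {u : ℕ → ℤ} (h : Admissible D u) (hD : D % 4 ≠ 1) :
    ((u 0 : ℤ) : ℝ) < √(D : ℝ) ∧ √(D : ℝ) < ((u 0 + 1 : ℤ) : ℝ) := by
  have h1 := h.lt_xi
  have h2 := h.xi_lt
  rw [xi, if_neg hD] at h1 h2
  exact ⟨h1, by push_cast; exact h2⟩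

lemma Admissible.lt_sqrt_of_emod_four {D : ℤ} {u : ℕ → ℤ} (h : Admissible D u) (hD : D % 4 = 1) :
    ((2 * u 0 + 1 : ℤ) : ℝ) < √(D : ℝ) ∧ √(D : ℝ) < ((2 * u 0 + 3 : ℤ) : ℝ) := by
  have h1 := h.lt_xi
  have h2 := h.xi_lt
  rw [xi, if_pos hD] at h1 h2
  push_cast
  constructor <;> linarith

/-! ### Limits -/

/-- A squeeze from below, uniform in the first variable. -/
lemma tendsto_nhdsLT_of_lower_bound {f : ℕ × ℕ → ℝ} {s : Set (ℕ × ℕ)} {g : ℕ → ℝ} {c : ℝ} (n₀ : ℕ)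
    (hg : Tendsto g atTop (𝓝 c))
    (h : ∀ z ∈ s, n₀ ≤ z.2 → g z.2 ≤ f z ∧ f z < c) :
    Tendsto f (((⊤ : Filter ℕ) ×ˢ (atTop : Filter ℕ)) ⊓ 𝓟 s) (𝓝[<] c) := by
  have hsnd : Tendsto (fun z : ℕ × ℕ => z.2) (((⊤ : Filter ℕ) ×ˢ (atTop : Filter ℕ)) ⊓ 𝓟 s) atTop :=
    tendsto_snd.mono_left inf_le_left
  have hs : ∀ᶠ z in (((⊤ : Filter ℕ) ×ˢ (atTop : Filter ℕ)) ⊓ 𝓟 s), z ∈ s :=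
    mem_inf_of_right (mem_principal_self s)
  have hev : ∀ᶠ z in (((⊤ : Filter ℕ) ×ˢ (atTop : Filter ℕ)) ⊓ 𝓟 s), g z.2 ≤ f z ∧ f z < c := by
    filter_upwards [hs, hsnd.eventually_ge_atTop n₀] with z hz hn using h z hz hn
  refine tendsto_nhdsWithin_iff.2 ⟨?_, hev.mono fun z hz => hz.2⟩
  exact tendsto_of_tendsto_of_tendsto_of_le_of_le' (hg.comp hsnd) tendsto_const_nhds
    (hev.mono fun z hz => hz.1) (hev.mono fun z hz => hz.2.le)

lemma tendsto_linear_div_linear {a b c d : ℝ} (hc : c ≠ 0) :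
    Tendsto (fun m : ℕ => (a * m + b) / (c * m + d)) atTop (𝓝 (a / c)) := by
  have h : Tendsto (fun m : ℕ => (a + b / m) / (c + d / m)) atTop (𝓝 ((a + 0) / (c + 0))) :=
    (tendsto_const_nhds.add (tendsto_const_div_atTop_nhds_zero_nat b)).div
      (tendsto_const_nhds.add (tendsto_const_div_atTop_nhds_zero_nat d)) (by simpa using hc)
  rw [add_zero, add_zero] at h
  refine h.congr' ?_
  filter_upwards [eventually_gt_atTop 0] with m hm
  have hm' : (m : ℝ) ≠ 0 := by positivity
  have e1 : a * m + b = (a + b / m) * m := by field_simp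
  have e2 : c * m + d = (c + d / m) * m := by field_simp
  rw [e1, e2, mul_div_mul_right _ _ hm']

lemma tendsto_const_sub_one_div (c : ℝ) :
    Tendsto (fun n : ℕ => c - 1 / ((n : ℝ) + 1)) atTop (𝓝 c) := by
  have := (tendsto_one_div_add_atTop_nhds_zero_nat (𝕜 := ℝ)).const_sub c
  simpa using this

/-! ### The family with `D ≡ 3 mod 4` -/

/-- The norm forms along the first half of the period. -/
def forms₃ (m n : ℤ) : ℕ → ℤ × ℤ × ℤ
  | 0 => (1,
      (131072 * n ^ 4 + 679936 * n ^ 3 + 1309184 * n ^ 2 + 1108512 * n + 348348) * m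
        + 3584 * n ^ 3 + 13152 * n ^ 2 + 15844 * n + 6284,
      -((65536 * n ^ 4 + 335872 * n ^ 3 + 639232 * n ^ 2 + 535296 * n + 166456) * m
        + 1792 * n ^ 3 + 6464 * n ^ 2 + 7672 * n + 3003))
  | 1 => (-((65536 * n ^ 4 + 335872 * n ^ 3 + 639232 * n ^ 2 + 535296 * n + 166456) * m
        + 1792 * n ^ 3 + 6464 * n ^ 2 + 7672 * n + 3003),
      -((131072 * n ^ 4 + 663552 * n ^ 3 + 1247744 * n ^ 2 + 1032672 * n + 317476) * m
        + 3584 * n ^ 3 + 12704 * n ^ 2 + 14844 * n + 5728),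
      (16384 * n ^ 3 + 61440 * n ^ 2 + 75840 * n + 30872) * m + 448 * n ^ 2 + 1000 * n + 557)
  | 2 => ((16384 * n ^ 3 + 61440 * n ^ 2 + 75840 * n + 30872) * m + 448 * n ^ 2 + 1000 * n + 557,
      (131072 * n ^ 4 + 647168 * n ^ 3 + 1194496 * n ^ 2 + 978080 * n + 299964) * m
        + 3584 * n ^ 3 + 12256 * n ^ 2 + 14068 * n + 5412,
      -((131072 * n ^ 4 + 630784 * n ^ 3 + 1123840 * n ^ 2 + 878304 * n + 254016) * m
        + 3584 * n ^ 3 + 11808 * n ^ 2 + 12816 * n + 4583))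
  | 3 => (-((131072 * n ^ 4 + 630784 * n ^ 3 + 1123840 * n ^ 2 + 878304 * n + 254016) * m
        + 3584 * n ^ 3 + 11808 * n ^ 2 + 12816 * n + 4583),
      -((131072 * n ^ 4 + 614400 * n ^ 3 + 1053184 * n ^ 2 + 778528 * n + 208068) * m
        + 3584 * n ^ 3 + 11360 * n ^ 2 + 11564 * n + 3754),
      (32768 * n ^ 3 + 132096 * n ^ 2 + 175616 * n + 76820) * m + 896 * n ^ 2 + 2252 * n + 1386)
  | 4 => ((32768 * n ^ 3 + 132096 * n ^ 2 + 175616 * n + 76820) * m + 896 * n ^ 2 + 2252 * n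
        + 1386,
      (131072 * n ^ 4 + 638976 * n ^ 3 + 1144320 * n ^ 2 + 889728 * n + 252852) * m
        + 3584 * n ^ 3 + 12032 * n ^ 2 + 13036 * n + 4562,
      -((81920 * n ^ 4 + 411648 * n ^ 3 + 764736 * n ^ 2 + 621936 * n + 186840) * m
        + 2240 * n ^ 3 + 7856 * n ^ 2 + 8992 * n + 3371))
  | 5 => (-((81920 * n ^ 4 + 411648 * n ^ 3 + 764736 * n ^ 2 + 621936 * n + 186840) * m
        + 2240 * n ^ 3 + 7856 * n ^ 2 + 8992 * n + 3371),
      -((32768 * n ^ 4 + 184320 * n ^ 3 + 385152 * n ^ 2 + 354144 * n + 120828) * m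
        + 896 * n ^ 3 + 3680 * n ^ 2 + 4948 * n + 2180),
      (49152 * n ^ 4 + 260096 * n ^ 3 + 511680 * n ^ 2 + 443408 * n + 142832) * m
        + 1344 * n ^ 3 + 5072 * n ^ 2 + 6296 * n + 2577)
  | 6 => ((49152 * n ^ 4 + 260096 * n ^ 3 + 511680 * n ^ 2 + 443408 * n + 142832) * m
        + 1344 * n ^ 3 + 5072 * n ^ 2 + 6296 * n + 2577,
      (65536 * n ^ 4 + 335872 * n ^ 3 + 638208 * n ^ 2 + 532672 * n + 164836) * m
        + 1792 * n ^ 3 + 6464 * n ^ 2 + 7644 * n + 2974,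
      -((65536 * n ^ 4 + 335872 * n ^ 3 + 638208 * n ^ 2 + 532672 * n + 164836) * m
        + 1792 * n ^ 3 + 6464 * n ^ 2 + 7644 * n + 2974))
  | _ => 0

/-- The second factor of `D₃`, equal to `N₃ / 2`. -/
def factor₃ (m n : ℤ) : ℤ :=
  2 * (128 * n ^ 2 + 328 * n + 203) ^ 2 * m + 896 * n ^ 3 + 3232 * n ^ 2 + 3822 * n + 1487

/-- The first factor of `D₃`. -/
def cofactor₃ (m n : ℤ) : ℤ :=
  2 * (256 * n ^ 2 + 672 * n + 429) ^ 2 * m + 3584 * n ^ 3 + 13376 * n ^ 2 + 16414 * n + 6641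

lemma D₃_eq (m n : ℤ) : D₃ m n = cofactor₃ m n * factor₃ m n := rfl

lemma N₃_eq (m n : ℤ) : N₃ m n = 2 * factor₃ m n := by
  unfold N₃ factor₃; ring

lemma D₃_eq_sq_add (m n : ℤ) : D₃ m n = u₃ m n ^ 2 + -(forms₃ m n 1).1 := by
  simp only [D₃, u₃, forms₃]; ring

lemma D₃_emod_four (m n : ℤ) : D₃ m n % 4 = 3 := by
  have h1 : cofactor₃ m n = 4 * ((32768 * n ^ 4 + 172032 * n ^ 3 + 335616 * n ^ 2 + 288288 * n + 92020) * m + 896 * n ^ 3 + 3344 * n ^ 2 + 4103 * n + 1660) + 2 * (m + n) + 1 := by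
    unfold cofactor₃; ring
  have h2 : factor₃ m n = 4 * ((8192 * n ^ 4 + 41984 * n ^ 3 + 79776 * n ^ 2 + 66584 * n + 20604) * m + 224 * n ^ 3 + 808 * n ^ 2 + 955 * n + 371) + 2 * (m + n) + 3 := by
    unfold factor₃; ring
  rw [D₃_eq, h1, h2]
  generalize (32768 * n ^ 4 + 172032 * n ^ 3 + 335616 * n ^ 2 + 288288 * n + 92020) * m + 896 * n ^ 3 + 3344 * n ^ 2 + 4103 * n + 1660 = s
  generalize (8192 * n ^ 4 + 41984 * n ^ 3 + 79776 * n ^ 2 + 66584 * n + 20604) * m + 224 * n ^ 3 + 808 * n ^ 2 + 955 * n + 371 = t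
  have : (4 * s + 2 * (m + n) + 1) * (4 * t + 2 * (m + n) + 3) = 4 * (4 * s * t + 2 * s * (m + n)
    + 3 * s + 2 * (m + n) * t + (m + n) ^ 2 + 2 * (m + n) + t) + 3 := by ring
  omega

section
variable {m n : ℤ}

lemma u₃_pos (hm : 0 ≤ m) (hn : 0 ≤ n) : 8 * n + 10 < 2 * u₃ m n := by
  have h1 : 0 ≤ 2 * (128 * n ^ 2 + 328 * n + 203) * (256 * n ^ 2 + 672 * n + 429) * m := by positivity
  have h2 : 0 ≤ 1792 * n ^ 3 + 6576 * n ^ 2 := by positivity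
  unfold u₃
  linarith

lemma formCycle₃ (hm : 0 ≤ m) (hn : 0 ≤ n) :
    FormCycle (D₃ m n) (u₃ m n) (period₃ m n) (palindromicForms 7 (forms₃ m n)) := by
  have hu := u₃_pos hm hn
  have hD4 := D₃_emod_four m n
  have ht : trDelta (D₃ m n) = 0 := by rw [trDelta, if_neg (by omega)]
  have hd : negNormDelta (D₃ m n) = D₃ m n := by rw [negNormDelta, if_neg (by omega)]
  have e1 : 0 ≤ m * n := by positivity
  have e2 : 0 ≤ m * n ^ 2 := by positivity
  have e3 : 0 ≤ m * n ^ 3 := by positivity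
  have e4 : 0 ≤ m * n ^ 4 := by positivity
  have e5 : 0 ≤ n ^ 2 := by positivity
  have e6 : 0 ≤ n ^ 3 := by positivity
  refine FormCycle.of_palindrome (by simp [period₃]) (by norm_num) ?_ (by linarith) ?_ ?_ ?_ ?_ ?_ ?_
    ?_ ?_
  · rw [D₃_eq_sq_add]
    simp only [forms₃]
    nlinarith [sq_nonneg (u₃ m n)]
  · intro k hk
    simp only [period₃, List.length_cons, List.length_nil] at hk
    interval_cases k <;> simp [period₃] <;> linarith
  · intro k hk
    have : k < 6 := by omega
    interval_cases k <;> rfl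
  · rw [ht]; simp [period₃]
  · rw [ht, hd, D₃_eq_sq_add]
    simp only [forms₃, u₃, Prod.mk.injEq]
    refine ⟨trivial, ?_, ?_⟩ <;> ring
  · intro k hk
    have : k < 6 := by omega
    interval_cases k <;>
      simp only [forms₃, period₃, stepForm, List.getD_cons_zero, List.getD_cons_succ,
        Prod.mk.injEq] <;> refine ⟨trivial, ?_, ?_⟩ <;> ring
  · simp only [forms₃, period₃, stepForm, revForm, List.getD_cons_zero, List.getD_cons_succ,
      Prod.mk.injEq, Nat.reduceSub]
    refine ⟨trivial, ?_, ?_⟩ <;> ring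
  · intro k hk
    interval_cases k <;> simp only [forms₃] <;> norm_num <;> linarith
  · intro k hk
    interval_cases k <;> simp only [forms₃] <;> norm_num <;> linarith

lemma palindromicForms₃_seven : (palindromicForms 7 (forms₃ m n) 7).1 = -N₃ m n := by
  rw [palindromicForms_of_le _ (i := 6) (by norm_num) (by norm_num)]
  simp only [forms₃, revForm, N₃]; ring

lemma hasPeriodicExpansion₃ (hm : 0 ≤ m) (hn : 0 ≤ n) :
    HasPeriodicExpansion (xi (D₃ m n)) (u₃ m n) (period₃ m n) := by
  have hu := u₃_pos hm hn
  refine (formCycle₃ hm hn).hasPeriodicExpansion ?_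
  intro k hk
  simp only [period₃, List.length_cons, List.length_nil] at hk
  have : k < 13 := by omega
  interval_cases k <;> simp [period₃] <;> linarith

lemma isLeast_negNorms₃ (hm : 0 ≤ m) (hn : 0 ≤ n) : IsLeast (negNorms (D₃ m n)) (N₃ m n) := by
  have e1 : 0 ≤ m * n := by positivity
  have e2 : 0 ≤ m * n ^ 2 := by positivity
  have e3 : 0 ≤ m * n ^ 3 := by positivity
  have e4 : 0 ≤ m * n ^ 4 := by positivity
  have e5 : 0 ≤ n ^ 2 := by positivity
  have e6 : 0 ≤ n ^ 3 := by positivity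
  refine (formCycle₃ hm hn).isLeast_negNorms (by unfold N₃; positivity) ?_ (k := 7)
    (by simp [period₃]) palindromicForms₃_seven
  intro k hk hodd
  simp only [period₃, List.length_cons, List.length_nil] at hk
  obtain ⟨j, rfl⟩ := hodd
  have : j < 7 := by omega
  interval_cases j <;> simp [palindromicForms, forms₃, revForm, N₃] <;> linarith

/-- The entries of the period that occur here are `1` or `2`, so only `r ≤ 2` has to be considered. -/
lemma norm_le_M₃ (hm : 0 ≤ m) (hn : 0 ≤ n) : ∀ k < (period₃ m n).length, Even k → ∀ r, 0 ≤ r →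
    r ≤ (period₃ m n).getD k 0 → (palindromicForms 7 (forms₃ m n) k).1 +
      (palindromicForms 7 (forms₃ m n) k).2.1 * r +
      (palindromicForms 7 (forms₃ m n) k).2.2 * r ^ 2 ≤ M₃ m n := by
  have e1 : 0 ≤ m * n := by positivity
  have e2 : 0 ≤ m * n ^ 2 := by positivity
  have e3 : 0 ≤ m * n ^ 3 := by positivity
  have e4 : 0 ≤ m * n ^ 4 := by positivity
  have e5 : 0 ≤ n ^ 2 := by positivity
  have e6 : 0 ≤ n ^ 3 := by positivity
  intro k hk heven r hr hr'
  simp only [period₃, List.length_cons, List.length_nil] at hk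
  obtain ⟨j, rfl⟩ := heven
  have : j < 7 := by omega
  interval_cases j <;> simp [period₃] at hr' <;> interval_cases r <;>
    simp [palindromicForms, forms₃, revForm, M₃] <;> linarith

lemma norm_semiconv₃ : (palindromicForms 7 (forms₃ m n) 12).1 +
      (palindromicForms 7 (forms₃ m n) 12).2.1 * 1 +
      (palindromicForms 7 (forms₃ m n) 12).2.2 * 1 ^ 2 = M₃ m n := by
  simp [palindromicForms, forms₃, revForm, M₃]; ring

lemma isGreatest_norms₃ (hm : 0 ≤ m) (hn : 0 ≤ n) :
    IsGreatest (semiconvNorms (D₃ m n)) (M₃ m n) ∧ IsGreatest (indecNorms (D₃ m n)) (M₃ m n) :=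
  (formCycle₃ hm hn).isGreatest_norms (norm_le_M₃ hm hn) (k := 12) (r := 1) (by simp [period₃])
    (by decide) (by norm_num) (by simp [period₃]) norm_semiconv₃

lemma factor₃_pos (hm : 0 ≤ m) (hn : 0 ≤ n) : 0 < factor₃ m n := by
  unfold factor₃; positivity

lemma jkMod₃ (hm : 0 ≤ m) (hn : 0 ≤ n) : jkMod (D₃ m n) = 2 * factor₃ m n := by
  have := D₃_emod_four m n
  rw [jkMod, if_neg (by omega), minNegNorm_eq (isLeast_negNorms₃ hm hn), N₃_eq]

lemma D₃_sub_sq (m n : ℤ) : D₃ m n - factor₃ m n ^ 2 = 2 * factor₃ m n * UB₃ m n := by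
  have h : cofactor₃ m n = factor₃ m n + 2 * UB₃ m n := by
    unfold cofactor₃ factor₃ UB₃; ring
  rw [D₃_eq, h]; ring

lemma UB₃_le_jkBound (hm : 0 ≤ m) (hn : 0 ≤ n) : (UB₃ m n : ℝ) ≤ jkBound (D₃ m n) := by
  have hg := factor₃_pos hm hn
  exact le_jkBound (by positivity) (jkMod₃ hm hn)
    (mem_jkRoots (jkMod₃ hm hn) hg.le (D₃_sub_sq m n)) (D₃_sub_sq m n)

lemma jkRoot₃_of_squarefree (hm : 0 ≤ m) (hn : 0 ≤ n) (h : Squarefree (factor₃ m n)) :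
    jkRoot (D₃ m n) = factor₃ m n ∧ jkBound (D₃ m n) = UB₃ m n := by
  have hg := factor₃_pos hm hn
  have hD := D₃_emod_four m n
  have h1 := jkRoot_eq_of_squarefree (D₃_eq m n) (by omega) (jkMod₃ hm hn) (dvd_mul_left _ _)
    (dvd_mul_right _ _) hg h (D₃_sub_sq m n)
  exact ⟨h1, jkBound_of_jkRoot_eq (by positivity) (jkMod₃ hm hn) h1 (D₃_sub_sq m n)⟩

lemma UB₃_lt_M₃ (hm : 0 ≤ m) (hn : 0 ≤ n) : UB₃ m n < M₃ m n := by
  have h : 0 < (16384 * n ^ 4 + 83968 * n ^ 3 + 158272 * n ^ 2 + 129808 * n + 39060) * m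
    + 448 * n ^ 3 + 1616 * n ^ 2 + 1876 * n + 705 := by positivity
  unfold M₃ UB₃; linarith

lemma excessRatio₃_lt (hm : 0 ≤ m) (hn : 0 ≤ n) {p q : ℤ} (hp : 0 < p) (hq : 0 < q)
    (h : p * (M₃ m n - UB₃ m n) ≤ q * u₃ m n) : excessRatio (D₃ m n) < (q : ℝ) / p := by
  have hc := formCycle₃ hm hn
  have hD := D₃_emod_four m n
  have hM := (isGreatest_norms₃ hm hn).1
  have hw : (u₃ m n : ℝ) < √(D₃ m n : ℝ) := (hc.admissible.lt_sqrt (by omega)).1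
  exact excessRatio_lt (maxNorm_eq hM) (UB₃_le_jkBound hm hn) (by linarith [u₃_pos hm hn]) hw hp hq h

lemma lt_excessRatio₃ (hm : 0 ≤ m) (hn : 0 ≤ n) (hsq : Squarefree (factor₃ m n)) {p q : ℤ}
    (hp : 0 < p) (hq : 0 ≤ q) (h : q * (u₃ m n + 1) < p * (M₃ m n - UB₃ m n)) :
    (q : ℝ) / p < excessRatio (D₃ m n) := by
  have hc := formCycle₃ hm hn
  have hD := D₃_emod_four m n
  have hM := (isGreatest_norms₃ hm hn).1
  exact lt_excessRatio (maxNorm_eq hM) (jkRoot₃_of_squarefree hm hn hsq).2 hc.pos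
    (hc.admissible.lt_sqrt (by omega)).2 hp hq h

lemma excessRatio₃_lt_quarter_sub (hm : 0 ≤ m) (hn : 0 ≤ n) :
    excessRatio (D₃ m n) < 1 / 4 - 1 / (64 * ((n : ℝ) + 1)) := by
  -- The difference of the two sides of the inequality to be shown, up to an additive constant.
  have h0 : 0 ≤ (69632 * n ^ 3 + 249856 * n ^ 2 + 293072 * n + 112770) * m + 1904 * n ^ 2
    + 3918 * n + 2010 := by positivity
  have h := excessRatio₃_lt hm hn (p := 64 * (n + 1)) (q := 16 * (n + 1) - 1) (by positivity)
    (by linarith) (by unfold M₃ UB₃ u₃; linarith)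
  have hn' : (0 : ℝ) ≤ n := by exact_mod_cast hn
  have e : (1 : ℝ) / 4 - 1 / (64 * ((n : ℝ) + 1)) = ((16 * (n + 1) - 1 : ℤ) : ℝ) /
      ((64 * (n + 1) : ℤ) : ℝ) := by
    push_cast; field_simp; ring
  rw [e]; exact h

lemma excessRatio₃_lt_quarter_sub' (hm : 0 ≤ m) (hn : 26 ≤ n) :
    excessRatio (D₃ m n) < 1 / 4 - 1 / (64 * (n : ℝ)) := by
  obtain ⟨k, hk, rfl⟩ : ∃ k, 0 ≤ k ∧ n = k + 26 := ⟨n - 26, by omega, by omega⟩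
  -- The difference of the two sides of the inequality to be shown, up to an additive constant.
  have h0 : 0 ≤ (4096 * k ^ 3 + 225280 * k ^ 2 + 3140560 * k + 1182402) * m + 112 * k ^ 2
    + 3054 * k + 550 := by positivity
  have h := excessRatio₃_lt (n := k + 26) hm (by omega) (p := 64 * (k + 26))
    (q := 16 * (k + 26) - 1) (by positivity) (by linarith) (by unfold M₃ UB₃ u₃; linarith)
  have hk' : (0 : ℝ) ≤ k := by exact_mod_cast hk
  have e : (1 : ℝ) / 4 - 1 / (64 * ((k + 26 : ℤ) : ℝ)) = ((16 * (k + 26) - 1 : ℤ) : ℝ) /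
      ((64 * (k + 26) : ℤ) : ℝ) := by
    push_cast; field_simp; ring
  rw [e]; exact h

lemma rho₃_lt_excessRatio (hm : 0 ≤ m) (hn : 0 ≤ n) (hsq : Squarefree (factor₃ m n)) :
    rho₃ n < excessRatio (D₃ m n) := by
  -- The difference of the two sides of the inequality to be shown, up to an additive constant.
  have h0 : 0 ≤ 8192 * n ^ 4 + 44544 * n ^ 3 + 90368 * n ^ 2 + 81040 * n := by positivity
  have h := lt_excessRatio₃ hm hn hsq
    (p := 2 * (128 * n ^ 2 + 328 * n + 203) * (256 * n ^ 2 + 672 * n + 429))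
    (q := 16384 * n ^ 4 + 83968 * n ^ 3 + 158272 * n ^ 2 + 129808 * n + 39060)
    (by positivity) (by positivity) (by unfold M₃ UB₃ u₃; linarith)
  push_cast at h
  exact h

lemma quarter_sub_le_excessRatio₃ (hm : 0 ≤ m) (hn : 3 ≤ n) (hsq : Squarefree (factor₃ m n)) :
    1 / 4 - 1 / ((n : ℝ) + 1) ≤ excessRatio (D₃ m n) := by
  obtain ⟨k, hk, rfl⟩ : ∃ k, 0 ≤ k ∧ n = k + 3 := ⟨n - 3, by omega, by omega⟩
  -- The difference of the two sides of the inequality to be shown, up to an additive constant.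
  have h0 : 0 ≤ (258048 * k ^ 4 + 4430848 * k ^ 3 + 28504880 * k ^ 2 + 81429634 * k
      + 87154752) * m + 7056 * k ^ 3 + 89278 * k ^ 2 + 376103 * k + 527567 := by positivity
  have h := lt_excessRatio₃ (n := k + 3) hm (by omega) hsq
    (p := 4 * (k + 4)) (q := k) (by positivity) hk (by unfold M₃ UB₃ u₃; linarith)
  have hk' : (0 : ℝ) ≤ k := by exact_mod_cast hk
  have e : (1 : ℝ) / 4 - 1 / (((k + 3 : ℤ) : ℝ) + 1) = (k : ℝ) / ((4 * (k + 4) : ℤ) : ℝ) := by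
    push_cast; field_simp; ring
  rw [e]; exact h.le

end

lemma Good₃.squarefree {m n : ℕ} (h : Good₃ m n) : Squarefree (factor₃ m n) := by
  rcases h with ⟨p, hp, hN⟩ | h
  · rw [N₃_eq] at hN
    have : factor₃ m n = p := by linarith
    rw [this]
    exact (Nat.prime_iff_prime_int.1 hp).squarefree
  · rw [D₃_eq] at h
    exact h.squarefree_of_dvd (dvd_mul_left _ _)

lemma factor₃_combination (m n : ℤ) : (128 * n ^ 2 + 328 * n + 203) ^ 2 * cofactor₃ m n
    + -(256 * n ^ 2 + 672 * n + 429) ^ 2 * factor₃ m n = 2 ^ 1 := by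
  unfold factor₃ cofactor₃; ring

lemma odd_factor₃ (m n : ℤ) : Odd (cofactor₃ m n) ∧ Odd (factor₃ m n) := by
  rw [← Int.odd_mul, ← D₃_eq, Int.odd_iff]
  have := D₃_emod_four m n
  omega

lemma isCoprime_factor₃ (n : ℤ) :
    IsCoprime (2 * (128 * n ^ 2 + 328 * n + 203) ^ 2) (factor₃ 0 n) ∧
    IsCoprime (2 * (256 * n ^ 2 + 672 * n + 429) ^ 2) (cofactor₃ 0 n) := by
  have h := factor₃_combination 0 n
  constructor
  · exact isCoprime_of_combination_eq_two_pow (x := cofactor₃ 0 n)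
      (y := -2 * (256 * n ^ 2 + 672 * n + 429) ^ 2) (k := 2) (by linear_combination 2 * h)
      (odd_factor₃ 0 n).2
  · exact isCoprime_of_combination_eq_two_pow (x := -factor₃ 0 n)
      (y := 2 * (128 * n ^ 2 + 328 * n + 203) ^ 2) (k := 2) (by linear_combination 2 * h)
      (odd_factor₃ 0 n).1

lemma factor₃_eq (m n : ℤ) :
    factor₃ m n = 2 * (128 * n ^ 2 + 328 * n + 203) ^ 2 * m + factor₃ 0 n := by
  unfold factor₃; ring

lemma cofactor₃_eq (m n : ℤ) :
    cofactor₃ m n = 2 * (256 * n ^ 2 + 672 * n + 429) ^ 2 * m + cofactor₃ 0 n := by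
  unfold cofactor₃; ring

lemma infinite_prime₃ (n : ℕ) : {m : ℕ | ∃ p : ℕ, p.Prime ∧ N₃ m n = 2 * p}.Infinite := by
  rw [Set.infinite_iff_exists_gt]
  intro B
  obtain ⟨m, hm, p, hp, e⟩ := exists_gt_prime_linear (by positivity) (isCoprime_factor₃ n).1 B
  exact ⟨m, ⟨p, hp, by rw [N₃_eq, factor₃_eq, e]⟩, hm⟩

lemma infinite_squarefree₃ (n : ℕ) : {m : ℕ | Squarefree (D₃ m n)}.Infinite := by
  have h := infinite_squarefree_linear_mul
    (a := 2 * (256 * (n : ℤ) ^ 2 + 672 * n + 429) ^ 2) (b := cofactor₃ 0 n)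
    (c := 2 * (128 * (n : ℤ) ^ 2 + 328 * n + 203) ^ 2) (d := factor₃ 0 n)
    (by positivity) (by unfold cofactor₃; positivity) (by positivity) (by unfold factor₃; positivity)
    (isCoprime_factor₃ n).2 (isCoprime_factor₃ n).1
    (fun m => by rw [← factor₃_eq, ← cofactor₃_eq]; exact odd_factor₃ m n)
    (fun m => by
      rw [← factor₃_eq, ← cofactor₃_eq]
      exact isCoprime_of_combination_eq_two_pow (factor₃_combination m n) (odd_factor₃ m n).2)
  simp only [← factor₃_eq, ← cofactor₃_eq, ← D₃_eq] at h
  exact h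

lemma tendsto_excessRatio₃ (n : ℕ) : Tendsto (fun m : ℕ => excessRatio (D₃ m n))
    (atTop ⊓ 𝓟 {m | Good₃ m n}) (𝓝 (rho₃ n)) := by
  have hup : Tendsto (fun m : ℕ => ((M₃ m n - UB₃ m n : ℤ) : ℝ) / (u₃ m n : ℝ))
      (atTop ⊓ 𝓟 {m | Good₃ m n}) (𝓝 (rho₃ n)) := by
    have h := tendsto_linear_div_linear
      (a := 16384 * (n : ℝ) ^ 4 + 83968 * n ^ 3 + 158272 * n ^ 2 + 129808 * n + 39060)
      (b := 448 * (n : ℝ) ^ 3 + 1616 * n ^ 2 + 1876 * n + 705)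
      (c := 2 * (128 * (n : ℝ) ^ 2 + 328 * n + 203) * (256 * n ^ 2 + 672 * n + 429))
      (d := 1792 * (n : ℝ) ^ 3 + 6576 * n ^ 2 + 7922 * n + 3142) (by positivity)
    refine (h.congr ?_).mono_left inf_le_left
    intro m
    unfold M₃ UB₃ u₃
    push_cast
    congr 1 <;> ring
  have hgood : ∀ᶠ m : ℕ in atTop ⊓ 𝓟 {m | Good₃ m n}, Good₃ m n :=
    mem_inf_of_right (mem_principal_self _)
  refine tendsto_of_tendsto_of_tendsto_of_le_of_le' tendsto_const_nhds hup ?_ ?_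
  · filter_upwards [hgood] with m hm
    have := rho₃_lt_excessRatio (Int.natCast_nonneg m) (Int.natCast_nonneg n) hm.squarefree
    exact_mod_cast this.le
  · refine Eventually.of_forall fun m => ?_
    have hm := Int.natCast_nonneg m
    have hn := Int.natCast_nonneg n
    have hu := u₃_pos hm hn
    have hE := UB₃_lt_M₃ hm hn
    exact (excessRatio₃_lt hm hn (by linarith) (by linarith) (by linarith)).le

lemma tendsto_excessRatio₃_quarter :
    Tendsto (fun z : ℕ × ℕ => excessRatio (D₃ z.1 z.2))
      (((⊤ : Filter ℕ) ×ˢ (atTop : Filter ℕ)) ⊓ 𝓟 {z | Good₃ z.1 z.2}) (𝓝[<] (1 / 4)) := by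
  refine tendsto_nhdsLT_of_lower_bound 3 (tendsto_const_sub_one_div (1 / 4)) ?_
  rintro ⟨m, n⟩ hz hn
  have hz' : Good₃ m n := hz
  have h1 := quarter_sub_le_excessRatio₃ (m := m) (n := n) (by positivity) (by exact_mod_cast hn)
    hz'.squarefree
  have h2 := excessRatio₃_lt_quarter_sub (m := m) (n := n) (by positivity) (by positivity)
  refine ⟨by simpa using h1, h2.trans_le ?_⟩
  have : (0 : ℝ) ≤ 1 / (64 * (((n : ℤ) : ℝ) + 1)) := by positivity
  linarith

lemma family₃ (m n : ℕ) :
    0 < D₃ m n ∧ D₃ m n % 4 = 3 ∧ ¬ IsSquare (D₃ m n) ∧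
    HasPeriodicExpansion (xi (D₃ m n)) (u₃ m n) (period₃ m n) ∧
    IsLeast (negNorms (D₃ m n)) (N₃ m n) ∧
    QuadraticAlgebra.norm (conv (D₃ m n) (5 + 1)) = -N₃ m n ∧
    Indecomposable (semiconv (D₃ m n) 11 1) ∧
    QuadraticAlgebra.norm (semiconv (D₃ m n) 11 1) = M₃ m n ∧
    IsGreatest (semiconvNorms (D₃ m n)) (M₃ m n) ∧
    IsGreatest (indecNorms (D₃ m n)) (M₃ m n) ∧
    IsLeast (jkRoots (D₃ m n)) (jkRoot (D₃ m n)) ∧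
    (Good₃ m n →
      2 * jkRoot (D₃ m n) = N₃ m n ∧
      jkBound (D₃ m n) = UB₃ m n ∧
      jkBound (D₃ m n) < M₃ m n ∧
      rho₃ n < excessRatio (D₃ m n)) ∧
    excessRatio (D₃ m n) < 1 / 4 - 1 / (64 * ((n : ℝ) + 1)) ∧
    (26 ≤ n → excessRatio (D₃ m n) < 1 / 4 - 1 / (64 * (n : ℝ))) := by
  have hm : (0 : ℤ) ≤ m := by positivity
  have hn : (0 : ℤ) ≤ n := by positivity
  have hc := formCycle₃ hm hn
  have hmax := isGreatest_norms₃ hm hn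
  refine ⟨hc.pos, D₃_emod_four m n, hc.admissible.not_isSquare, hasPeriodicExpansion₃ hm hn,
    isLeast_negNorms₃ hm hn, ?_, ?_, ?_, hmax.1, hmax.2, ?_, ?_, ?_, ?_⟩
  · rw [hc.norm_conv (k := 7) rfl (by simp [period₃])]
    exact palindromicForms₃_seven
  · exact hc.indecomposable_semiconv (k := 12) (by norm_num) rfl (by simp [period₃]) (by decide)
      (by norm_num) (by simp [period₃])
  · rw [hc.norm_semiconv (k := 12) (by norm_num) rfl (by simp [period₃])]
    exact norm_semiconv₃
  · exact isLeast_jkRoot (mem_jkRoots (jkMod₃ hm hn) (factor₃_pos hm hn).le (D₃_sub_sq m n))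
  · intro hg
    obtain ⟨h1, h2⟩ := jkRoot₃_of_squarefree hm hn hg.squarefree
    refine ⟨by rw [h1, N₃_eq], h2, ?_, ?_⟩
    · rw [h2]
      exact_mod_cast UB₃_lt_M₃ hm hn
    · exact_mod_cast rho₃_lt_excessRatio hm hn hg.squarefree
  · simpa using excessRatio₃_lt_quarter_sub hm hn
  · intro h26
    simpa using excessRatio₃_lt_quarter_sub' hm (by exact_mod_cast h26 : (26 : ℤ) ≤ n)

/-! ### The family with `D ≡ 1 mod 4` -/

/-- The norm forms along the first half of the period. -/
def forms₁ (m n : ℤ) : ℕ → ℤ × ℤ × ℤ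
  | 0 => (1,
      (4096 * n ^ 4 + 17920 * n ^ 3 + 27712 * n ^ 2 + 17736 * n + 4002) * m + 448 * n ^ 3
        + 1272 * n ^ 2 + 1082 * n + 287,
      -((2048 * n ^ 4 + 8704 * n ^ 3 + 13088 * n ^ 2 + 8160 * n + 1796) * m + 224 * n ^ 3
        + 608 * n ^ 2 + 500 * n + 129))
  | 1 => (-((2048 * n ^ 4 + 8704 * n ^ 3 + 13088 * n ^ 2 + 8160 * n + 1796) * m + 224 * n ^ 3
        + 608 * n ^ 2 + 500 * n + 129),
      -((4096 * n ^ 4 + 16896 * n ^ 3 + 24640 * n ^ 2 + 14904 * n + 3182) * m + 448 * n ^ 3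
        + 1160 * n ^ 2 + 918 * n + 229),
      (1024 * n ^ 3 + 3072 * n ^ 2 + 2832 * n + 820) * m + 112 * n ^ 2 + 164 * n + 59)
  | 2 => ((1024 * n ^ 3 + 3072 * n ^ 2 + 2832 * n + 820) * m + 112 * n ^ 2 + 164 * n + 59,
      (4096 * n ^ 4 + 15872 * n ^ 3 + 22592 * n ^ 2 + 14312 * n + 3378) * m + 448 * n ^ 3
        + 1048 * n ^ 2 + 866 * n + 243,
      -((4096 * n ^ 4 + 14848 * n ^ 3 + 18368 * n ^ 2 + 8952 * n + 1404) * m + 448 * n ^ 3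
        + 936 * n ^ 2 + 576 * n + 101))
  | 3 => (-((4096 * n ^ 4 + 14848 * n ^ 3 + 18368 * n ^ 2 + 8952 * n + 1404) * m + 448 * n ^ 3
        + 936 * n ^ 2 + 576 * n + 101),
      -((4096 * n ^ 4 + 13824 * n ^ 3 + 14144 * n ^ 2 + 3592 * n - 570) * m + 448 * n ^ 3
        + 824 * n ^ 2 + 286 * n - 41),
      (2048 * n ^ 3 + 7296 * n ^ 2 + 8192 * n + 2794) * m + 224 * n ^ 2 + 454 * n + 201)
  | 4 => ((2048 * n ^ 3 + 7296 * n ^ 2 + 8192 * n + 2794) * m + 224 * n ^ 2 + 454 * n + 201,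
      (4096 * n ^ 4 + 15360 * n ^ 3 + 18624 * n ^ 2 + 7584 * n + 570) * m + 448 * n ^ 3
        + 992 * n ^ 2 + 518 * n + 41,
      -((2560 * n ^ 4 + 10368 * n ^ 3 + 14376 * n ^ 2 + 7812 * n + 1404) * m + 280 * n ^ 3
        + 704 * n ^ 2 + 494 * n + 101))
  | 5 => (-((2560 * n ^ 4 + 10368 * n ^ 3 + 14376 * n ^ 2 + 7812 * n + 1404) * m + 280 * n ^ 3
        + 704 * n ^ 2 + 494 * n + 101),
      -((1024 * n ^ 4 + 5376 * n ^ 3 + 10128 * n ^ 2 + 8040 * n + 2238) * m + 112 * n ^ 3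
        + 416 * n ^ 2 + 470 * n + 161),
      (1536 * n ^ 4 + 7040 * n ^ 3 + 11544 * n ^ 2 + 7964 * n + 1960) * m + 168 * n ^ 3
        + 512 * n ^ 2 + 478 * n + 141)
  | 6 => ((1536 * n ^ 4 + 7040 * n ^ 3 + 11544 * n ^ 2 + 7964 * n + 1960) * m + 168 * n ^ 3
        + 512 * n ^ 2 + 478 * n + 141,
      (2048 * n ^ 4 + 8704 * n ^ 3 + 12960 * n ^ 2 + 7888 * n + 1682) * m + 224 * n ^ 3
        + 608 * n ^ 2 + 486 * n + 121,
      -((2048 * n ^ 4 + 8704 * n ^ 3 + 12960 * n ^ 2 + 7888 * n + 1682) * m + 224 * n ^ 3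
        + 608 * n ^ 2 + 486 * n + 121))
  | _ => 0

/-- The first factor of `D₁`; the second one is `N₁`. -/
def cofactor₁ (m n : ℤ) : ℤ :=
  2 * (64 * n ^ 2 + 144 * n + 69) ^ 2 * m + 896 * n ^ 3 + 2656 * n ^ 2 + 2398 * n + 685

lemma D₁_eq (m n : ℤ) : D₁ m n = cofactor₁ m n * N₁ m n := rfl

lemma D₁_eq_sq_add (m n : ℤ) :
    D₁ m n = 4 * (u₁ m n ^ 2 + u₁ m n + -(forms₁ m n 1).1) + 1 := by
  simp only [D₁, u₁, forms₁]; ring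

lemma D₁_emod_four (m n : ℤ) : D₁ m n % 4 = 1 := by
  rw [D₁_eq_sq_add]; omega

section
variable {m n : ℤ}

lemma u₁_pos (hm : 1 ≤ m) (hn : 1 ≤ n) : 4 * n + 4 < 2 * u₁ m n := by
  have h1 : 0 ≤ (64 * n ^ 2 + 144 * n + 69) * (32 * n ^ 2 + 68 * n + 29) * m := by positivity
  have h2 : 0 ≤ 224 * n ^ 3 + 636 * n ^ 2 := by positivity
  unfold u₁
  linarith

/-- The shifted monomials in terms of which the inequalities of this section are linear with
nonnegative coefficients. -/
lemma shifted_monomials_nonneg₁ (hm : 1 ≤ m) (hn : 1 ≤ n) :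
    0 ≤ (m - 1) * (n - 1) ∧ 0 ≤ (m - 1) * (n - 1) ^ 2 ∧ 0 ≤ (m - 1) * (n - 1) ^ 3 ∧
    0 ≤ (m - 1) * (n - 1) ^ 4 ∧ 0 ≤ (n - 1) ^ 2 ∧ 0 ≤ (n - 1) ^ 3 ∧ 0 ≤ (n - 1) ^ 4 := by
  have h1 : 0 ≤ m - 1 := by omega
  have h2 : 0 ≤ n - 1 := by omega
  refine ⟨?_, ?_, ?_, ?_, ?_, ?_, ?_⟩ <;> positivity

lemma formCycle₁ (hm : 1 ≤ m) (hn : 1 ≤ n) :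
    FormCycle (D₁ m n) (u₁ m n) (period₁ m n) (palindromicForms 7 (forms₁ m n)) := by
  have hu := u₁_pos hm hn
  have hD4 := D₁_emod_four m n
  have ht : trDelta (D₁ m n) = 1 := by rw [trDelta, if_pos hD4]
  have hd : negNormDelta (D₁ m n) = u₁ m n ^ 2 + u₁ m n + -(forms₁ m n 1).1 := by
    rw [negNormDelta, if_pos hD4, D₁_eq_sq_add]; omega
  obtain ⟨e1, e2, e3, e4, e5, e6, e7⟩ := shifted_monomials_nonneg₁ hm hn
  have hneg : ∀ k < 7, 0 < (-1) ^ k * (forms₁ m n k).1 := by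
    intro k hk
    interval_cases k <;> simp only [forms₁] <;> norm_num <;> linarith
  refine FormCycle.of_palindrome (by simp [period₁]) (by norm_num) ?_ (by linarith) ?_ ?_ ?_ ?_ ?_ ?_
    hneg ?_
  · have := hneg 1 (by norm_num)
    rw [D₁_eq_sq_add]
    nlinarith [sq_nonneg (u₁ m n)]
  · intro k hk
    simp only [period₁, List.length_cons, List.length_nil] at hk
    interval_cases k <;> simp [period₁] <;> linarith
  · intro k hk
    have : k < 6 := by omega
    interval_cases k <;> rfl
  · rw [ht]; simp [period₁]
  · rw [ht, hd]
    simp only [forms₁, u₁, Prod.mk.injEq]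
    refine ⟨trivial, ?_, ?_⟩ <;> ring
  · intro k hk
    have : k < 6 := by omega
    interval_cases k <;>
      simp only [forms₁, period₁, stepForm, List.getD_cons_zero, List.getD_cons_succ,
        Prod.mk.injEq] <;> refine ⟨trivial, ?_, ?_⟩ <;> ring
  · simp only [forms₁, period₁, stepForm, revForm, List.getD_cons_zero, List.getD_cons_succ,
      Prod.mk.injEq, Nat.reduceSub]
    refine ⟨trivial, ?_, ?_⟩ <;> ring
  · intro k hk
    interval_cases k <;> simp only [forms₁] <;> norm_num <;> linarith

lemma palindromicForms₁_seven : (palindromicForms 7 (forms₁ m n) 7).1 = -N₁ m n := by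
  rw [palindromicForms_of_le _ (i := 6) (by norm_num) (by norm_num)]
  simp only [forms₁, revForm, N₁]; ring

lemma hasPeriodicExpansion₁ (hm : 1 ≤ m) (hn : 1 ≤ n) :
    HasPeriodicExpansion (xi (D₁ m n)) (u₁ m n) (period₁ m n) := by
  have hu := u₁_pos hm hn
  refine (formCycle₁ hm hn).hasPeriodicExpansion ?_
  intro k hk
  simp only [period₁, List.length_cons, List.length_nil] at hk
  have : k < 13 := by omega
  interval_cases k <;> simp [period₁] <;> linarith

lemma N₁_pos (hm : 0 ≤ m) (hn : 0 ≤ n) : 0 < N₁ m n := by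
  unfold N₁; positivity

lemma isLeast_negNorms₁ (hm : 1 ≤ m) (hn : 1 ≤ n) : IsLeast (negNorms (D₁ m n)) (N₁ m n) := by
  obtain ⟨e1, e2, e3, e4, e5, e6, e7⟩ := shifted_monomials_nonneg₁ hm hn
  refine (formCycle₁ hm hn).isLeast_negNorms (N₁_pos (by omega) (by omega)) ?_ (k := 7)
    (by simp [period₁]) palindromicForms₁_seven
  intro k hk hodd
  simp only [period₁, List.length_cons, List.length_nil] at hk
  obtain ⟨j, rfl⟩ := hodd
  have : j < 7 := by omega
  interval_cases j <;> simp [palindromicForms, forms₁, revForm, N₁] <;> linarith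

/-- The entries of the period that occur here are `1` or `2`, so only `r ≤ 2` has to be considered. -/
lemma norm_le_M₁ (hm : 1 ≤ m) (hn : 1 ≤ n) : ∀ k < (period₁ m n).length, Even k → ∀ r, 0 ≤ r →
    r ≤ (period₁ m n).getD k 0 → (palindromicForms 7 (forms₁ m n) k).1 +
      (palindromicForms 7 (forms₁ m n) k).2.1 * r +
      (palindromicForms 7 (forms₁ m n) k).2.2 * r ^ 2 ≤ M₁ m n := by
  obtain ⟨e1, e2, e3, e4, e5, e6, e7⟩ := shifted_monomials_nonneg₁ hm hn
  intro k hk heven r hr hr'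
  simp only [period₁, List.length_cons, List.length_nil] at hk
  obtain ⟨j, rfl⟩ := heven
  have : j < 7 := by omega
  interval_cases j <;> simp [period₁] at hr' <;> interval_cases r <;>
    simp [palindromicForms, forms₁, revForm, M₁] <;> linarith

lemma norm_semiconv₁ : (palindromicForms 7 (forms₁ m n) 12).1 +
      (palindromicForms 7 (forms₁ m n) 12).2.1 * 1 +
      (palindromicForms 7 (forms₁ m n) 12).2.2 * 1 ^ 2 = M₁ m n := by
  rw [palindromicForms_of_le _ (i := 1) (by norm_num) (by norm_num)]
  simp only [forms₁, revForm, M₁]; ring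

lemma isGreatest_norms₁ (hm : 1 ≤ m) (hn : 1 ≤ n) :
    IsGreatest (semiconvNorms (D₁ m n)) (M₁ m n) ∧ IsGreatest (indecNorms (D₁ m n)) (M₁ m n) :=
  (formCycle₁ hm hn).isGreatest_norms (norm_le_M₁ hm hn) (k := 12) (r := 1) (by simp [period₁])
    (by decide) (by norm_num) (by simp [period₁]) norm_semiconv₁

lemma jkMod₁ (hm : 1 ≤ m) (hn : 1 ≤ n) : jkMod (D₁ m n) = 4 * N₁ m n := by
  rw [jkMod, if_pos (D₁_emod_four m n), minNegNorm_eq (isLeast_negNorms₁ hm hn)]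

lemma D₁_sub_sq (m n : ℤ) :
    D₁ m n - N₁ m n ^ 2 = 4 * N₁ m n * (M₁ m n - excess₁ m n) := by
  have h : cofactor₁ m n = N₁ m n + 4 * (M₁ m n - excess₁ m n) := by
    unfold cofactor₁ N₁ M₁ excess₁; ring
  rw [D₁_eq, h]; ring

lemma mem_jkRoots₁ (hm : 1 ≤ m) (hn : 1 ≤ n) : N₁ m n ∈ jkRoots (D₁ m n) :=
  mem_jkRoots (jkMod₁ hm hn) (N₁_pos (by omega) (by omega)).le (D₁_sub_sq m n)

lemma jkBound₁_of_squarefree (hm : 1 ≤ m) (hn : 1 ≤ n) (h : Squarefree (N₁ m n)) :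
    jkBound (D₁ m n) = (M₁ m n - excess₁ m n : ℤ) := by
  have hN := N₁_pos (m := m) (n := n) (by omega) (by omega)
  have hD := D₁_emod_four m n
  have h1 := jkRoot_eq_of_squarefree (D₁_eq m n) (by omega) (jkMod₁ hm hn) (dvd_mul_left _ _)
    (Dvd.intro (2 * N₁ m n) (by ring)) hN h (D₁_sub_sq m n)
  exact jkBound_of_jkRoot_eq (by positivity) (jkMod₁ hm hn) h1 (D₁_sub_sq m n)

lemma excess₁_pos (hm : 1 ≤ m) (hn : 1 ≤ n) : 0 < excess₁ m n := by
  unfold excess₁; positivity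

lemma excessRatio₁_lt (hm : 1 ≤ m) (hn : 1 ≤ n) :
    excessRatio (D₁ m n) < 1 / 8 - 1 / (64 * (n : ℝ)) := by
  obtain ⟨k, hk, rfl⟩ : ∃ k, 0 ≤ k ∧ n = k + 1 := ⟨n - 1, by omega, by omega⟩
  obtain ⟨l, hl, rfl⟩ : ∃ l, 0 ≤ l ∧ m = l + 1 := ⟨m - 1, by omega, by omega⟩
  have hc := formCycle₁ hm hn
  have hD := D₁_emod_four (l + 1) (k + 1)
  have hu := u₁_pos hm hn
  have hw : ((2 * u₁ (l + 1) (k + 1) + 1 : ℤ) : ℝ) < √(D₁ (l + 1) (k + 1) : ℝ) :=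
    (hc.admissible.lt_sqrt_of_emod_four hD).1
  have hN := N₁_pos (m := l + 1) (n := k + 1) (by omega) (by omega)
  -- The difference of the two sides of the inequality to be shown, up to an additive constant.
  have h0 : 0 ≤ (6656 * k ^ 3 + 30976 * k ^ 2 + 40520 * k + 12198) * l + 6656 * k ^ 3
      + 31704 * k ^ 2 + 42038 * k + 12701 := by positivity
  have h := excessRatio_lt (p := 64 * (k + 1)) (q := 8 * (k + 1) - 1)
    (maxNorm_eq (isGreatest_norms₁ hm hn).1)
    (le_jkBound (by positivity) (jkMod₁ hm hn) (mem_jkRoots₁ hm hn) (D₁_sub_sq _ _))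
    (by linarith) hw (by positivity) (by linarith)
    (by unfold excess₁ u₁; linarith)
  have hk' : (0 : ℝ) ≤ k := by exact_mod_cast hk
  have e : (1 : ℝ) / 8 - 1 / (64 * ((k + 1 : ℤ) : ℝ)) = ((8 * (k + 1) - 1 : ℤ) : ℝ) /
      ((64 * (k + 1) : ℤ) : ℝ) := by
    push_cast; field_simp; ring
  rw [e]; exact h

lemma eighth_sub_le_excessRatio₁ (hm : 1 ≤ m) (hn : 7 ≤ n) (hsq : Squarefree (N₁ m n)) :
    1 / 8 - 1 / ((n : ℝ) + 1) ≤ excessRatio (D₁ m n) := by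
  obtain ⟨k, hk, rfl⟩ : ∃ k, 0 ≤ k ∧ n = k + 7 := ⟨n - 7, by omega, by omega⟩
  obtain ⟨l, hl, rfl⟩ : ∃ l, 0 ≤ l ∧ m = l + 1 := ⟨m - 1, by omega, by omega⟩
  have hn' : 1 ≤ k + 7 := by omega
  have hc := formCycle₁ hm hn'
  have hD := D₁_emod_four (l + 1) (k + 7)
  have hw : √(D₁ (l + 1) (k + 7) : ℝ) < ((2 * u₁ (l + 1) (k + 7) + 3 : ℤ) : ℝ) :=
    (hc.admissible.lt_sqrt_of_emod_four hD).2
  -- The difference of the two sides of the inequality to be shown, up to an additive constant.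
  have h0 : 0 ≤ (32256 * k ^ 4 + 1042944 * k ^ 3 + 12632344 * k ^ 2 + 67930294 * k
      + 136840320) * l + 32256 * k ^ 4 + 1046472 * k ^ 3 + 12716302 * k ^ 2 + 68595351 * k
      + 138594047 := by positivity
  have h := lt_excessRatio (p := 8 * (k + 8)) (q := k)
    (maxNorm_eq (isGreatest_norms₁ hm hn').1) (jkBound₁_of_squarefree hm hn' hsq) hc.pos hw
    (by positivity) hk (by unfold excess₁ u₁; linarith)
  have hk' : (0 : ℝ) ≤ k := by exact_mod_cast hk
  have e : (1 : ℝ) / 8 - 1 / (((k + 7 : ℤ) : ℝ) + 1) = (k : ℝ) / ((8 * (k + 8) : ℤ) : ℝ) := by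
    push_cast; field_simp; ring
  rw [e]; exact h.le

end

lemma Good₁.squarefree {m n : ℕ} (h : Good₁ m n) : Squarefree (N₁ m n) := by
  rcases h.2 with ⟨p, hp, hN⟩ | h
  · rw [hN]
    exact (Nat.prime_iff_prime_int.1 hp).squarefree
  · rw [D₁_eq] at h
    exact h.squarefree_of_dvd (dvd_mul_left _ _)

lemma factor₁_combination (m n : ℤ) : (32 * n ^ 2 + 68 * n + 29) ^ 2 * cofactor₁ m n
    + -(64 * n ^ 2 + 144 * n + 69) ^ 2 * N₁ m n = 2 ^ 2 := by
  unfold N₁ cofactor₁; ring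

lemma odd_factor₁ (m n : ℤ) : Odd (cofactor₁ m n) ∧ Odd (N₁ m n) := by
  rw [← Int.odd_mul, ← D₁_eq, Int.odd_iff]
  have := D₁_emod_four m n
  omega

lemma isCoprime_factor₁ (n : ℤ) :
    IsCoprime (2 * (32 * n ^ 2 + 68 * n + 29) ^ 2) (N₁ 0 n) ∧
    IsCoprime (2 * (64 * n ^ 2 + 144 * n + 69) ^ 2) (cofactor₁ 0 n) := by
  have h := factor₁_combination 0 n
  constructor
  · exact isCoprime_of_combination_eq_two_pow (x := cofactor₁ 0 n)
      (y := -2 * (64 * n ^ 2 + 144 * n + 69) ^ 2) (k := 3) (by linear_combination 2 * h)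
      (odd_factor₁ 0 n).2
  · exact isCoprime_of_combination_eq_two_pow (x := -N₁ 0 n)
      (y := 2 * (32 * n ^ 2 + 68 * n + 29) ^ 2) (k := 3) (by linear_combination 2 * h)
      (odd_factor₁ 0 n).1

lemma N₁_eq (m n : ℤ) : N₁ m n = 2 * (32 * n ^ 2 + 68 * n + 29) ^ 2 * m + N₁ 0 n := by
  unfold N₁; ring

lemma cofactor₁_eq (m n : ℤ) :
    cofactor₁ m n = 2 * (64 * n ^ 2 + 144 * n + 69) ^ 2 * m + cofactor₁ 0 n := by
  unfold cofactor₁; ring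

lemma infinite_prime₁ (n : ℕ) : {m : ℕ | ∃ p : ℕ, p.Prime ∧ N₁ m n = p}.Infinite := by
  rw [Set.infinite_iff_exists_gt]
  intro B
  obtain ⟨m, hm, p, hp, e⟩ := exists_gt_prime_linear (by positivity) (isCoprime_factor₁ n).1 B
  exact ⟨m, ⟨p, hp, by rw [N₁_eq, e]⟩, hm⟩

lemma infinite_squarefree₁ (n : ℕ) : {m : ℕ | Squarefree (D₁ m n)}.Infinite := by
  have h := infinite_squarefree_linear_mul
    (a := 2 * (64 * (n : ℤ) ^ 2 + 144 * n + 69) ^ 2) (b := cofactor₁ 0 n)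
    (c := 2 * (32 * (n : ℤ) ^ 2 + 68 * n + 29) ^ 2) (d := N₁ 0 n)
    (by positivity) (by unfold cofactor₁; positivity) (by positivity)
    (N₁_pos le_rfl (Int.natCast_nonneg n))
    (isCoprime_factor₁ n).2 (isCoprime_factor₁ n).1
    (fun m => by rw [← N₁_eq, ← cofactor₁_eq]; exact odd_factor₁ m n)
    (fun m => by
      rw [← N₁_eq, ← cofactor₁_eq]
      exact isCoprime_of_combination_eq_two_pow (factor₁_combination m n) (odd_factor₁ m n).2)
  simp only [← N₁_eq, ← cofactor₁_eq, ← D₁_eq] at h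
  exact h

lemma tendsto_excessRatio₁_eighth :
    Tendsto (fun z : ℕ × ℕ => excessRatio (D₁ z.1 z.2))
      (((⊤ : Filter ℕ) ×ˢ (atTop : Filter ℕ)) ⊓ 𝓟 {z | Good₁ z.1 z.2}) (𝓝[<] (1 / 8)) := by
  refine tendsto_nhdsLT_of_lower_bound 7 (tendsto_const_sub_one_div (1 / 8)) ?_
  rintro ⟨m, n⟩ hz hn
  have hz' : Good₁ m n := hz
  have hm : (1 : ℤ) ≤ m := by exact_mod_cast hz'.1
  have hn' : (7 : ℤ) ≤ n := by exact_mod_cast hn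
  have h1 := eighth_sub_le_excessRatio₁ hm hn' hz'.squarefree
  have h2 := excessRatio₁_lt hm (by omega : (1 : ℤ) ≤ n)
  refine ⟨by simpa using h1, h2.trans_le ?_⟩
  have : (0 : ℝ) ≤ 1 / (64 * ((n : ℤ) : ℝ)) := by positivity
  linarith

lemma family₁ (m n : ℕ) (hm0 : 0 < m) (hn0 : 0 < n) :
    0 < D₁ m n ∧ D₁ m n % 4 = 1 ∧ ¬ IsSquare (D₁ m n) ∧
    HasPeriodicExpansion (xi (D₁ m n)) (u₁ m n) (period₁ m n) ∧
    IsLeast (negNorms (D₁ m n)) (N₁ m n) ∧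
    QuadraticAlgebra.norm (conv (D₁ m n) (5 + 1)) = -N₁ m n ∧
    (∀ r : ℤ, 0 ≤ r → r ≤ partialQuotient (xi (D₁ m n)) (5 + 2) →
      QuadraticAlgebra.norm (semiconv (D₁ m n) 5 r) ≤
        QuadraticAlgebra.norm (semiconv (D₁ m n) 5 0)) ∧
    Indecomposable (semiconv (D₁ m n) 11 1) ∧
    QuadraticAlgebra.norm (semiconv (D₁ m n) 11 1) = M₁ m n ∧
    IsGreatest (semiconvNorms (D₁ m n)) (M₁ m n) ∧
    IsGreatest (indecNorms (D₁ m n)) (M₁ m n) ∧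
    IsLeast (jkRoots (D₁ m n)) (jkRoot (D₁ m n)) ∧
    (Good₁ m n →
      (M₁ m n : ℝ) - jkBound (D₁ m n) = excess₁ m n ∧
      jkBound (D₁ m n) < M₁ m n) ∧
    excessRatio (D₁ m n) < 1 / 8 - 1 / (64 * (n : ℝ)) := by
  have hm : (1 : ℤ) ≤ m := by exact_mod_cast hm0
  have hn : (1 : ℤ) ≤ n := by exact_mod_cast hn0
  have hc := formCycle₁ hm hn
  have hmax := isGreatest_norms₁ hm hn
  refine ⟨hc.pos, D₁_emod_four m n, hc.admissible.not_isSquare, hasPeriodicExpansion₁ hm hn,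
    isLeast_negNorms₁ hm hn, ?_, ?_, ?_, ?_, hmax.1, hmax.2, isLeast_jkRoot (mem_jkRoots₁ hm hn),
    ?_, ?_⟩
  · rw [hc.norm_conv (k := 7) rfl (by simp [period₁])]
    exact palindromicForms₁_seven
  · intro r hr hr'
    rw [hc.admissible.partialQuotient_xi] at hr'
    have hr1 : r ≤ 1 := hr'
    rw [hc.norm_semiconv (k := 6) (by norm_num) rfl (by simp [period₁]),
      hc.norm_semiconv (k := 6) (by norm_num) rfl (by simp [period₁]),
      palindromicForms_of_lt _ (by norm_num)]
    simp only [forms₁]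
    interval_cases r <;> linarith
  · exact hc.indecomposable_semiconv (k := 12) (by norm_num) rfl (by simp [period₁]) (by decide)
      (by norm_num) (by simp [period₁])
  · rw [hc.norm_semiconv (k := 12) (by norm_num) rfl (by simp [period₁])]
    exact norm_semiconv₁
  · intro hg
    have h2 := jkBound₁_of_squarefree hm hn hg.squarefree
    have hE : (0 : ℝ) < excess₁ m n := by exact_mod_cast excess₁_pos hm hn
    rw [h2]
    push_cast
    constructor <;> linarith
  · simpa using excessRatio₁_lt hm hn

/-! ### The family with `D ≡ 2 mod 4` -/

/-- The norm forms along the first half of the period. -/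
def forms₂ (m n : ℤ) : ℕ → ℤ × ℤ × ℤ
  | 0 => (1,
      (12544 * n ^ 4 + 80640 * n ^ 3 + 194272 * n ^ 2 + 207872 * n + 83352) * m + 6272 * n ^ 4
        - 22400 * n ^ 3 - 207280 * n ^ 2 - 387616 * n - 222380,
      -((12544 * n ^ 4 + 68096 * n ^ 3 + 134016 * n ^ 2 + 111488 * n + 32014) * m
        + 6272 * n ^ 4 - 28672 * n ^ 3 - 174688 * n ^ 2 - 233312 * n - 85412))
  | 1 => (-((12544 * n ^ 4 + 68096 * n ^ 3 + 134016 * n ^ 2 + 111488 * n + 32014) * m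
        + 6272 * n ^ 4 - 28672 * n ^ 3 - 174688 * n ^ 2 - 233312 * n - 85412),
      -((12544 * n ^ 4 + 55552 * n ^ 3 + 73760 * n ^ 2 + 15104 * n - 19324) * m + 6272 * n ^ 4
        - 34944 * n ^ 3 - 142096 * n ^ 2 - 79008 * n + 51556),
      (12544 * n ^ 3 + 60256 * n ^ 2 + 96384 * n + 51338) * m + 6272 * n ^ 3 - 32592 * n ^ 2
        - 154304 * n - 136967)
  | 2 => ((12544 * n ^ 3 + 60256 * n ^ 2 + 96384 * n + 51338) * m + 6272 * n ^ 3
        - 32592 * n ^ 2 - 154304 * n - 136967,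
      (12544 * n ^ 4 + 64960 * n ^ 3 + 119008 * n ^ 2 + 87572 * n + 19324) * m + 6272 * n ^ 4
        - 30240 * n ^ 3 - 166512 * n ^ 2 - 194926 * n - 51556,
      -((7840 * n ^ 4 + 45472 * n ^ 3 + 97782 * n ^ 2 + 92164 * n + 32014) * m + 3920 * n ^ 4
        - 16464 * n ^ 3 - 116729 * n ^ 2 - 181756 * n - 85412))
  | 3 => (-((7840 * n ^ 4 + 45472 * n ^ 3 + 97782 * n ^ 2 + 92164 * n + 32014) * m
        + 3920 * n ^ 4 - 16464 * n ^ 3 - 116729 * n ^ 2 - 181756 * n - 85412),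
      -((3136 * n ^ 4 + 25984 * n ^ 3 + 76556 * n ^ 2 + 96756 * n + 44704) * m + 1568 * n ^ 4
        - 2688 * n ^ 3 - 66946 * n ^ 2 - 168586 * n - 119268),
      (4704 * n ^ 4 + 32032 * n ^ 3 + 81482 * n ^ 2 + 91792 * n + 38648) * m + 2352 * n ^ 4
        - 7504 * n ^ 3 - 82375 * n ^ 2 - 167474 * n - 103111)
  | 4 => ((4704 * n ^ 4 + 32032 * n ^ 3 + 81482 * n ^ 2 + 91792 * n + 38648) * m + 2352 * n ^ 4
        - 7504 * n ^ 3 - 82375 * n ^ 2 - 167474 * n - 103111,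
      (6272 * n ^ 4 + 38080 * n ^ 3 + 86408 * n ^ 2 + 86828 * n + 32592) * m + 3136 * n ^ 4
        - 12320 * n ^ 3 - 97804 * n ^ 2 - 166362 * n - 86954,
      -((6272 * n ^ 4 + 39424 * n ^ 3 + 92856 * n ^ 2 + 97128 * n + 38070) * m + 3136 * n ^ 4
        - 11648 * n ^ 3 - 101300 * n ^ 2 - 182868 * n - 101569))
  | 5 => (-((6272 * n ^ 4 + 39424 * n ^ 3 + 92856 * n ^ 2 + 97128 * n + 38070) * m
        + 3136 * n ^ 4 - 11648 * n ^ 3 - 101300 * n ^ 2 - 182868 * n - 101569),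
      -((6272 * n ^ 4 + 40768 * n ^ 3 + 99304 * n ^ 2 + 107428 * n + 43548) * m + 3136 * n ^ 4
        - 10976 * n ^ 3 - 104796 * n ^ 2 - 199374 * n - 116184),
      (4704 * n ^ 4 + 30688 * n ^ 3 + 75034 * n ^ 2 + 81492 * n + 33170) * m + 2352 * n ^ 4
        - 8176 * n ^ 3 - 78879 * n ^ 2 - 150968 * n - 88496)
  | 6 => ((4704 * n ^ 4 + 30688 * n ^ 3 + 75034 * n ^ 2 + 81492 * n + 33170) * m + 2352 * n ^ 4
        - 8176 * n ^ 3 - 78879 * n ^ 2 - 150968 * n - 88496,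
      (3136 * n ^ 4 + 20608 * n ^ 3 + 50764 * n ^ 2 + 55556 * n + 22792) * m + 1568 * n ^ 4
        - 5376 * n ^ 3 - 52962 * n ^ 2 - 102562 * n - 60808,
      -((7840 * n ^ 4 + 49504 * n ^ 3 + 117126 * n ^ 2 + 123064 * n + 48448) * m + 3920 * n ^ 4
        - 14448 * n ^ 3 - 127217 * n ^ 2 - 231274 * n - 129257))
  | 7 => (-((7840 * n ^ 4 + 49504 * n ^ 3 + 117126 * n ^ 2 + 123064 * n + 48448) * m
        + 3920 * n ^ 4 - 14448 * n ^ 3 - 127217 * n ^ 2 - 231274 * n - 129257),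
      -((12544 * n ^ 4 + 78400 * n ^ 3 + 183488 * n ^ 2 + 190572 * n + 74104) * m
        + 6272 * n ^ 4 - 23520 * n ^ 3 - 201472 * n ^ 2 - 359986 * n - 197706),
      (1792 * n ^ 3 + 8672 * n ^ 2 + 13984 * n + 7514) * m + 896 * n ^ 3 - 4624 * n ^ 2
        - 22256 * n - 20047)
  | 8 => ((1792 * n ^ 3 + 8672 * n ^ 2 + 13984 * n + 7514) * m + 896 * n ^ 3 - 4624 * n ^ 2
        - 22256 * n - 20047,
      (12544 * n ^ 4 + 78848 * n ^ 3 + 185728 * n ^ 2 + 194304 * n + 76176) * m + 6272 * n ^ 4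
        - 23296 * n ^ 3 - 202592 * n ^ 2 - 365792 * n - 203234,
      -((6272 * n ^ 4 + 39424 * n ^ 3 + 92864 * n ^ 2 + 97152 * n + 38088) * m + 3136 * n ^ 4
        - 11648 * n ^ 3 - 101296 * n ^ 2 - 182896 * n - 101617))
  | _ => 0

/-- The least root of the congruence modulo `N₂` when `N₂` is prime: half the middle coefficient of
the form `forms₂ m n 4`, whose last coefficient is `-N₂`. -/
def root₂ (m n : ℤ) : ℤ :=
  (3136 * n ^ 4 + 19040 * n ^ 3 + 43204 * n ^ 2 + 43414 * n + 16296) * m + 1568 * n ^ 4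
      - 6160 * n ^ 3 - 48902 * n ^ 2 - 83181 * n - 43477

lemma D₂_eq_sq_add (m n : ℤ) : D₂ m n = u₂ m n ^ 2 + -(forms₂ m n 1).1 := by
  simp only [D₂, u₂, forms₂]; ring

lemma D₂_emod_four (m n : ℤ) : D₂ m n % 4 = (2 * m) % 4 := by
  have h1 : u₂ m n = 2 * ((3136 * n ^ 4 + 20160 * n ^ 3 + 48568 * n ^ 2 + 51968 * n
      + 20838) * m + 1568 * n ^ 4 - 5600 * n ^ 3 - 51820 * n ^ 2 - 96904 * n - 55595) := by
    unfold u₂; ring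
  have h2 : -(forms₂ m n 1).1 = 4 * ((3136 * n ^ 4 + 17024 * n ^ 3 + 33504 * n ^ 2 + 27872 * n
      + 8003) * m + 1568 * n ^ 4 - 7168 * n ^ 3 - 43672 * n ^ 2 - 58328 * n - 21353) + 2 * m := by
    simp only [forms₂]; ring
  rw [D₂_eq_sq_add, h1, h2]
  generalize (3136 * n ^ 4 + 20160 * n ^ 3 + 48568 * n ^ 2 + 51968 * n + 20838) * m
      + 1568 * n ^ 4 - 5600 * n ^ 3 - 51820 * n ^ 2 - 96904 * n - 55595 = s
  generalize (3136 * n ^ 4 + 17024 * n ^ 3 + 33504 * n ^ 2 + 27872 * n + 8003) * m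
      + 1568 * n ^ 4 - 7168 * n ^ 3 - 43672 * n ^ 2 - 58328 * n - 21353 = t
  have : (2 * s) ^ 2 + (4 * t + 2 * m) = 4 * (s ^ 2 + t) + 2 * m := by ring
  omega

section
variable {m n : ℤ}

/-- The expressions in terms of which the inequalities of this section are linear with nonnegative
coefficients for `m, n ≥ 1`, `(m, n) ≠ (1, 1)`. -/
lemma shifted_monomials_nonneg₂ (hm : 1 ≤ m) (hn : 1 ≤ n) :
    0 ≤ (n - 1) * (n - 2) ∧ 0 ≤ (n - 1) * (n - 2) ^ 2 ∧ 0 ≤ (n - 1) * (n - 2) ^ 3 ∧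
    0 ≤ (m - 1) * (n - 1) ∧ 0 ≤ (m - 1) * ((n - 1) * (n - 2)) ∧
    0 ≤ (m - 1) * ((n - 1) * (n - 2) ^ 2) ∧ 0 ≤ (m - 1) * ((n - 1) * (n - 2) ^ 3) := by
  have h1 : 0 ≤ m - 1 := by omega
  have h2 : 0 ≤ n - 1 := by omega
  have h3 : 0 ≤ (n - 1) * (n - 2) ∧ 0 ≤ (n - 1) * (n - 2) ^ 2 ∧ 0 ≤ (n - 1) * (n - 2) ^ 3 := by
    rcases eq_or_lt_of_le hn with rfl | h
    · norm_num
    · have h3 : 0 ≤ n - 2 := by omega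
      refine ⟨?_, ?_, ?_⟩ <;> positivity
  obtain ⟨e1, e2, e3⟩ := h3
  exact ⟨e1, e2, e3, mul_nonneg h1 h2, mul_nonneg h1 e1, mul_nonneg h1 e2, mul_nonneg h1 e3⟩

lemma u₂_pos (hm : 1 ≤ m) (hn : 1 ≤ n) (hmn : 3 ≤ m + n) : 7 * n + 10 < 2 * u₂ m n := by
  obtain ⟨e1, e2, e3, e4, e5, e6, e7⟩ := shifted_monomials_nonneg₂ hm hn
  unfold u₂
  linarith

lemma formCycle₂ (hm : 1 ≤ m) (hn : 1 ≤ n) (hmn : 3 ≤ m + n) :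
    FormCycle (D₂ m n) (u₂ m n) (period₂ m n) (palindromicForms 9 (forms₂ m n)) := by
  have hu := u₂_pos hm hn hmn
  have hD4 := D₂_emod_four m n
  have ht : trDelta (D₂ m n) = 0 := by rw [trDelta, if_neg (by omega)]
  have hd : negNormDelta (D₂ m n) = D₂ m n := by rw [negNormDelta, if_neg (by omega)]
  obtain ⟨e1, e2, e3, e4, e5, e6, e7⟩ := shifted_monomials_nonneg₂ hm hn
  have hneg : ∀ k < 9, 0 < (-1) ^ k * (forms₂ m n k).1 := by
    intro k hk
    interval_cases k <;> simp only [forms₂] <;> norm_num <;> linarith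
  refine FormCycle.of_palindrome (by simp [period₂]) (by norm_num) ?_ (by linarith) ?_ ?_ ?_ ?_ ?_ ?_
    hneg ?_
  · have := hneg 1 (by norm_num)
    rw [D₂_eq_sq_add]
    nlinarith [sq_nonneg (u₂ m n)]
  · intro k hk
    simp only [period₂, List.length_cons, List.length_nil] at hk
    interval_cases k <;> simp [period₂] <;> linarith
  · intro k hk
    have : k < 8 := by omega
    interval_cases k <;> rfl
  · rw [ht]; simp [period₂]
  · rw [ht, hd, D₂_eq_sq_add]
    simp only [forms₂, u₂, Prod.mk.injEq]
    refine ⟨trivial, ?_, ?_⟩ <;> ring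
  · intro k hk
    have : k < 8 := by omega
    interval_cases k <;>
      simp only [forms₂, period₂, stepForm, List.getD_cons_zero, List.getD_cons_succ,
        Prod.mk.injEq] <;> refine ⟨trivial, ?_, ?_⟩ <;> ring
  · simp only [forms₂, period₂, stepForm, revForm, List.getD_cons_zero, List.getD_cons_succ,
      Prod.mk.injEq, Nat.reduceSub]
    refine ⟨trivial, ?_, ?_⟩ <;> ring
  · intro k hk
    interval_cases k <;> simp only [forms₂] <;> norm_num <;> linarith

lemma palindromicForms₂_five : (palindromicForms 9 (forms₂ m n) 5).1 = -N₂ m n := by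
  rw [palindromicForms_of_lt _ (by norm_num)]
  simp only [forms₂, N₂]

lemma hasPeriodicExpansion₂ (hm : 1 ≤ m) (hn : 1 ≤ n) (hmn : 3 ≤ m + n) :
    HasPeriodicExpansion (xi (D₂ m n)) (u₂ m n) (period₂ m n) := by
  have hu := u₂_pos hm hn hmn
  refine (formCycle₂ hm hn hmn).hasPeriodicExpansion ?_
  intro k hk
  simp only [period₂, List.length_cons, List.length_nil] at hk
  have : k < 17 := by omega
  interval_cases k <;> simp [period₂] <;> linarith

lemma N₂_pos (hm : 1 ≤ m) (hn : 1 ≤ n) (hmn : 3 ≤ m + n) : 0 < N₂ m n := by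
  obtain ⟨e1, e2, e3, e4, e5, e6, e7⟩ := shifted_monomials_nonneg₂ hm hn
  unfold N₂; linarith

lemma isLeast_negNorms₂ (hm : 1 ≤ m) (hn : 1 ≤ n) (hmn : 3 ≤ m + n) :
    IsLeast (negNorms (D₂ m n)) (N₂ m n) := by
  obtain ⟨e1, e2, e3, e4, e5, e6, e7⟩ := shifted_monomials_nonneg₂ hm hn
  refine (formCycle₂ hm hn hmn).isLeast_negNorms (N₂_pos hm hn hmn) ?_ (k := 5)
    (by simp [period₂]) palindromicForms₂_five
  intro k hk hodd
  simp only [period₂, List.length_cons, List.length_nil] at hk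
  obtain ⟨j, rfl⟩ := hodd
  have : j < 9 := by omega
  interval_cases j <;> simp [palindromicForms, forms₂, revForm, N₂] <;> linarith

/-- The entries of the period that occur here are `1` or `2`, so only `r ≤ 2` has to be considered. -/
lemma norm_le_M₂ (hm : 1 ≤ m) (hn : 1 ≤ n) (hmn : 3 ≤ m + n) :
    ∀ k < (period₂ m n).length, Even k → ∀ r, 0 ≤ r → r ≤ (period₂ m n).getD k 0 →
      (palindromicForms 9 (forms₂ m n) k).1 + (palindromicForms 9 (forms₂ m n) k).2.1 * r +
      (palindromicForms 9 (forms₂ m n) k).2.2 * r ^ 2 ≤ M₂ m n := by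
  obtain ⟨e1, e2, e3, e4, e5, e6, e7⟩ := shifted_monomials_nonneg₂ hm hn
  intro k hk heven r hr hr'
  simp only [period₂, List.length_cons, List.length_nil] at hk
  obtain ⟨j, rfl⟩ := heven
  have : j < 9 := by omega
  interval_cases j <;> simp [period₂] at hr' <;> interval_cases r <;>
    simp [palindromicForms, forms₂, revForm, M₂] <;> linarith

lemma norm_semiconv₂ : (palindromicForms 9 (forms₂ m n) 8).1 +
      (palindromicForms 9 (forms₂ m n) 8).2.1 * 1 +
      (palindromicForms 9 (forms₂ m n) 8).2.2 * 1 ^ 2 = M₂ m n := by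
  rw [palindromicForms_of_lt _ (by norm_num)]
  simp only [forms₂, M₂]; ring

lemma isGreatest_norms₂ (hm : 1 ≤ m) (hn : 1 ≤ n) (hmn : 3 ≤ m + n) :
    IsGreatest (semiconvNorms (D₂ m n)) (M₂ m n) ∧ IsGreatest (indecNorms (D₂ m n)) (M₂ m n) :=
  (formCycle₂ hm hn hmn).isGreatest_norms (norm_le_M₂ hm hn hmn) (k := 8) (r := 1)
    (by simp [period₂]) (by decide) (by norm_num) (by simp [period₂]) norm_semiconv₂

lemma jkMod₂ (hm : 1 ≤ m) (hn : 1 ≤ n) (hmn : 3 ≤ m + n) : jkMod (D₂ m n) = N₂ m n := by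
  have := D₂_emod_four m n
  rw [jkMod, if_neg (by omega), minNegNorm_eq (isLeast_negNorms₂ hm hn hmn)]

lemma D₂_sub_sq (m n : ℤ) :
    D₂ m n - root₂ m n ^ 2 = N₂ m n * (M₂ m n - excess₂ m n) := by
  unfold D₂ root₂ N₂ M₂ excess₂; ring

lemma root₂_bounds (hm : 1 ≤ m) (hn : 1 ≤ n) (hmn : 3 ≤ m + n) :
    0 ≤ root₂ m n ∧ 2 * root₂ m n ≤ N₂ m n := by
  obtain ⟨e1, e2, e3, e4, e5, e6, e7⟩ := shifted_monomials_nonneg₂ hm hn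
  unfold root₂ N₂
  constructor <;> linarith

lemma mem_jkRoots₂ (hm : 1 ≤ m) (hn : 1 ≤ n) (hmn : 3 ≤ m + n) :
    root₂ m n ∈ jkRoots (D₂ m n) :=
  mem_jkRoots (jkMod₂ hm hn hmn) (root₂_bounds hm hn hmn).1 (D₂_sub_sq m n)

lemma jkBound₂_of_prime (hm : 1 ≤ m) (hn : 1 ≤ n) (hmn : 3 ≤ m + n) (h : Prime (N₂ m n)) :
    jkBound (D₂ m n) = (M₂ m n - excess₂ m n : ℤ) := by
  obtain ⟨h0, hle⟩ := root₂_bounds hm hn hmn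
  exact jkBound_of_jkRoot_eq (N₂_pos hm hn hmn) (jkMod₂ hm hn hmn)
    (jkRoot_eq_of_prime h (jkMod₂ hm hn hmn) h0 hle (D₂_sub_sq m n)) (D₂_sub_sq m n)

lemma excess₂_pos (hm : 1 ≤ m) (hn : 1 ≤ n) (hmn : 3 ≤ m + n) : 0 < excess₂ m n := by
  obtain ⟨e1, e2, e3, e4, e5, e6, e7⟩ := shifted_monomials_nonneg₂ hm hn
  unfold excess₂; linarith

lemma excessRatio₂_lt (hm : 1 ≤ m) (hn : 1 ≤ n) (hmn : 3 ≤ m + n) :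
    excessRatio (D₂ m n) < 1 / 4 - 1 / (7 * ((n : ℝ) + 2)) := by
  have hc := formCycle₂ hm hn hmn
  have hD := D₂_emod_four m n
  have hu := u₂_pos hm hn hmn
  have hw : (u₂ m n : ℝ) < √(D₂ m n : ℝ) := (hc.admissible.lt_sqrt (by omega)).1
  obtain ⟨e1, e2, e3, e4, e5, e6, e7⟩ := shifted_monomials_nonneg₂ hm hn
  have h := excessRatio_lt (p := 28 * (n + 2)) (q := 7 * n + 10)
    (maxNorm_eq (isGreatest_norms₂ hm hn hmn).1)
    (le_jkBound (N₂_pos hm hn hmn) (jkMod₂ hm hn hmn) (mem_jkRoots₂ hm hn hmn) (D₂_sub_sq _ _))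
    (by linarith) hw (by positivity) (by positivity)
    (by unfold excess₂ u₂; linarith)
  have hn' : (1 : ℝ) ≤ n := by exact_mod_cast hn
  have e : (1 : ℝ) / 4 - 1 / (7 * ((n : ℝ) + 2)) = ((7 * n + 10 : ℤ) : ℝ) /
      ((28 * (n + 2) : ℤ) : ℝ) := by
    push_cast; field_simp; ring
  rw [e]; exact h

lemma quarter_sub_le_excessRatio₂ (hm : 1 ≤ m) (hn : 3 ≤ n) (hp : Prime (N₂ m n)) :
    1 / 4 - 1 / ((n : ℝ) + 1) ≤ excessRatio (D₂ m n) := by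
  obtain ⟨k, hk, rfl⟩ : ∃ k, 0 ≤ k ∧ n = k + 3 := ⟨n - 3, by omega, by omega⟩
  obtain ⟨l, hl, rfl⟩ : ∃ l, 0 ≤ l ∧ m = l + 1 := ⟨m - 1, by omega, by omega⟩
  have hn' : 1 ≤ k + 3 := by omega
  have hmn : 3 ≤ l + 1 + (k + 3) := by omega
  have hc := formCycle₂ hm hn' hmn
  have hD := D₂_emod_four (l + 1) (k + 3)
  have hw : √(D₂ (l + 1) (k + 3) : ℝ) < ((u₂ (l + 1) (k + 3) + 1 : ℤ) : ℝ) :=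
    (hc.admissible.lt_sqrt (by omega)).2
  -- The difference of the two sides of the inequality to be shown, up to an additive constant.
  have h0 : 0 ≤ (21504 * k ^ 4 + 398824 * k ^ 3 + 2773264 * k ^ 2 + 8569092 * k + 9927168) * l
      + 32256 * k ^ 4 + 490716 * k ^ 3 + 2657680 * k ^ 2 + 5860561 * k + 4044223 := by positivity
  have h := lt_excessRatio (p := 4 * (k + 4)) (q := k)
    (maxNorm_eq (isGreatest_norms₂ hm hn' hmn).1) (jkBound₂_of_prime hm hn' hmn hp) hc.pos hw
    (by positivity) hk (by unfold excess₂ u₂; linarith)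
  have hk' : (0 : ℝ) ≤ k := by exact_mod_cast hk
  have e : (1 : ℝ) / 4 - 1 / (((k + 3 : ℤ) : ℝ) + 1) = (k : ℝ) / ((4 * (k + 4) : ℤ) : ℝ) := by
    push_cast; field_simp; ring
  rw [e]; exact h.le

end

lemma Good₂.prime {m n : ℕ} (h : Good₂ m n) : Prime (N₂ m n) := by
  obtain ⟨p, hp, hN⟩ := h.2
  rw [hN]
  exact Nat.prime_iff_prime_int.1 hp

lemma infinite_prime₂ (n : ℕ) : {m : ℕ | Odd m ∧ ∃ p : ℕ, p.Prime ∧ N₂ m n = p}.Infinite := by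
  rw [Set.infinite_iff_exists_gt]
  intro B
  have hodd : Odd (N₂ 1 n) := ⟨4704 * n ^ 4 + 13888 * n ^ 3 - 4222 * n ^ 2 - 42870 * n
      - 31750, by unfold N₂; ring⟩
  -- The leading coefficient and the constant term of `N₂`, as polynomials in `n`, generate an ideal of
  -- `ℤ[n]` containing `4`; the cofactors below come from this relation.
  have hcop : IsCoprime (2 * (6272 * (n : ℤ) ^ 4 + 39424 * n ^ 3 + 92856 * n ^ 2 + 97128 * n
      + 38070))
      (N₂ 1 n) :=
    isCoprime_of_combination_eq_two_pow (k := 3) (x := 336 * n ^ 3 + 560 * n ^ 2 - 1037 * n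
      - 1728) (y := -448 * n ^ 3 - 2240 * n ^ 2 - 3732 * n - 2072) (by unfold N₂; ring) hodd
  obtain ⟨k, hk, p, hp, e⟩ := exists_gt_prime_linear (by positivity) hcop B
  refine ⟨2 * k + 1, ⟨⟨k, rfl⟩, p, hp, ?_⟩, by omega⟩
  rw [← e]
  unfold N₂
  push_cast
  ring

lemma tendsto_excessRatio₂_quarter :
    Tendsto (fun z : ℕ × ℕ => excessRatio (D₂ z.1 z.2))
      (((⊤ : Filter ℕ) ×ˢ (atTop : Filter ℕ)) ⊓ 𝓟 {z | Good₂ z.1 z.2}) (𝓝[<] (1 / 4)) := by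
  refine tendsto_nhdsLT_of_lower_bound 3 (tendsto_const_sub_one_div (1 / 4)) ?_
  rintro ⟨m, n⟩ hz hn
  have hz' : Good₂ m n := hz
  have hm : (1 : ℤ) ≤ m := by exact_mod_cast hz'.1
  have hn' : (3 : ℤ) ≤ n := by exact_mod_cast hn
  have h1 := quarter_sub_le_excessRatio₂ hm hn' hz'.prime
  have h2 := excessRatio₂_lt hm (by omega : (1 : ℤ) ≤ n) (by omega)
  refine ⟨by simpa using h1, h2.trans_le ?_⟩
  have : (0 : ℝ) ≤ 1 / (7 * (((n : ℤ) : ℝ) + 2)) := by positivity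
  linarith

lemma family₂ (m n : ℕ) (hm0 : 0 < m) (hn0 : 0 < n) (hne : (m, n) ≠ (1, 1)) :
    0 < D₂ m n ∧ (Odd m → D₂ m n % 4 = 2) ∧ (Even m → D₂ m n % 4 = 0) ∧
    ¬ IsSquare (D₂ m n) ∧
    HasPeriodicExpansion (xi (D₂ m n)) (u₂ m n) (period₂ m n) ∧
    IsLeast (negNorms (D₂ m n)) (N₂ m n) ∧
    QuadraticAlgebra.norm (conv (D₂ m n) (3 + 1)) = -N₂ m n ∧
    (∀ r : ℤ, 0 ≤ r → r ≤ partialQuotient (xi (D₂ m n)) (3 + 2) →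
      QuadraticAlgebra.norm (semiconv (D₂ m n) 3 r) ≤
        QuadraticAlgebra.norm (semiconv (D₂ m n) 3 0)) ∧
    Indecomposable (semiconv (D₂ m n) 7 1) ∧
    QuadraticAlgebra.norm (semiconv (D₂ m n) 7 1) = M₂ m n ∧
    IsGreatest (semiconvNorms (D₂ m n)) (M₂ m n) ∧
    IsGreatest (indecNorms (D₂ m n)) (M₂ m n) ∧
    IsLeast (jkRoots (D₂ m n)) (jkRoot (D₂ m n)) ∧
    (Good₂ m n →
      (M₂ m n : ℝ) - jkBound (D₂ m n) = excess₂ m n ∧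
      jkBound (D₂ m n) < M₂ m n) ∧
    excessRatio (D₂ m n) < 1 / 4 - 1 / (7 * ((n : ℝ) + 2)) := by
  have hm : (1 : ℤ) ≤ m := by exact_mod_cast hm0
  have hn : (1 : ℤ) ≤ n := by exact_mod_cast hn0
  have hmn : (3 : ℤ) ≤ m + n := by
    have : ¬ (m = 1 ∧ n = 1) := fun h => hne (by rw [h.1, h.2])
    omega
  have hc := formCycle₂ hm hn hmn
  have hmax := isGreatest_norms₂ hm hn hmn
  have hD := D₂_emod_four m n
  refine ⟨hc.pos, ?_, ?_, hc.admissible.not_isSquare, hasPeriodicExpansion₂ hm hn hmn,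
    isLeast_negNorms₂ hm hn hmn, ?_, ?_, ?_, ?_, hmax.1, hmax.2,
    isLeast_jkRoot (mem_jkRoots₂ hm hn hmn), ?_, ?_⟩
  · rintro ⟨k, rfl⟩
    omega
  · rintro ⟨k, rfl⟩
    omega
  · rw [hc.norm_conv (k := 5) rfl (by simp [period₂])]
    exact palindromicForms₂_five
  · intro r hr hr'
    rw [hc.admissible.partialQuotient_xi] at hr'
    have hr1 : r ≤ 1 := hr'
    obtain ⟨e1, e2, e3, e4, e5, e6, e7⟩ := shifted_monomials_nonneg₂ hm hn
    rw [hc.norm_semiconv (k := 4) (by norm_num) rfl (by simp [period₂]),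
      hc.norm_semiconv (k := 4) (by norm_num) rfl (by simp [period₂]),
      palindromicForms_of_lt _ (by norm_num)]
    simp only [forms₂]
    interval_cases r <;> linarith
  · exact hc.indecomposable_semiconv (k := 8) (by norm_num) rfl (by simp [period₂]) (by decide)
      (by norm_num) (by simp [period₂])
  · rw [hc.norm_semiconv (k := 8) (by norm_num) rfl (by simp [period₂])]
    exact norm_semiconv₂
  · intro hg
    have h2 := jkBound₂_of_prime hm hn hmn hg.prime
    have hE : (0 : ℝ) < excess₂ m n := by exact_mod_cast excess₂_pos hm hn hmn
    rw [h2]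
    push_cast
    constructor <;> linarith
  · simpa using excessRatio₂_lt hm hn hmn

end JangKim

theorem mainTheorem5 :
    -- the family with `D ≡ 3 mod 4`
    ((∀ m n : ℕ,
        0 < D₃ m n ∧ D₃ m n % 4 = 3 ∧ ¬ IsSquare (D₃ m n) ∧
        HasPeriodicExpansion (xi (D₃ m n)) (u₃ m n) (period₃ m n) ∧
        IsLeast (negNorms (D₃ m n)) (N₃ m n) ∧
        QuadraticAlgebra.norm (conv (D₃ m n) (5 + 1)) = -N₃ m n ∧
        Indecomposable (semiconv (D₃ m n) 11 1) ∧
        QuadraticAlgebra.norm (semiconv (D₃ m n) 11 1) = M₃ m n ∧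
        IsGreatest (semiconvNorms (D₃ m n)) (M₃ m n) ∧
        IsGreatest (indecNorms (D₃ m n)) (M₃ m n) ∧
        IsLeast (jkRoots (D₃ m n)) (jkRoot (D₃ m n)) ∧
        (Good₃ m n →
          2 * jkRoot (D₃ m n) = N₃ m n ∧
          jkBound (D₃ m n) = UB₃ m n ∧
          jkBound (D₃ m n) < M₃ m n ∧
          rho₃ n < excessRatio (D₃ m n)) ∧
        excessRatio (D₃ m n) < 1 / 4 - 1 / (64 * ((n : ℝ) + 1)) ∧
        (26 ≤ n → excessRatio (D₃ m n) < 1 / 4 - 1 / (64 * (n : ℝ)))) ∧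
      (∀ n : ℕ, {m : ℕ | ∃ p : ℕ, p.Prime ∧ N₃ m n = 2 * p}.Infinite) ∧
      (∀ n : ℕ, {m : ℕ | Squarefree (D₃ m n)}.Infinite) ∧
      (∀ n : ℕ, Tendsto (fun m : ℕ => excessRatio (D₃ m n))
        (atTop ⊓ 𝓟 {m | Good₃ m n}) (𝓝 (rho₃ n))) ∧
      Tendsto (fun z : ℕ × ℕ => excessRatio (D₃ z.1 z.2))
        (((⊤ : Filter ℕ) ×ˢ (atTop : Filter ℕ)) ⊓ 𝓟 {z | Good₃ z.1 z.2}) (𝓝[<] (1 / 4))) ∧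
    -- the family with `D ≡ 2 mod 4`
    ((∀ m n : ℕ, 0 < m → 0 < n → (m, n) ≠ (1, 1) →
        0 < D₂ m n ∧ (Odd m → D₂ m n % 4 = 2) ∧ (Even m → D₂ m n % 4 = 0) ∧
        ¬ IsSquare (D₂ m n) ∧
        HasPeriodicExpansion (xi (D₂ m n)) (u₂ m n) (period₂ m n) ∧
        IsLeast (negNorms (D₂ m n)) (N₂ m n) ∧
        QuadraticAlgebra.norm (conv (D₂ m n) (3 + 1)) = -N₂ m n ∧
        (∀ r : ℤ, 0 ≤ r → r ≤ partialQuotient (xi (D₂ m n)) (3 + 2) →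
          QuadraticAlgebra.norm (semiconv (D₂ m n) 3 r) ≤
            QuadraticAlgebra.norm (semiconv (D₂ m n) 3 0)) ∧
        Indecomposable (semiconv (D₂ m n) 7 1) ∧
        QuadraticAlgebra.norm (semiconv (D₂ m n) 7 1) = M₂ m n ∧
        IsGreatest (semiconvNorms (D₂ m n)) (M₂ m n) ∧
        IsGreatest (indecNorms (D₂ m n)) (M₂ m n) ∧
        IsLeast (jkRoots (D₂ m n)) (jkRoot (D₂ m n)) ∧
        (Good₂ m n →
          (M₂ m n : ℝ) - jkBound (D₂ m n) = excess₂ m n ∧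
          jkBound (D₂ m n) < M₂ m n) ∧
        excessRatio (D₂ m n) < 1 / 4 - 1 / (7 * ((n : ℝ) + 2))) ∧
      (∀ n : ℕ, 0 < n → {m : ℕ | Odd m ∧ ∃ p : ℕ, p.Prime ∧ N₂ m n = p}.Infinite) ∧
      Tendsto (fun z : ℕ × ℕ => excessRatio (D₂ z.1 z.2))
        (((⊤ : Filter ℕ) ×ˢ (atTop : Filter ℕ)) ⊓ 𝓟 {z | Good₂ z.1 z.2}) (𝓝[<] (1 / 4))) ∧
    -- the family with `D ≡ 1 mod 4`
    ((∀ m n : ℕ, 0 < m → 0 < n →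
        0 < D₁ m n ∧ D₁ m n % 4 = 1 ∧ ¬ IsSquare (D₁ m n) ∧
        HasPeriodicExpansion (xi (D₁ m n)) (u₁ m n) (period₁ m n) ∧
        IsLeast (negNorms (D₁ m n)) (N₁ m n) ∧
        QuadraticAlgebra.norm (conv (D₁ m n) (5 + 1)) = -N₁ m n ∧
        (∀ r : ℤ, 0 ≤ r → r ≤ partialQuotient (xi (D₁ m n)) (5 + 2) →
          QuadraticAlgebra.norm (semiconv (D₁ m n) 5 r) ≤
            QuadraticAlgebra.norm (semiconv (D₁ m n) 5 0)) ∧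
        Indecomposable (semiconv (D₁ m n) 11 1) ∧
        QuadraticAlgebra.norm (semiconv (D₁ m n) 11 1) = M₁ m n ∧
        IsGreatest (semiconvNorms (D₁ m n)) (M₁ m n) ∧
        IsGreatest (indecNorms (D₁ m n)) (M₁ m n) ∧
        IsLeast (jkRoots (D₁ m n)) (jkRoot (D₁ m n)) ∧
        (Good₁ m n →
          (M₁ m n : ℝ) - jkBound (D₁ m n) = excess₁ m n ∧
          jkBound (D₁ m n) < M₁ m n) ∧
        excessRatio (D₁ m n) < 1 / 8 - 1 / (64 * (n : ℝ))) ∧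
      (∀ n : ℕ, 0 < n → {m : ℕ | ∃ p : ℕ, p.Prime ∧ N₁ m n = p}.Infinite) ∧
      (∀ n : ℕ, 0 < n → {m : ℕ | Squarefree (D₁ m n)}.Infinite) ∧
      Tendsto (fun z : ℕ × ℕ => excessRatio (D₁ z.1 z.2))
        (((⊤ : Filter ℕ) ×ˢ (atTop : Filter ℕ)) ⊓ 𝓟 {z | Good₁ z.1 z.2}) (𝓝[<] (1 / 8))) := by
  refine ⟨⟨family₃, infinite_prime₃, infinite_squarefree₃, tendsto_excessRatio₃,
      tendsto_excessRatio₃_quarter⟩,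
    ⟨family₂, fun n _ => infinite_prime₂ n, tendsto_excessRatio₂_quarter⟩,
    ⟨family₁, fun n _ => infinite_prime₁ n, fun n _ => infinite_squarefree₁ n,
      tendsto_excessRatio₁_eighth⟩⟩
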